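/- Let $(M,c)$ be a smooth conformal manifold of dimension $m\ge 3$ ($c$ a conformal class of smooth Riemannian metrics) and let $N\subset M$ be an embedded smooth hypersurface, of dimension $n=m-1$, with normal bundle $\nu$. Let $\nabla$ be any Weyl structure on $(M,c)$, i.e. a torsion-free connection on $TM$ that preserves $c$ (for $g\in c$, $\nabla g=\alpha\otimes g$ for some $1$-form $\alpha$). Let $R_{X,Y}=[\nabla_X,\nabla_Y]-\nabla_{[X,Y]}$ be its curvature, $\mathrm{Ric}(X,Y)=\mathrm{tr}(R_{\cdot,X}Y)$ its Ricci tensor, with trace-free symmetric part $\mathrm{Ric}^s_0$ and scalar curvature $\mathrm{scal}=\mathrm{tr}_c\mathrm{Ric}$, let $F(X,Y)=\frac1m\mathrm{tr}\,R_{X,Y}$ be its Faraday form, and let $$h^\nabla=\frac1{m-2}\mathrm{Ric}^s_0+\frac{\mathrm{scal}}{2m(m-1)}\,c-\frac12F$$ be its Schouten-Weyl tensor. Write $A=A^N+A^\perp$ for the orthogonal decomposition of $TM|_N=TN\oplus\nu$. Let $H^\nabla\in\nu^*$, $H^\nabla(\xi)=-\frac1n\mathrm{tr}\big((\nabla_\cdot\xi)^N\big)$,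 be the mean curvature, and let $B_0$ be the trace-free part of the fundamental form $B^\nabla(X,Y)=(\nabla_XY)^\perp$. Let $(\delta^\nabla B_0)(X)=\mathrm{tr}^c_{TN}\big((\nabla_\cdot B_0)(X,\cdot)\big)$, viewed in $\nu^*$ by means of $c$; here $\nabla$ acts on $H^\nabla$ and $B_0$ through the induced connections $\nabla^N=(\nabla\,\cdot)^N$ on $TN$ and $\nabla^\perp=(\nabla\,\cdot)^\perp$ on $\nu$. (Traces, orthogonality and the identification with $\nu^*$ are computed with any metric $g\in c$.) Then the mixed Schouten-Weyl tensor $\mu:TN\to\nu^*$ of $N$ in $(M,c)$, $$\mu_X(\xi)=h^\nabla(X,\xi)-(\nabla_XH^\nabla)(\xi)+\frac1{n-1}(\delta^\nabla B_0)(X)(\xi),$$ vanishes identically: $\mu_X(\xi)=0$ for every $x\in N$, $X\in T_xN$, $\xi\in\nu_x$, for every Weyl structure $\nabla$ on $(M,c)$ and every metric $g\in c$ used to compute it. -/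

import Mathlib

open Bundle Manifold
open scoped Manifold ContDiff

noncomputable section

namespace ConfGeom

/-! ### Traces on finite-dimensional real vector spaces -/

section LinearAlgebra

variable {V W : Type*} [AddCommGroup V] [Module ℝ V] [FiniteDimensional ℝ V]
  [AddCommGroup W] [Module ℝ W]

/-- The trace `∑ᵢ bⁱ(T bᵢ)` of an endomorphism `T`, computed in a basis `b` of `V`. -/
def endTrace (T : V → V) : ℝ :=
  ∑ i, (Module.finBasis ℝ V).repr (T (Module.finBasis ℝ V i)) i

/-- The Gram matrix `βᵢⱼ = β(bᵢ, bⱼ)` of a bilinear form in the basis `b` of `V`. -/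
def gram (β : V → V → ℝ) :
    Matrix (Fin (Module.finrank ℝ V)) (Fin (Module.finrank ℝ V)) ℝ :=
  Matrix.of fun i j => β (Module.finBasis ℝ V i) (Module.finBasis ℝ V j)

/-- The trace `tr_β A = ∑ᵢⱼ βⁱʲ A(bᵢ, bⱼ)` of a (scalar- or vector-valued) bilinear map `A` with
respect to an inner product `β`, where `(βⁱʲ)` is the inverse of the Gram matrix of `β`. -/
def metricTrace (β : V → V → ℝ) (A : V → V → W) : W :=
  ∑ i, ∑ j, (gram β)⁻¹ i j • A (Module.finBasis ℝ V i) (Module.finBasis ℝ V j)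

end LinearAlgebra

instance finiteDimensionalTangent {m : ℕ} {M : Type*} [TopologicalSpace M] [ChartedSpace (EuclideanSpace ℝ (Fin m)) M]
    (x : M) : FiniteDimensional ℝ (TangentSpace (𝓡 m) x) :=
  inferInstanceAs (FiniteDimensional ℝ (EuclideanSpace ℝ (Fin m)))

/-! ### Conformal structures and Weyl structures -/

section Ambient

variable (m : ℕ) (M : Type*) [TopologicalSpace M] [ChartedSpace (EuclideanSpace ℝ (Fin m)) M]
  [IsManifold (𝓡 m) ∞ M]

/-- Smooth Riemannian metrics on the `m`-dimensional manifold `M`. -/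
abbrev Metric : Type _ :=
  ContMDiffRiemannianMetric (𝓡 m) ∞ (EuclideanSpace ℝ (Fin m))
    (fun x : M => TangentSpace (𝓡 m) x)

/-- Affine connections on `M`: `D Z x v` is `∇_v Z` at the point `x`. -/
abbrev AffineConnection : Type _ :=
  CovariantDerivative (𝓡 m) (EuclideanSpace ℝ (Fin m)) (fun x : M => TangentSpace (𝓡 m) x)

/-- Two metrics are conformally equivalent if `g' = e^{2f} g` for a smooth function `f`. -/
def conformalSetoid : Setoid (Metric m M) where
  r g g' := ∃ f : M → ℝ, ContMDiff (𝓡 m) 𝓘(ℝ) ∞ f ∧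
    ∀ (x : M) (v w : TangentSpace (𝓡 m) x),
      g'.inner x v w = Real.exp (2 * f x) * g.inner x v w
  iseqv :=
    { refl := fun g => ⟨fun _ => 0, contMDiff_const, fun x v w => by simp⟩
      symm := by
        rintro g g' ⟨f, hf, h⟩
        refine ⟨fun x => -f x, hf.neg, fun x v w => ?_⟩
        rw [h, ← mul_assoc, ← Real.exp_add]
        simp
      trans := by
        rintro g g' g'' ⟨f, hf, h⟩ ⟨f', hf', h'⟩
        refine ⟨fun x => f' x + f x, hf'.add hf, fun x v w => ?_⟩
        rw [h', h, ← mul_assoc, ← Real.exp_add]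
        ring_nf }

/-- A conformal structure on `M`: a conformal class of smooth Riemannian metrics. -/
def ConformalStructure : Type _ := Quotient (conformalSetoid m M)

variable {m M}

/-- The metric `g` belongs to the conformal class `c`. -/
def ConformalStructure.Contains (c : ConformalStructure m M) (g : Metric m M) : Prop :=
  Quotient.mk (conformalSetoid m M) g = c

/-- The vector field `Y` on `M`, as a section of the tangent bundle, is differentiable at `x`. -/
abbrev DifferentiableFieldAt (Y : (y : M) → TangentSpace (𝓡 m) y) (x : M) : Prop :=
  MDifferentiableAt (𝓡 m) (𝓡 m).tangent
    (fun y => (TotalSpace.mk y (Y y) : TangentBundle (𝓡 m) M)) x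

/-- The connection `D` preserves the metric `g` up to scale: `∇ g = α ⊗ g` for a `1`-form `α`. -/
def PreservesUpToScale (D : AffineConnection m M) (g : Metric m M) : Prop :=
  ∃ α : (x : M) → TangentSpace (𝓡 m) x →L[ℝ] ℝ,
    ∀ (x : M) (Y Z : (y : M) → TangentSpace (𝓡 m) y) (v : TangentSpace (𝓡 m) x),
      DifferentiableFieldAt Y x → DifferentiableFieldAt Z x →
        mvfderiv (𝓡 m) (fun y => g.inner y (Y y) (Z y)) x v
            - g.inner x (D Y x v) (Z x) - g.inner x (Y x) (D Z x v)
          = α x v * g.inner x (Y x) (Z x)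

/-- A Weyl structure on `(M, c)`: a smooth torsion-free connection on `TM` which is conformal, i.e.
preserves up to scale the metrics of the conformal class. -/
structure WeylStructure (c : ConformalStructure m M) where
  conn : AffineConnection m M
  smooth : CovariantDerivative.ContMDiffCovariantDerivative conn ∞
  torsion_free : conn.torsion = 0
  conformal : ∀ g : Metric m M, c.Contains g → PreservesUpToScale conn g

/-- The value at `x` of a field of tangent vectors extending `v ∈ T_xM` (constant in the
trivialization of `TM` at `x`). Every tensor below is computed on such extensions. -/
abbrev ext {x : M} (v : TangentSpace (𝓡 m) x) : (y : M) → TangentSpace (𝓡 m) y :=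
  FiberBundle.extend (EuclideanSpace ℝ (Fin m)) v

/-- The curvature `R_{X,Y} Z = ∇_X ∇_Y Z - ∇_Y ∇_X Z - ∇_{[X,Y]} Z`. -/
def curvature (D : AffineConnection m M) (x : M) (X Y Z : TangentSpace (𝓡 m) x) :
    TangentSpace (𝓡 m) x :=
  D (fun y => D (ext Z) y (ext Y y)) x X - D (fun y => D (ext Z) y (ext X y)) x Y
    - D (ext Z) x (VectorField.mlieBracket (𝓡 m) (ext X) (ext Y) x)

/-- The Ricci tensor `Ric(X, Y) = tr (R_{·,X} Y)` (not symmetric in general). -/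
def ricci (D : AffineConnection m M) (x : M) (X Y : TangentSpace (𝓡 m) x) : ℝ :=
  endTrace fun Z : TangentSpace (𝓡 m) x => curvature D x Z X Y

/-- The symmetric part of the Ricci tensor. -/
def ricciSymm (D : AffineConnection m M) (x : M) (X Y : TangentSpace (𝓡 m) x) : ℝ :=
  (ricci D x X Y + ricci D x Y X) / 2

/-- The Faraday form: for a Weyl structure `R_{X,Y} = (R_{X,Y})^{skew} + F(X,Y) Id`, so that
`F(X,Y) = (1/m) tr R_{X,Y}`. -/
def faraday (D : AffineConnection m M) (x : M) (X Y : TangentSpace (𝓡 m) x) : ℝ :=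
  endTrace (fun Z : TangentSpace (𝓡 m) x => curvature D x X Y Z) / m

/-- The scalar curvature, the trace of the Ricci tensor with respect to the metric `g`. -/
def scal (g : Metric m M) (D : AffineConnection m M) (x : M) : ℝ :=
  metricTrace (fun v w : TangentSpace (𝓡 m) x => g.inner x v w) (ricci D x)

/-- The Schouten-Weyl tensor `h = (1/(m-2)) Ric₀ˢ + (scal/(2m(m-1))) g - (1/2) F` in dimension
`m ≥ 3`; `Ric₀ˢ = Ricˢ - (scal/m) g` is the trace-free symmetric part of the Ricci tensor. It
depends on `g` only through its conformal class. -/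
def schoutenWeyl (g : Metric m M) (D : AffineConnection m M) (x : M)
    (X Y : TangentSpace (𝓡 m) x) : ℝ :=
  (ricciSymm D x X Y - scal g D x / m * g.inner x X Y) / ((m : ℝ) - 2)
    + scal g D x / (2 * m * ((m : ℝ) - 1)) * g.inner x X Y - faraday D x X Y / 2

end Ambient

/-! ### Submanifolds

`N` is a submanifold of `M`, embedded by `ι`; `T_yN` is identified with its image in `T_{ι y}M`
under the differential of `ι`. -/

section Submanifold

variable {m : ℕ} (n : ℕ)
  {M : Type*} [TopologicalSpace M] [ChartedSpace (EuclideanSpace ℝ (Fin m)) M]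
  [IsManifold (𝓡 m) ∞ M]
  {N : Type*} [TopologicalSpace N] [ChartedSpace (EuclideanSpace ℝ (Fin n)) N]
  [IsManifold (𝓡 n) ∞ N]

/-- The differential `T_yN → T_{ι y}M` of `ι`. -/
abbrev push (ι : N → M) (y : N) : TangentSpace (𝓡 n) y →L[ℝ] TangentSpace (𝓡 m) (ι y) :=
  mfderiv (𝓡 n) (𝓡 m) ι y

/-- The metric on `N` induced by `g`. -/
def inducedMetric (g : Metric m M) (ι : N → M) (y : N) (v w : TangentSpace (𝓡 n) y) : ℝ :=
  g.inner (ι y) (push n ι y v) (push n ι y w)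

/-- The tangential component `A^N ∈ T_yN` of `A ∈ T_{ι y}M`: the `g`-orthogonal projection, given by
`A^N = ∑ᵢⱼ gⁱʲ g(A, bⱼ) bᵢ` in a basis `b` of `T_yN`. -/
def tangential (g : Metric m M) (ι : N → M) (y : N) (A : TangentSpace (𝓡 m) (ι y)) :
    TangentSpace (𝓡 n) y :=
  metricTrace (inducedMetric n g ι y) fun v w => g.inner (ι y) A (push n ι y w) • v

/-- The normal component `A^⊥ = A - A^N` of `A ∈ T_{ι y}M`. -/
def normal (g : Metric m M) (ι : N → M) (y : N) (A : TangentSpace (𝓡 m) (ι y)) :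
    TangentSpace (𝓡 m) (ι y) :=
  A - push n ι y (tangential n g ι y A)

/-- The normal space `ν_y`, the `g`-orthogonal complement of `T_yN` in `T_{ι y}M`. -/
def IsNormal (g : Metric m M) (ι : N → M) (y : N) (A : TangentSpace (𝓡 m) (ι y)) : Prop :=
  ∀ v : TangentSpace (𝓡 n) y, g.inner (ι y) A (push n ι y v) = 0

/-- The derivative `∇_v A`, `v ∈ T_xN`, of a vector field `A` of `M` along `ι` (the connection
induced by `∇` on `ι^*TM`). In the trivialization of `TM` at `ι x` by a frame `(s_a)`, where
`A = ∑ A^a s_a`, it is `∑ (dA^a(v) s_a + A^a ∇_{dι(v)} s_a)`. -/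
def covAlong (D : AffineConnection m M) (ι : N → M) (A : (y : N) → TangentSpace (𝓡 m) (ι y))
    (x : N) (v : TangentSpace (𝓡 n) x) : TangentSpace (𝓡 m) (ι x) :=
  letI e := trivializationAt (EuclideanSpace ℝ (Fin m))
    (fun z : M => TangentSpace (𝓡 m) z) (ι x)
  e.symm (ι x) (mvfderiv (𝓡 n) (fun y => e.continuousLinearMapAt ℝ (ι y) (A y)) x v)
    + D (ext (A x)) (ι x) (push n ι x v)

/-- The connection `∇^N_v Y = (∇_v Y)^N` induced on `N`. -/
def inducedConn (g : Metric m M) (D : AffineConnection m M) (ι : N → M)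
    (Y : (y : N) → TangentSpace (𝓡 n) y) (x : N) (v : TangentSpace (𝓡 n) x) :
    TangentSpace (𝓡 n) x :=
  tangential n g ι x (covAlong n D ι (fun y => push n ι y (Y y)) x v)

/-- The normal connection `∇^⊥_v ξ = (∇_v ξ)^⊥`. -/
def normalConn (g : Metric m M) (D : AffineConnection m M) (ι : N → M)
    (ξ : (y : N) → TangentSpace (𝓡 m) (ι y)) (x : N) (v : TangentSpace (𝓡 n) x) :
    TangentSpace (𝓡 m) (ι x) :=
  normal n g ι x (covAlong n D ι ξ x v)

/-- A field of normal vectors along `N` extending `ξ ∈ ν_x`. -/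
def normalExt (g : Metric m M) (ι : N → M) {x : N} (ξ : TangentSpace (𝓡 m) (ι x)) (y : N) :
    TangentSpace (𝓡 m) (ι y) :=
  normal n g ι y (ext ξ (ι y))

/-- The fundamental form `B(X, Y) = (∇_X Y)^⊥`. -/
def fundForm (g : Metric m M) (D : AffineConnection m M) (ι : N → M) (x : N)
    (X Y : TangentSpace (𝓡 n) x) : TangentSpace (𝓡 m) (ι x) :=
  normal n g ι x (covAlong n D ι (fun y => push n ι y (ext Y y)) x X)

/-- The trace-free part `B₀ = B - (1/n) (tr B) g` of the fundamental form. -/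
def fundFormTF (g : Metric m M) (D : AffineConnection m M) (ι : N → M) (x : N)
    (X Y : TangentSpace (𝓡 n) x) : TangentSpace (𝓡 m) (ι x) :=
  fundForm n g D ι x X Y
    - (inducedMetric n g ι x X Y / n) • metricTrace (inducedMetric n g ι x) (fundForm n g D ι x)

/-- The mean curvature `H ∈ ν^*`, `H(ξ) = -(1/n) tr ((∇_· ξ)^N)`. -/
def meanCurv (g : Metric m M) (D : AffineConnection m M) (ι : N → M) (x : N)
    (ξ : TangentSpace (𝓡 m) (ι x)) : ℝ :=
  -(endTrace fun v : TangentSpace (𝓡 n) x =>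
      tangential n g ι x (covAlong n D ι (normalExt n g ι ξ) x v)) / n

/-- `(∇_X H)(ξ) = X(H(ξ)) - H(∇^⊥_X ξ)`. -/
def covMeanCurv (g : Metric m M) (D : AffineConnection m M) (ι : N → M) (x : N)
    (X : TangentSpace (𝓡 n) x) (ξ : TangentSpace (𝓡 m) (ι x)) : ℝ :=
  mvfderiv (𝓡 n) (fun y => meanCurv n g D ι y (normalExt n g ι ξ y)) x X
    - meanCurv n g D ι x (normalConn n g D ι (normalExt n g ι ξ) x X)

/-- `(∇_Z B₀)(X, Y) = ∇^⊥_Z (B₀(X, Y)) - B₀(∇^N_Z X, Y) - B₀(X, ∇^N_Z Y)`. -/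
def covFundFormTF (g : Metric m M) (D : AffineConnection m M) (ι : N → M) (x : N)
    (Z X Y : TangentSpace (𝓡 n) x) : TangentSpace (𝓡 m) (ι x) :=
  normalConn n g D ι (fun y => fundFormTF n g D ι y (ext X y) (ext Y y)) x Z
    - fundFormTF n g D ι x (inducedConn n g D ι (ext X) x Z) Y
    - fundFormTF n g D ι x X (inducedConn n g D ι (ext Y) x Z)

/-- The codifferential `(δ B₀)(X) = tr_{TN} ((∇_· B₀)(X, ·))`, as an element of `ν^*`: the trace
with respect to `g` takes values in `ν`, and `ν` is identified with `ν^*` by `g`. -/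
def codiff (g : Metric m M) (D : AffineConnection m M) (ι : N → M) (x : N)
    (X : TangentSpace (𝓡 n) x) (ξ : TangentSpace (𝓡 m) (ι x)) : ℝ :=
  g.inner (ι x)
    (metricTrace (inducedMetric n g ι x) fun Z Y => covFundFormTF n g D ι x Z X Y) ξ

/-- The mixed Schouten-Weyl tensor
`μ_X(ξ) = h(X, ξ) - (∇_X H)(ξ) + (1/(n-1)) (δ B₀)(X)(ξ)`, for `X ∈ T_xN` and `ξ ∈ ν_x`, computed
with the connection `D`, and with the metric `g` of the conformal class as a gauge. -/
def mixedSchoutenWeyl (g : Metric m M) (D : AffineConnection m M) (ι : N → M) (x : N)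
    (X : TangentSpace (𝓡 n) x) (ξ : TangentSpace (𝓡 m) (ι x)) : ℝ :=
  schoutenWeyl g D (ι x) (push n ι x X) ξ - covMeanCurv n g D ι x X ξ
    + 1 / ((n : ℝ) - 1) * codiff n g D ι x X ξ

end Submanifold

end ConfGeom

end

/-!
The tensor `μ` is what remains of the Codazzi equation after taking a trace over `TN`. Let `ν` be a
local normal field, `b = g(B^∇, ν)` the scalar fundamental form, and `b = b₀ + H(ν) g` its
decomposition into trace-free part and mean curvature. Since `∇` is torsion-free, commuting second
covariant derivatives along `N` gives

  `(∇_Z b)(X, Y) - (∇_X b)(Z, Y) = g(R_{Z,X} Y, ν)`,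

where the derivative of `b` is corrected by the terms coming from `∇g = α ⊗ g` and from
`∇^⊥ ν = τ ⊗ ν`, so that it represents `∇B`. In terms of `b₀` and `H` this is
`LocalHypersurface.codazzi`. Now trace over `Z` and `Y`. On the left, `(δB₀)(X)(ν)` appears,
`∇_X b₀` is still trace-free (`LocalHypersurface.exists_trace_zero`), and the mean curvature
contributes `(1 - n) (∇_X H)(ν)`. On the right, `R_{Z,X}` is skew-symmetric up to `F(Z, X)` times the identity
(`localCurv_skew`, `trace_eq_of_skew`), which makes the trace equal to `-Ric(X, ν) + F(ν, X)`.
By the Bianchi identity the skew-symmetric part of `Ric` is a multiple of `F` (`localRicci_sub`), so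
that dividing by `n - 1 = m - 2` gives exactly `μ_X(ν) = 0`, the scalar curvature term being absent
because `g(X, ν) = 0`. This is `LocalHypersurface.mixed_eq_zero`, for a hypersurface `φ` of a vector
space with Christoffel symbols `Γ`, metric `G` and form `α`.

The rest of the file translates the intrinsic notions into this local form, in the charts at `x₀`
and at `ι x₀`: connections (`crd_conn`), curvature (`crd_curvature`), derivatives along `ι`
(`crd_covAlong`), tangential and normal components (`IsWeylHypersurface.crd_tangential`), mean
curvature (`IsWeylHypersurface.covMeanCurv_eq`) and the divergence of the trace-free fundamental
form (`IsWeylHypersurface.codiff_eq`). Smoothness of a connection is a property of its action on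
global sections, so the coordinate fields are cut off by a bump function to see that the Christoffel
symbols are smooth (`contDiffAt_chris`); this is where `M` has to be Hausdorff. For `ξ ≠ 0` the
normal extension of `ξ` is a nonvanishing normal field, and the local theorem applies; for `ξ = 0`
every term of `μ_X(ξ)` vanishes.
-/

noncomputable section

set_option maxSynthPendingDepth 3
set_option linter.unusedSectionVars false

namespace ConfGeom

/-! ### Traces -/

section Traces

variable {V W : Type*} [AddCommGroup V] [Module ℝ V] [FiniteDimensional ℝ V]
  [AddCommGroup W] [Module ℝ W]

lemma endTrace_eq_trace (T : V →ₗ[ℝ] V) : endTrace (fun v => T v) = LinearMap.trace ℝ V T := by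
  rw [LinearMap.trace_eq_matrix_trace ℝ (Module.finBasis ℝ V), Matrix.trace, endTrace]
  simp [LinearMap.toMatrix_apply]

/-- The trace may be computed after a linear change of coordinates. -/
lemma endTrace_conj {V' : Type*} [AddCommGroup V'] [Module ℝ V'] (e : V ≃ₗ[ℝ] V') (T : V → V)
    (T' : V' →ₗ[ℝ] V') (h : ∀ v, e (T v) = T' (e v)) :
    endTrace T = LinearMap.trace ℝ V' T' := by
  have : T = fun v => (e.symm.conj T') v := by
    funext v
    simp [LinearEquiv.conj_apply, ← h]
  rw [this, endTrace_eq_trace, LinearMap.trace_conj']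

variable {β : V → V → ℝ}

/-- The Gram matrix of a positive definite form is invertible. -/
lemma isUnit_det_gram (b : V →ₗ[ℝ] V →ₗ[ℝ] ℝ) (hpos : ∀ v, v ≠ 0 → 0 < b v v) :
    IsUnit (gram fun v w => b v w).det := by
  rw [isUnit_iff_ne_zero, Ne, ← Matrix.exists_mulVec_eq_zero_iff]
  rintro ⟨c, hc, h⟩
  set B := Module.finBasis ℝ V
  have key : ∀ i, b (B i) (∑ j, c j • B j) = 0 := by
    intro i
    have := congrFun h i
    simpa [Matrix.mulVec, dotProduct, gram, mul_comm] using this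
  have h0 : b (∑ j, c j • B j) (∑ j, c j • B j) = 0 := by
    generalize hs : ∑ j, c j • B j = s at key ⊢
    have : b s s = ∑ j, c j • b (B j) s := by
      conv_lhs => arg 1; rw [← hs]
      simp
    simp [this, key]
  have hne : (∑ j, c j • B j) ≠ 0 := by
    intro h1
    apply hc
    funext j
    exact (Fintype.linearIndependent_iff.1 B.linearIndependent c h1) j
  exact absurd h0 (hpos _ hne).ne'

/-- Raising an index: the trace with respect to `b` of the bilinear form `b (T ·) ·` is the trace
of `T`. -/
lemma metricTrace_eq_trace (b : V →ₗ[ℝ] V →ₗ[ℝ] ℝ) (hsymm : ∀ v w, b v w = b w v)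
    (hpos : ∀ v, v ≠ 0 → 0 < b v v) (T : V →ₗ[ℝ] V) (A : V → V → ℝ)
    (h : ∀ v w, A v w = b (T v) w) :
    metricTrace (fun v w => b v w) A = LinearMap.trace ℝ V T := by
  have hu := isUnit_det_gram b hpos
  rw [← endTrace_eq_trace, endTrace, metricTrace]
  refine Finset.sum_congr rfl fun i _ => ?_
  set B := Module.finBasis ℝ V
  set g := gram fun v w => b v w
  have e1 : ∀ j, A (B i) (B j) = ∑ k, g j k * B.repr (T (B i)) k := by
    intro j
    rw [h, hsymm]
    generalize T (B i) = x
    conv_lhs => rw [← B.sum_repr x]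
    simp only [map_sum, map_smul, smul_eq_mul]
    exact Finset.sum_congr rfl fun k _ => mul_comm _ _
  have e2 := congrFun (congrArg (fun N => Matrix.mulVec N (fun k => B.repr (T (B i)) k))
    (Matrix.nonsing_inv_mul g hu)) i
  simp only [← Matrix.mulVec_mulVec, Matrix.one_mulVec] at e2
  rw [← e2]
  simp [Matrix.mulVec, dotProduct, e1]

/-- The vector `∑ᵢⱼ bⁱʲ f(eⱼ) eᵢ` represents the linear form `f` with respect to `b`. -/
lemma metricTrace_smul_left (b : V →ₗ[ℝ] V →ₗ[ℝ] ℝ) (hsymm : ∀ v w, b v w = b w v)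
    (hpos : ∀ v, v ≠ 0 → 0 < b v v) (f : V →ₗ[ℝ] ℝ) (u : V) :
    b (metricTrace (fun v w => b v w) fun v w => f w • v) u = f u := by
  have hu := isUnit_det_gram b hpos
  set B := Module.finBasis ℝ V
  set g := gram fun v w => b v w
  suffices H : b (metricTrace (fun v w => b v w) fun v w => f w • v) = f by rw [H]
  refine B.ext fun k => ?_
  have e2 := congrFun (congrArg (fun N => Matrix.mulVec N (fun k => f (B k)))
    (Matrix.mul_nonsing_inv g hu)) k
  simp only [← Matrix.mulVec_mulVec, Matrix.one_mulVec] at e2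
  rw [← e2]
  simp only [metricTrace, map_sum, map_smul, LinearMap.sum_apply, LinearMap.smul_apply]
  simp only [Matrix.mulVec, dotProduct]
  refine Finset.sum_congr rfl fun i _ => ?_
  rw [Finset.mul_sum]
  refine Finset.sum_congr rfl fun j _ => ?_
  have : g k i = b (B i) (B k) := by simp [g, gram, hsymm, B]
  rw [this]
  simp only [smul_eq_mul]
  change g⁻¹ i j * (f (B j) * b (B i) (B k)) = _
  ring

lemma metricTrace_map (f : W →ₗ[ℝ] ℝ) (A : V → V → W) :
    f (metricTrace β A) = metricTrace β fun v w => f (A v w) := by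
  simp [metricTrace]

lemma metricTrace_add (A A' : V → V → W) :
    metricTrace β (fun v w => A v w + A' v w) = metricTrace β A + metricTrace β A' := by
  simp [metricTrace, Finset.sum_add_distrib]

end Traces

/-! ### Flat geometry of a torsion-free connection along a map -/

lemma two_le_infty : (2 : ℕ∞ω) ≤ ∞ := WithTop.coe_le_coe.2 (le_top : (2 : ℕ∞) ≤ ⊤)

section ProductRule

variable {X Y Z W : Type*} [NormedAddCommGroup X] [NormedSpace ℝ X] [NormedAddCommGroup Y]
  [NormedSpace ℝ Y] [NormedAddCommGroup Z] [NormedSpace ℝ Z] [NormedAddCommGroup W]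
  [NormedSpace ℝ W]

lemma fderiv_clm_apply₁ {B : X → Y →L[ℝ] W} {a : X → Y} {x : X}
    (hB : DifferentiableAt ℝ B x) (ha : DifferentiableAt ℝ a x) (v : X) :
    fderiv ℝ (fun y => B y (a y)) x v = fderiv ℝ B x v (a x) + B x (fderiv ℝ a x v) := by
  rw [(hB.hasFDerivAt.clm_apply ha.hasFDerivAt).fderiv]
  simp
  abel

lemma fderiv_clm_apply₂ {B : X → Y →L[ℝ] Z →L[ℝ] W} {a : X → Y} {c : X → Z} {x : X}
    (hB : DifferentiableAt ℝ B x) (ha : DifferentiableAt ℝ a x) (hc : DifferentiableAt ℝ c x)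
    (v : X) :
    fderiv ℝ (fun y => B y (a y) (c y)) x v
      = fderiv ℝ B x v (a x) (c x) + B x (fderiv ℝ a x v) (c x) + B x (a x) (fderiv ℝ c x v) := by
  rw [((hB.hasFDerivAt.clm_apply ha.hasFDerivAt).clm_apply hc.hasFDerivAt).fderiv]
  simp
  abel

lemma _root_.DifferentiableAt.clm_apply₂ {B : X → Y →L[ℝ] Z →L[ℝ] W} {a : X → Y} {c : X → Z}
    {x : X} (hB : DifferentiableAt ℝ B x) (ha : DifferentiableAt ℝ a x)
    (hc : DifferentiableAt ℝ c x) : DifferentiableAt ℝ (fun y => B y (a y) (c y)) x :=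
  (hB.clm_apply ha).clm_apply hc

end ProductRule

section LocalGeometry

open Filter Topology

variable {U V : Type*} [NormedAddCommGroup U] [NormedSpace ℝ U] [FiniteDimensional ℝ U]
  [NormedAddCommGroup V] [NormedSpace ℝ V] [FiniteDimensional ℝ V]

/-- The Christoffel symbols `Γ` (with `Γ z w v = ∇_v w` for a constant field `w`) are, at the point
`z`, those of a torsion-free connection with `∇ G = α ⊗ G` for a metric `G`. -/
structure IsLocalWeyl (Γ : V → V →L[ℝ] V →L[ℝ] V) (G : V → V →L[ℝ] V →L[ℝ] ℝ)
    (α : V → V →L[ℝ] ℝ) (z : V) : Prop where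
  symm : ∀ v w, Γ z v w = Γ z w v
  metric_symm : ∀ v w, G z v w = G z w v
  metric_pos : ∀ v, v ≠ 0 → 0 < G z v v
  differentiable : DifferentiableAt ℝ G z
  compat : ∀ u v w, fderiv ℝ G z u v w = G z (Γ z v u) w + G z v (Γ z w u) + α z u * G z v w

/-- The covariant derivative at `q` of a field `A` along `φ`, in terms of Christoffel symbols. -/
def covAt (Γ : V → V →L[ℝ] V →L[ℝ] V) (φ : U → V) (A : U → V) (q : U) : U →L[ℝ] V :=
  fderiv ℝ A q + (Γ (φ q) (A q)).comp (fderiv ℝ φ q)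

lemma covAt_apply (Γ : V → V →L[ℝ] V →L[ℝ] V) (φ : U → V) (A : U → V) (q v : U) :
    covAt Γ φ A q v = fderiv ℝ A q v + Γ (φ q) (A q) (fderiv ℝ φ q v) := rfl

/-- The Hessian `∇_v (dφ(w))` of `φ`, whose normal part is the fundamental form. -/
def hess (Γ : V → V →L[ℝ] V →L[ℝ] V) (φ : U → V) (q v w : U) : V :=
  covAt Γ φ (fun r => fderiv ℝ φ r w) q v

/-- The map `a ↦ G(a, dφ ·)`, that is, the transpose of `dφ` composed with `G`. -/
def pairing (G : V → V →L[ℝ] V →L[ℝ] ℝ) (φ : U → V) (q : U) : V →L[ℝ] U →L[ℝ] ℝ :=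
  ((fderiv ℝ φ q).precomp ℝ).comp (G (φ q))

/-- The tangential projection `V → U` along `φ`: the vector `u = tanProj a` is determined by
`G(dφ(u), dφ ·) = G(a, dφ ·)`. If `dφ` is not injective, the inverse has its default value `0`. -/
def tanProj (G : V → V →L[ℝ] V →L[ℝ] ℝ) (φ : U → V) (q : U) : V →L[ℝ] U :=
  ((pairing G φ q).comp (fderiv ℝ φ q)).inverse.comp (pairing G φ q)

/-- The normal component along `φ` of the constant field `ξ`. -/
def normalField (G : V → V →L[ℝ] V →L[ℝ] ℝ) (φ : U → V) (ξ : V) (q : U) : V :=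
  ξ - fderiv ℝ φ q (tanProj G φ q ξ)

variable {Γ : V → V →L[ℝ] V →L[ℝ] V} {G : V → V →L[ℝ] V →L[ℝ] ℝ} {α : V → V →L[ℝ] ℝ}
  {φ : U → V} {q : U}

lemma pairing_apply (a : V) (w : U) : pairing G φ q a w = G (φ q) a (fderiv ℝ φ q w) := rfl

/-- The compatibility `∇G = α ⊗ G`, for fields along a map. -/
lemma fderiv_metric_along (hφ : DifferentiableAt ℝ φ q) (hw : IsLocalWeyl Γ G α (φ q))
    {A C : U → V} (hA : DifferentiableAt ℝ A q) (hC : DifferentiableAt ℝ C q) (v : U) :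
    fderiv ℝ (fun r => G (φ r) (A r) (C r)) q v
      = G (φ q) (covAt Γ φ A q v) (C q) + G (φ q) (A q) (covAt Γ φ C q v)
        + α (φ q) (fderiv ℝ φ q v) * G (φ q) (A q) (C q) := by
  have hG : DifferentiableAt ℝ (fun r => G (φ r)) q := hw.differentiable.comp q hφ
  have hGd : fderiv ℝ (fun r => G (φ r)) q v = fderiv ℝ G (φ q) (fderiv ℝ φ q v) :=
    congrArg (fun f : U →L[ℝ] V →L[ℝ] V →L[ℝ] ℝ => f v) (fderiv_comp q hw.differentiable hφ)
  rw [fderiv_clm_apply₂ hG hA hC, hGd]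
  simp only [hw.compat, covAt_apply, map_add, add_apply]
  ring

/-- The pulled back metric is nondegenerate. -/
lemma exists_pairing_equiv (hw : IsLocalWeyl Γ G α (φ q))
    (hinj : Function.Injective (fderiv ℝ φ q)) :
    ∃ e : U ≃L[ℝ] (U →L[ℝ] ℝ), (e : U →L[ℝ] U →L[ℝ] ℝ) = (pairing G φ q).comp (fderiv ℝ φ q) := by
  have h1 : Function.Injective ((pairing G φ q).comp (fderiv ℝ φ q)) := by
    rw [injective_iff_map_eq_zero]
    intro w h
    by_contra hw0
    have h2 : fderiv ℝ φ q w ≠ 0 := fun h3 => hw0 (hinj (by simpa using h3))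
    have := hw.metric_pos _ h2
    have h4 := congrArg (fun f : U →L[ℝ] ℝ => f w) h
    simp only [ContinuousLinearMap.comp_apply, pairing_apply, zero_apply] at h4
    linarith
  have h2 : Module.finrank ℝ U = Module.finrank ℝ (U →L[ℝ] ℝ) := by
    rw [← LinearEquiv.finrank_eq (LinearMap.toContinuousLinearMap (𝕜 := ℝ) (E := U) (F' := ℝ))]
    exact (Subspace.dual_finrank_eq (K := ℝ) (V := U)).symm
  refine ⟨(LinearEquiv.ofInjectiveOfFinrankEq
    ((pairing G φ q).comp (fderiv ℝ φ q)).toLinearMap h1 h2).toContinuousLinearEquiv, ?_⟩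
  ext; rfl

/-- The defining property of the tangential projection. -/
lemma metric_tanProj (hw : IsLocalWeyl Γ G α (φ q)) (hinj : Function.Injective (fderiv ℝ φ q))
    (a : V) (w : U) :
    G (φ q) (fderiv ℝ φ q (tanProj G φ q a)) (fderiv ℝ φ q w) = G (φ q) a (fderiv ℝ φ q w) := by
  obtain ⟨e, he⟩ := exists_pairing_equiv hw hinj
  have h1 : ((pairing G φ q).comp (fderiv ℝ φ q)) (tanProj G φ q a) = pairing G φ q a := by
    simp only [tanProj, ← he, ContinuousLinearMap.inverse_equiv]
    simp
  exact congrArg (fun f : U →L[ℝ] ℝ => f w) h1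

lemma tanProj_unique (hw : IsLocalWeyl Γ G α (φ q)) (hinj : Function.Injective (fderiv ℝ φ q))
    (a : V) (u : U)
    (h : ∀ w, G (φ q) (fderiv ℝ φ q u) (fderiv ℝ φ q w) = G (φ q) a (fderiv ℝ φ q w)) :
    u = tanProj G φ q a := by
  obtain ⟨e, he⟩ := exists_pairing_equiv hw hinj
  apply e.injective
  have : ∀ x, e x = ((pairing G φ q).comp (fderiv ℝ φ q)) x := fun x => by rw [← he]; rfl
  rw [this, this]
  ext w
  exact (h w).trans (metric_tanProj hw hinj a w).symm

lemma normalField_orthogonal (hw : IsLocalWeyl Γ G α (φ q))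
    (hinj : Function.Injective (fderiv ℝ φ q)) (ξ : V) (w : U) :
    G (φ q) (normalField G φ ξ q) (fderiv ℝ φ q w) = 0 := by
  simp [normalField, metric_tanProj hw hinj]

/-- In codimension one, a vector is the sum of its tangential part and of its component along a
given nonzero normal vector. -/
lemma eq_tangent_add_normal (hrank : Module.finrank ℝ V = Module.finrank ℝ U + 1)
    (hw : IsLocalWeyl Γ G α (φ q)) (hinj : Function.Injective (fderiv ℝ φ q)) {ν : V}
    (hν : ∀ w, G (φ q) ν (fderiv ℝ φ q w) = 0) (hν0 : ν ≠ 0) (a : V) :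
    a = fderiv ℝ φ q (tanProj G φ q a) + (G (φ q) a ν / G (φ q) ν ν) • ν := by
  have hk := hw.metric_pos ν hν0
  let f : U × ℝ →ₗ[ℝ] V := (fderiv ℝ φ q).toLinearMap.coprod (LinearMap.toSpanSingleton ℝ V ν)
  have hf : ∀ u t, f (u, t) = fderiv ℝ φ q u + t • ν := fun u t => by simp [f]
  have hfi : Function.Injective f := by
    rw [injective_iff_map_eq_zero]
    rintro ⟨u, t⟩ h
    rw [hf] at h
    have h1 : G (φ q) ν (fderiv ℝ φ q u + t • ν) = 0 := by rw [h, map_zero]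
    rw [map_add, hν, map_smul, zero_add, smul_eq_mul] at h1
    have ht : t = 0 := by
      rcases mul_eq_zero.1 h1 with h2 | h2
      · exact h2
      · exact absurd h2 hk.ne'
    subst ht
    have : u = 0 := hinj (by simpa using h)
    rw [this]; rfl
  have hfs : Function.Surjective f := by
    rw [← LinearMap.injective_iff_surjective_of_finrank_eq_finrank]
    · exact hfi
    · simp [hrank]
  set r := a - (fderiv ℝ φ q (tanProj G φ q a) + (G (φ q) a ν / G (φ q) ν ν) • ν) with hr
  have hr0 : r = 0 := by
    by_contra hne
    have hpos := hw.metric_pos r hne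
    obtain ⟨⟨u, t⟩, hut⟩ := hfs r
    rw [hf] at hut
    have h1 : G (φ q) r (fderiv ℝ φ q u) = 0 := by
      simp [hr, metric_tanProj hw hinj, hν]
    have h2 : G (φ q) r ν = 0 := by
      have h3 : G (φ q) (fderiv ℝ φ q (tanProj G φ q a)) ν = 0 := by rw [hw.metric_symm, hν]
      simp [hr, h3, hk.ne']
    have h4 : G (φ q) r r = 0 := by
      conv_lhs => arg 2; rw [← hut]
      simp [h1, h2]
    exact hpos.ne' h4
  rw [hr, sub_eq_zero] at hr0
  exact hr0

/-- The equation of Weingarten: the tangential part of the derivative of a normal field is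
determined by the fundamental form. -/
lemma weingarten (hφ : ContDiffAt ℝ 2 φ q) (hw : IsLocalWeyl Γ G α (φ q)) {A : U → V}
    (hA : DifferentiableAt ℝ A q)
    (hn : ∀ᶠ r in 𝓝 q, ∀ w, G (φ r) (A r) (fderiv ℝ φ r w) = 0) (v w : U) :
    G (φ q) (covAt Γ φ A q v) (fderiv ℝ φ q w) = - G (φ q) (hess Γ φ q v w) (A q) := by
  have hd : DifferentiableAt ℝ (fun r => fderiv ℝ φ r w) q :=
    ((hφ.fderiv_right (m := 1) (by norm_num)).clm_apply contDiffAt_const).differentiableAt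
      one_ne_zero
  have h := fderiv_metric_along (hφ.differentiableAt two_ne_zero) hw hA hd v
  have h0 : (fun r => G (φ r) (A r) (fderiv ℝ φ r w)) =ᶠ[𝓝 q] fun _ => (0 : ℝ) :=
    hn.mono fun r hr => hr w
  rw [h0.fderiv_eq, hn.self_of_nhds w] at h
  simp only [fderiv_fun_const, Pi.zero_apply, zero_apply, mul_zero, add_zero] at h
  rw [hw.metric_symm (hess Γ φ q v w), hess]
  linarith

/-! ### Curvature in coordinates -/

/-- The curvature `R_{u,v} w` in terms of Christoffel symbols. -/
def localCurv (Γ : V → V →L[ℝ] V →L[ℝ] V) (z u v w : V) : V :=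
  fderiv ℝ Γ z u w v + Γ z (Γ z w v) u - (fderiv ℝ Γ z v w u + Γ z (Γ z w u) v)

lemma localCurv_antisymm (z u v w : V) : localCurv Γ z u v w = - localCurv Γ z v u w := by
  simp [localCurv]

/-- The first Bianchi identity. -/
lemma localCurv_bianchi {z : V} (hs : ∀ᶠ y in 𝓝 z, ∀ v w, Γ y v w = Γ y w v)
    (hΓ : DifferentiableAt ℝ Γ z) (u v w : V) :
    localCurv Γ z u v w + localCurv Γ z v w u + localCurv Γ z w u v = 0 := by
  have hd : ∀ u v w, fderiv ℝ Γ z u v w = fderiv ℝ Γ z u w v := by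
    intro u v w
    have e : (fun y => Γ y v w) =ᶠ[𝓝 z] fun y => Γ y w v := hs.mono fun y hy => hy v w
    have h1 : ∀ v w, fderiv ℝ (fun y => Γ y v w) z u = fderiv ℝ Γ z u v w := by
      intro v w
      rw [fderiv_clm_apply₂ hΓ (differentiableAt_const v) (differentiableAt_const w)]
      simp
    rw [← h1, ← h1, e.fderiv_eq]
  have hz := hs.self_of_nhds
  simp only [localCurv]
  rw [hd u w v, hd v u w, hd w v u, hz w v, hz u w, hz v u]
  abel

/-- The curvature of a Weyl connection is skew-symmetric up to a multiple of the identity. -/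
lemma localCurv_skew {z : V} (hw : ∀ᶠ y in 𝓝 z, IsLocalWeyl Γ G α y)
    (hΓ : DifferentiableAt ℝ Γ z) (hG : ContDiffAt ℝ ∞ G z) (hα : DifferentiableAt ℝ α z)
    (s t : V) : ∃ c : ℝ, ∀ v w,
      G z (localCurv Γ z s t v) w + G z v (localCurv Γ z s t w) = 2 * c * G z v w := by
  -- the constant is `-dα(s, t) / 2`, as seen by antisymmetrizing the second derivatives of `G`
  refine ⟨(fderiv ℝ α z t s - fderiv ℝ α z s t) / 2, fun v w => ?_⟩
  have hGd : DifferentiableAt ℝ G z := hG.differentiableAt (by simp)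
  have hG2 : DifferentiableAt ℝ (fderiv ℝ G) z :=
    (hG.fderiv_right (m := 1) (by norm_cast)).differentiableAt one_ne_zero
  have hsymm : ∀ s t, fderiv ℝ (fderiv ℝ G) z s t = fderiv ℝ (fderiv ℝ G) z t s :=
    fun s t => (hG.isSymmSndFDerivAt (by norm_num; exact two_le_infty)).eq s t
  have key : ∀ s t, fderiv ℝ (fderiv ℝ G) z s t v w
      = fderiv ℝ G z s (Γ z v t) w + G z (fderiv ℝ Γ z s v t) w
        + (fderiv ℝ G z s v (Γ z w t) + G z v (fderiv ℝ Γ z s w t))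
        + (fderiv ℝ α z s t * G z v w + α z t * fderiv ℝ G z s v w) := by
    intro s t
    have e : (fun y => fderiv ℝ G y t v w) =ᶠ[𝓝 z]
        fun y => G y (Γ y v t) w + G y v (Γ y w t) + α y t * G y v w :=
      hw.mono fun y hy => hy.compat t v w
    have hGt : DifferentiableAt ℝ (fun y => fderiv ℝ G y t) z :=
      hG2.clm_apply (differentiableAt_const t)
    have hGvw : DifferentiableAt ℝ (fun y => G y v w) z :=
      hGd.clm_apply₂ (differentiableAt_const v) (differentiableAt_const w)
    have hαt : DifferentiableAt ℝ (fun y => α y t) z := hα.clm_apply (differentiableAt_const t)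
    have hΓt : ∀ v, DifferentiableAt ℝ (fun y => Γ y v t) z := fun v =>
      hΓ.clm_apply₂ (differentiableAt_const v) (differentiableAt_const t)
    have dΓ : ∀ v, fderiv ℝ (fun y => Γ y v t) z s = fderiv ℝ Γ z s v t := fun v => by
      simp [fderiv_clm_apply₂ hΓ (differentiableAt_const v) (differentiableAt_const t)]
    have e1 : fderiv ℝ (fun y => fderiv ℝ G y t v w) z s = fderiv ℝ (fderiv ℝ G) z s t v w := by
      rw [fderiv_clm_apply₂ hGt (differentiableAt_const v) (differentiableAt_const w),
        fderiv_clm_apply₁ hG2 (differentiableAt_const t)]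
      simp
    have hA := hGd.clm_apply₂ (hΓt v) (differentiableAt_const w)
    have hB := hGd.clm_apply₂ (differentiableAt_const v) (hΓt w)
    have hsum : fderiv ℝ (fun y => G y (Γ y v t) w + G y v (Γ y w t) + α y t * G y v w) z s
        = fderiv ℝ (fun y => G y (Γ y v t) w) z s + fderiv ℝ (fun y => G y v (Γ y w t)) z s
          + (α z t * fderiv ℝ (fun y => G y v w) z s
            + G z v w * fderiv ℝ (fun y => α y t) z s) := by
      rw [fderiv_fun_add (hA.fun_add hB) (hαt.fun_mul hGvw), fderiv_fun_add hA hB,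
        fderiv_fun_mul hαt hGvw]
      simp
    rw [← e1, e.fderiv_eq, hsum, fderiv_clm_apply₂ hGd (hΓt v) (differentiableAt_const w),
      fderiv_clm_apply₂ hGd (differentiableAt_const v) (hΓt w),
      fderiv_clm_apply₂ hGd (differentiableAt_const v) (differentiableAt_const w),
      fderiv_clm_apply₁ hα (differentiableAt_const t), dΓ, dΓ]
    simp
    ring
  have hz := hw.self_of_nhds
  have k1 := key s t
  have k2 := key t s
  rw [hsymm s t, k2] at k1
  simp only [hz.compat] at k1
  simp only [localCurv, map_sub, map_add, sub_apply, add_apply]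
  linarith

/-- The second covariant derivatives along `φ` commute up to the curvature. -/
lemma covAt_comm (hφ : ContDiffAt ℝ ∞ φ q) (hΓ : ContDiffAt ℝ ∞ Γ (φ q)) {A : U → V}
    (hA : ContDiffAt ℝ ∞ A q) (u v : U) :
    covAt Γ φ (fun r => covAt Γ φ A r v) q u - covAt Γ φ (fun r => covAt Γ φ A r u) q v
      = localCurv Γ (φ q) (fderiv ℝ φ q u) (fderiv ℝ φ q v) (A q) := by
  have hA1 : DifferentiableAt ℝ A q := hA.differentiableAt (by simp)
  have hφ1 : DifferentiableAt ℝ φ q := hφ.differentiableAt (by simp)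
  have hA2 : DifferentiableAt ℝ (fderiv ℝ A) q :=
    (hA.fderiv_right (m := 1) (by norm_cast)).differentiableAt one_ne_zero
  have hφ2 : DifferentiableAt ℝ (fderiv ℝ φ) q :=
    (hφ.fderiv_right (m := 1) (by norm_cast)).differentiableAt one_ne_zero
  have hΓ1 : DifferentiableAt ℝ Γ (φ q) := hΓ.differentiableAt (by simp)
  have hs1 : ∀ u v, fderiv ℝ (fderiv ℝ A) q u v = fderiv ℝ (fderiv ℝ A) q v u :=
    fun u v => (hA.isSymmSndFDerivAt (by norm_num; exact two_le_infty)).eq u v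
  have hs2 : ∀ u v, fderiv ℝ (fderiv ℝ φ) q u v = fderiv ℝ (fderiv ℝ φ) q v u :=
    fun u v => (hφ.isSymmSndFDerivAt (by norm_num; exact two_le_infty)).eq u v
  have key : ∀ u v, fderiv ℝ (fun r => covAt Γ φ A r v) q u
      = fderiv ℝ (fderiv ℝ A) q u v
        + (fderiv ℝ Γ (φ q) (fderiv ℝ φ q u) (A q) (fderiv ℝ φ q v)
          + Γ (φ q) (fderiv ℝ A q u) (fderiv ℝ φ q v)
          + Γ (φ q) (A q) (fderiv ℝ (fderiv ℝ φ) q u v)) := by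
    intro u v
    have hφv : DifferentiableAt ℝ (fun r => fderiv ℝ φ r v) q :=
      hφ2.clm_apply (differentiableAt_const v)
    have hΓφ : DifferentiableAt ℝ (fun r => Γ (φ r)) q := hΓ1.comp q hφ1
    have hΓd : fderiv ℝ (fun r => Γ (φ r)) q u = fderiv ℝ Γ (φ q) (fderiv ℝ φ q u) := by
      have := fderiv_comp q hΓ1 hφ1
      exact congrArg (fun f : U →L[ℝ] V →L[ℝ] V →L[ℝ] V => f u) this
    have h0 : (fun r => covAt Γ φ A r v)
        = fun r => fderiv ℝ A r v + Γ (φ r) (A r) (fderiv ℝ φ r v) := rfl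
    rw [h0, fderiv_fun_add (hA2.clm_apply (differentiableAt_const v)) (hΓφ.clm_apply₂ hA1 hφv),
      add_apply, fderiv_clm_apply₁ hA2 (differentiableAt_const v),
      fderiv_clm_apply₂ hΓφ hA1 hφv, fderiv_clm_apply₁ hφ2 (differentiableAt_const v), hΓd]
    simp
  rw [covAt_apply Γ φ (fun r => covAt Γ φ A r v), covAt_apply Γ φ (fun r => covAt Γ φ A r u),
    key u v, key v u, hs1 u v, hs2 u v]
  simp only [localCurv, covAt_apply, map_add, add_apply]
  abel

end LocalGeometry

/-! ### The Codazzi equation of a hypersurface in a chart -/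

section LocalHypersurface

open Filter Topology

variable {U V : Type*} [NormedAddCommGroup U] [NormedSpace ℝ U] [FiniteDimensional ℝ U]
  [NormedAddCommGroup V] [NormedSpace ℝ V] [FiniteDimensional ℝ V]

/-- Near `p`, the map `φ` parametrizes a hypersurface of a space with a Weyl structure (given by its
Christoffel symbols `Γ`, a metric `G` and the form `α`), with nonvanishing normal field `ν`. -/
structure LocalHypersurface (Γ : V → V →L[ℝ] V →L[ℝ] V) (G : V → V →L[ℝ] V →L[ℝ] ℝ)
    (α : V → V →L[ℝ] ℝ) (φ : U → V) (ν : U → V) (p : U) : Prop where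
  finrank_eq : Module.finrank ℝ V = Module.finrank ℝ U + 1
  contDiffAt_chris : ContDiffAt ℝ ∞ Γ (φ p)
  contDiffAt_metric : ContDiffAt ℝ ∞ G (φ p)
  weyl : ∀ᶠ z in 𝓝 (φ p), IsLocalWeyl Γ G α z
  contDiffAt : ContDiffAt ℝ ∞ φ p
  injective : ∀ᶠ q in 𝓝 p, Function.Injective (fderiv ℝ φ q)
  contDiffAt_normal : ContDiffAt ℝ ∞ ν p
  normal : ∀ᶠ q in 𝓝 p, ∀ w, G (φ q) (ν q) (fderiv ℝ φ q w) = 0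
  normal_ne : ν p ≠ 0

/-- The scalar fundamental form `G(∇_v dφ(w), ν)`. -/
def sff (Γ : V → V →L[ℝ] V →L[ℝ] V) (G : V → V →L[ℝ] V →L[ℝ] ℝ) (φ ν : U → V) (q v w : U) : ℝ :=
  G (φ q) (hess Γ φ q v w) (ν q)

/-- The endomorphism `v ↦ (∇_v ν)^N`, the shape operator without its customary minus sign. -/
def shape (Γ : V → V →L[ℝ] V →L[ℝ] V) (G : V → V →L[ℝ] V →L[ℝ] ℝ) (φ ν : U → V) (q : U) :
    U →L[ℝ] U :=
  (tanProj G φ q).comp (covAt Γ φ ν q)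

/-- The mean curvature, evaluated on `ν`. -/
def localMean (Γ : V → V →L[ℝ] V →L[ℝ] V) (G : V → V →L[ℝ] V →L[ℝ] ℝ) (φ ν : U → V) (q : U) : ℝ :=
  -(LinearMap.trace ℝ U (shape Γ G φ ν q)) / Module.finrank ℝ U

/-- The trace-free part of the scalar fundamental form. -/
def sffTF (Γ : V → V →L[ℝ] V →L[ℝ] V) (G : V → V →L[ℝ] V →L[ℝ] ℝ) (φ ν : U → V) (q v w : U) : ℝ :=
  sff Γ G φ ν q v w - localMean Γ G φ ν q * G (φ q) (fderiv ℝ φ q v) (fderiv ℝ φ q w)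

/-- The form of the normal connection: `∇^⊥ ν = τ ⊗ ν`. -/
def normalForm (Γ : V → V →L[ℝ] V →L[ℝ] V) (G : V → V →L[ℝ] V →L[ℝ] ℝ) (φ ν : U → V) (q v : U) :
    ℝ :=
  G (φ q) (covAt Γ φ ν q v) (ν q) / G (φ q) (ν q) (ν q)

/-- For a normal-valued bilinear form `B` with `b = G(B, ν)`, this is `G((∇_v B)(w, x), ν)` in terms
of `b`: the terms with `α` and `τ = normalForm` come from `∇G = α ⊗ G` and `∇^⊥ ν = τ ⊗ ν`. -/
def covForm (Γ : V → V →L[ℝ] V →L[ℝ] V) (G : V → V →L[ℝ] V →L[ℝ] ℝ) (α : V → V →L[ℝ] ℝ)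
    (φ ν : U → V) (b : U → U → U → ℝ) (q v w x : U) : ℝ :=
  fderiv ℝ (fun r => b r w x) q v
    - (α (φ q) (fderiv ℝ φ q v) + normalForm Γ G φ ν q v) * b q w x
    - b q (tanProj G φ q (hess Γ φ q v w)) x - b q w (tanProj G φ q (hess Γ φ q v x))

/-- The covariant derivative of the mean curvature, evaluated on `ν`. -/
def covMean (Γ : V → V →L[ℝ] V →L[ℝ] V) (G : V → V →L[ℝ] V →L[ℝ] ℝ) (φ ν : U → V) (q v : U) : ℝ :=
  fderiv ℝ (localMean Γ G φ ν) q v - normalForm Γ G φ ν q v * localMean Γ G φ ν q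

variable {Γ : V → V →L[ℝ] V →L[ℝ] V} {G : V → V →L[ℝ] V →L[ℝ] ℝ} {α : V → V →L[ℝ] ℝ}
  {φ ν : U → V} {p : U}

lemma contDiffAt_fderiv {X Y : Type*} [NormedAddCommGroup X] [NormedSpace ℝ X]
    [NormedAddCommGroup Y] [NormedSpace ℝ Y] {f : X → Y} {x : X} (h : ContDiffAt ℝ ∞ f x) :
    ContDiffAt ℝ ∞ (fderiv ℝ f) x :=
  h.fderiv_right (by norm_cast)

/-- The tangential projection is smooth, as inversion of linear isomorphisms is. -/
lemma contDiffAt_tanProj (hG : ContDiffAt ℝ ∞ G (φ p)) (hw : IsLocalWeyl Γ G α (φ p))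
    (hφ : ContDiffAt ℝ ∞ φ p) (hinj : Function.Injective (fderiv ℝ φ p)) :
    ContDiffAt ℝ ∞ (tanProj G φ) p := by
  have hφ' := contDiffAt_fderiv hφ
  have h1 : ContDiffAt ℝ ∞ (pairing G φ) p := by
    refine ContDiffAt.clm_comp ?_ (hG.comp p hφ)
    exact ((ContinuousLinearMap.compL ℝ U V ℝ).flip.contDiff.contDiffAt).comp p hφ'
  obtain ⟨e, he⟩ := exists_pairing_equiv hw hinj
  refine ContDiffAt.clm_comp ?_ h1
  have h2 : ContDiffAt ℝ ∞ ContinuousLinearMap.inverse ((pairing G φ p).comp (fderiv ℝ φ p)) := by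
    rw [← he]; exact contDiffAt_map_inverse e
  exact h2.comp p (h1.clm_comp hφ')

lemma contDiffAt_normalField (hG : ContDiffAt ℝ ∞ G (φ p)) (hw : IsLocalWeyl Γ G α (φ p))
    (hφ : ContDiffAt ℝ ∞ φ p) (hinj : Function.Injective (fderiv ℝ φ p)) (ξ : V) :
    ContDiffAt ℝ ∞ (normalField G φ ξ) p :=
  contDiffAt_const.sub ((contDiffAt_fderiv hφ).clm_apply
    ((contDiffAt_tanProj hG hw hφ hinj).clm_apply contDiffAt_const))

lemma contDiffAt_covAt (hΓ : ContDiffAt ℝ ∞ Γ (φ p)) (hφ : ContDiffAt ℝ ∞ φ p) {A : U → V}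
    (hA : ContDiffAt ℝ ∞ A p) : ContDiffAt ℝ ∞ (covAt Γ φ A) p :=
  (contDiffAt_fderiv hA).add (((hΓ.comp p hφ).clm_apply hA).clm_comp (contDiffAt_fderiv hφ))

lemma contDiffAt_hess (hΓ : ContDiffAt ℝ ∞ Γ (φ p)) (hφ : ContDiffAt ℝ ∞ φ p) (v w : U) :
    ContDiffAt ℝ ∞ (fun r => hess Γ φ r v w) p :=
  (contDiffAt_covAt hΓ hφ ((contDiffAt_fderiv hφ).clm_apply contDiffAt_const)).clm_apply
    contDiffAt_const

lemma hess_apply (hφ : ContDiffAt ℝ ∞ φ p) (v w : U) :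
    hess Γ φ p v w = fderiv ℝ (fderiv ℝ φ) p v w
      + Γ (φ p) (fderiv ℝ φ p w) (fderiv ℝ φ p v) := by
  rw [hess, covAt_apply, fderiv_clm_apply₁
    ((contDiffAt_fderiv hφ).differentiableAt (by simp)) (differentiableAt_const w)]
  simp

/-- The Hessian is symmetric because the connection is torsion-free. -/
lemma hess_symm (hφ : ContDiffAt ℝ ∞ φ p) (hw : IsLocalWeyl Γ G α (φ p)) (v w : U) :
    hess Γ φ p v w = hess Γ φ p w v := by
  rw [hess_apply hφ, hess_apply hφ, hw.symm]
  congr 1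
  exact (hφ.isSymmSndFDerivAt (by norm_num; exact two_le_infty)).eq
    v w

lemma LocalHypersurface.weyl_at (h : LocalHypersurface Γ G α φ ν p) : IsLocalWeyl Γ G α (φ p) :=
  h.weyl.self_of_nhds

lemma LocalHypersurface.eventually_weyl (h : LocalHypersurface Γ G α φ ν p) :
    ∀ᶠ q in 𝓝 p, IsLocalWeyl Γ G α (φ q) :=
  h.contDiffAt.continuousAt.eventually h.weyl

lemma LocalHypersurface.eventually_contDiffAt (h : LocalHypersurface Γ G α φ ν p) :
    ∀ᶠ q in 𝓝 p, ContDiffAt ℝ 2 φ q :=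
  (h.contDiffAt.of_le two_le_infty).eventually (by simp)

lemma LocalHypersurface.contDiffAt_shape (h : LocalHypersurface Γ G α φ ν p) :
    ContDiffAt ℝ ∞ (shape Γ G φ ν) p :=
  (contDiffAt_tanProj h.contDiffAt_metric h.weyl_at h.contDiffAt h.injective.self_of_nhds).clm_comp
    (contDiffAt_covAt h.contDiffAt_chris h.contDiffAt h.contDiffAt_normal)

/-- The trace as a continuous linear form. -/
def traceCLM (U : Type*) [NormedAddCommGroup U] [NormedSpace ℝ U] [FiniteDimensional ℝ U] :
    (U →L[ℝ] U) →L[ℝ] ℝ :=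
  ((LinearMap.trace ℝ U).comp (ContinuousLinearMap.coeLM ℝ)).toContinuousLinearMap

lemma traceCLM_apply (T : U →L[ℝ] U) : traceCLM U T = LinearMap.trace ℝ U T := rfl

lemma LocalHypersurface.contDiffAt_localMean (h : LocalHypersurface Γ G α φ ν p) :
    ContDiffAt ℝ ∞ (localMean Γ G φ ν) p := by
  have h1 : ContDiffAt ℝ ∞ (fun q => traceCLM U (shape Γ G φ ν q)) p :=
    (traceCLM U).contDiff.contDiffAt.comp p h.contDiffAt_shape
  exact h1.neg.div_const _

lemma LocalHypersurface.contDiffAt_inducedMetric (h : LocalHypersurface Γ G α φ ν p) (v w : U) :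
    ContDiffAt ℝ ∞ (fun q => G (φ q) (fderiv ℝ φ q v) (fderiv ℝ φ q w)) p :=
  ((h.contDiffAt_metric.comp p h.contDiffAt).clm_apply
    ((contDiffAt_fderiv h.contDiffAt).clm_apply contDiffAt_const)).clm_apply
    ((contDiffAt_fderiv h.contDiffAt).clm_apply contDiffAt_const)

lemma LocalHypersurface.contDiffAt_sff (h : LocalHypersurface Γ G α φ ν p) (v w : U) :
    ContDiffAt ℝ ∞ (fun q => sff Γ G φ ν q v w) p :=
  ((h.contDiffAt_metric.comp p h.contDiffAt).clm_apply
    (contDiffAt_hess h.contDiffAt_chris h.contDiffAt v w)).clm_apply h.contDiffAt_normal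

lemma LocalHypersurface.contDiffAt_sffTF (h : LocalHypersurface Γ G α φ ν p) (v w : U) :
    ContDiffAt ℝ ∞ (fun q => sffTF Γ G φ ν q v w) p :=
  (h.contDiffAt_sff v w).sub (h.contDiffAt_localMean.mul (h.contDiffAt_inducedMetric v w))

/-- The Codazzi equation for the scalar fundamental form. -/
theorem LocalHypersurface.codazzi_sff (h : LocalHypersurface Γ G α φ ν p) (z x y : U) :
    covForm Γ G α φ ν (sff Γ G φ ν) p z x y - covForm Γ G α φ ν (sff Γ G φ ν) p x z y
      = G (φ p) (localCurv Γ (φ p) (fderiv ℝ φ p z) (fderiv ℝ φ p x) (fderiv ℝ φ p y)) (ν p) := by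
  have hw := h.weyl_at
  have hinj := h.injective.self_of_nhds
  have hνd : DifferentiableAt ℝ ν p := h.contDiffAt_normal.differentiableAt (by simp)
  have key : ∀ z x y, covForm Γ G α φ ν (sff Γ G φ ν) p z x y
      = G (φ p) (covAt Γ φ (fun r => hess Γ φ r x y) p z) (ν p)
        - sff Γ G φ ν p z (tanProj G φ p (hess Γ φ p x y))
        - sff Γ G φ ν p (tanProj G φ p (hess Γ φ p z x)) y
        - sff Γ G φ ν p x (tanProj G φ p (hess Γ φ p z y)) := by
    intro z x y
    have h1 : fderiv ℝ (fun r => sff Γ G φ ν r x y) p z = _ :=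
      fderiv_metric_along (h.contDiffAt.differentiableAt (by simp)) hw
        ((contDiffAt_hess h.contDiffAt_chris h.contDiffAt x y).differentiableAt (by simp)) hνd z
    have h2 : G (φ p) (hess Γ φ p x y) (covAt Γ φ ν p z)
        = - sff Γ G φ ν p z (tanProj G φ p (hess Γ φ p x y))
          + normalForm Γ G φ ν p z * sff Γ G φ ν p x y := by
      conv_lhs => rw [eq_tangent_add_normal h.finrank_eq hw hinj h.normal.self_of_nhds h.normal_ne
        (hess Γ φ p x y)]
      rw [map_add, map_smul, add_apply, smul_apply, hw.metric_symm,
        weingarten (h.contDiffAt.of_le two_le_infty) hw hνd h.normal,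
        hw.metric_symm (ν p) (covAt Γ φ ν p z), normalForm, sff, sff, smul_eq_mul]
      ring
    rw [covForm, h1, h2, sff, sff]
    ring
  have hN : hess Γ φ p z x = hess Γ φ p x z := hess_symm h.contDiffAt hw z x
  have hc := covAt_comm h.contDiffAt h.contDiffAt_chris
    (A := fun r => fderiv ℝ φ r y) ((contDiffAt_fderiv h.contDiffAt).clm_apply contDiffAt_const) z x
  rw [key, key, hN, ← hc, map_sub, sub_apply]
  simp only [hess]
  ring

/-- The covariant derivative of the pulled back metric is `α` times the metric. -/
lemma LocalHypersurface.fderiv_inducedMetric (h : LocalHypersurface Γ G α φ ν p) (z x y : U) :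
    fderiv ℝ (fun q => G (φ q) (fderiv ℝ φ q x) (fderiv ℝ φ q y)) p z
      = G (φ p) (fderiv ℝ φ p (tanProj G φ p (hess Γ φ p z x))) (fderiv ℝ φ p y)
        + G (φ p) (fderiv ℝ φ p x) (fderiv ℝ φ p (tanProj G φ p (hess Γ φ p z y)))
        + α (φ p) (fderiv ℝ φ p z) * G (φ p) (fderiv ℝ φ p x) (fderiv ℝ φ p y) := by
  have hw := h.weyl_at
  have hinj := h.injective.self_of_nhds
  have hd : ∀ x, DifferentiableAt ℝ (fun q => fderiv ℝ φ q x) p := fun x =>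
    ((contDiffAt_fderiv h.contDiffAt).clm_apply contDiffAt_const).differentiableAt (by simp)
  rw [fderiv_metric_along (h.contDiffAt.differentiableAt (by simp)) hw (hd x) (hd y),
    metric_tanProj hw hinj, hw.metric_symm (fderiv ℝ φ p x) (fderiv ℝ φ p (tanProj G φ p _)),
    metric_tanProj hw hinj, hw.metric_symm (fderiv ℝ φ p x)]
  rfl

/-- Codazzi's equation, with the fundamental form decomposed into its trace-free part and the mean
curvature. -/
theorem LocalHypersurface.codazzi (h : LocalHypersurface Γ G α φ ν p) (z x y : U) :
    (covForm Γ G α φ ν (sffTF Γ G φ ν) p z x y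
        + covMean Γ G φ ν p z * G (φ p) (fderiv ℝ φ p x) (fderiv ℝ φ p y))
      - (covForm Γ G α φ ν (sffTF Γ G φ ν) p x z y
        + covMean Γ G φ ν p x * G (φ p) (fderiv ℝ φ p z) (fderiv ℝ φ p y))
      = G (φ p) (localCurv Γ (φ p) (fderiv ℝ φ p z) (fderiv ℝ φ p x) (fderiv ℝ φ p y)) (ν p) := by
  have key : ∀ z x y, covForm Γ G α φ ν (sffTF Γ G φ ν) p z x y
        + covMean Γ G φ ν p z * G (φ p) (fderiv ℝ φ p x) (fderiv ℝ φ p y)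
      = covForm Γ G α φ ν (sff Γ G φ ν) p z x y := by
    intro z x y
    have hm := h.contDiffAt_localMean.differentiableAt (by simp)
    have hg := (h.contDiffAt_inducedMetric x y).differentiableAt (by simp)
    have hs := (h.contDiffAt_sff x y).differentiableAt (by simp)
    have h1 : fderiv ℝ (fun r => sffTF Γ G φ ν r x y) p z
        = fderiv ℝ (fun r => sff Γ G φ ν r x y) p z - (localMean Γ G φ ν p * fderiv ℝ
            (fun q => G (φ q) (fderiv ℝ φ q x) (fderiv ℝ φ q y)) p z
          + G (φ p) (fderiv ℝ φ p x) (fderiv ℝ φ p y) * fderiv ℝ (localMean Γ G φ ν) p z) := by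
      have : (fun r => sffTF Γ G φ ν r x y) = fun r => sff Γ G φ ν r x y
          - localMean Γ G φ ν r * G (φ r) (fderiv ℝ φ r x) (fderiv ℝ φ r y) := rfl
      rw [this, fderiv_fun_sub hs (hm.fun_mul hg), fderiv_fun_mul hm hg]
      simp
    rw [covForm, covForm, h1, h.fderiv_inducedMetric, covMean]
    simp only [sffTF]
    ring
  rw [key, key, h.codazzi_sff]

/-- Near `p`, the trace-free fundamental form is represented by minus the trace-free shape
operator. -/
lemma sffTF_eq (h : LocalHypersurface Γ G α φ ν p) :
    ∀ᶠ q in 𝓝 p, ∀ v w, sffTF Γ G φ ν q v w = - G (φ q)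
      (fderiv ℝ φ q ((shape Γ G φ ν q + localMean Γ G φ ν q • ContinuousLinearMap.id ℝ U) v))
      (fderiv ℝ φ q w) := by
  filter_upwards [h.eventually_weyl, h.eventually_contDiffAt, h.injective,
    h.normal.eventually_nhds, ((h.contDiffAt_normal.of_le two_le_infty).eventually (by simp))]
    with q hw hφ hi hν hd v w
  have := weingarten hφ hw (hd.differentiableAt (by simp)) hν v w
  simp only [add_apply, map_add, shape, ContinuousLinearMap.comp_apply, metric_tanProj hw hi, this,
    sffTF, sff, smul_apply, map_smul, ContinuousLinearMap.id_apply, smul_eq_mul]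
  ring

lemma trace_shape_add (hn : Module.finrank ℝ U ≠ 0) (q : U) :
    traceCLM U (shape Γ G φ ν q + localMean Γ G φ ν q • ContinuousLinearMap.id ℝ U) = 0 := by
  have h1 : traceCLM U (ContinuousLinearMap.id ℝ U) = Module.finrank ℝ U := by
    rw [traceCLM_apply]
    exact LinearMap.trace_id ℝ U
  have h2 : (Module.finrank ℝ U : ℝ) ≠ 0 := by exact_mod_cast hn
  rw [map_add, map_smul, h1, localMean, traceCLM_apply, smul_eq_mul]
  field_simp
  ring

/-- The covariant derivative of the trace-free fundamental form is trace-free in its two last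
arguments. -/
theorem LocalHypersurface.exists_trace_zero (hn : Module.finrank ℝ U ≠ 0)
    (h : LocalHypersurface Γ G α φ ν p) (z : U) :
    ∃ T : U →ₗ[ℝ] U, LinearMap.trace ℝ U T = 0 ∧ ∀ x y,
      covForm Γ G α φ ν (sffTF Γ G φ ν) p z x y
        = G (φ p) (fderiv ℝ φ p (T x)) (fderiv ℝ φ p y) := by
  have hw := h.weyl_at
  have hinj := h.injective.self_of_nhds
  have hφ' := (contDiffAt_fderiv h.contDiffAt).differentiableAt (by simp)
  set S : U → U →L[ℝ] U := fun q => shape Γ G φ ν q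
    + localMean Γ G φ ν q • ContinuousLinearMap.id ℝ U with hS
  have hSd : DifferentiableAt ℝ S p :=
    (h.contDiffAt_shape.add (h.contDiffAt_localMean.smul contDiffAt_const)).differentiableAt
      (by simp)
  have htr : ∀ q, traceCLM U (S q) = 0 := fun q => trace_shape_add hn q
  have htr' : traceCLM U (fderiv ℝ S p z) = 0 := by
    have h1 : fderiv ℝ (fun q => traceCLM U (S q)) p = (traceCLM U).comp (fderiv ℝ S p) :=
      ((traceCLM U).hasFDerivAt.comp p hSd.hasFDerivAt).fderiv
    have h2 : (fun q => traceCLM U (S q)) = fun _ => 0 := funext htr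
    rw [h2] at h1
    simpa using (congrArg (fun f : U →L[ℝ] ℝ => f z) h1).symm
  let N : U →L[ℝ] U := (tanProj G φ p).comp (fderiv ℝ (fderiv ℝ φ) p z
    + ((Γ (φ p)).flip (fderiv ℝ φ p z)).comp (fderiv ℝ φ p))
  have hN : ∀ x, N x = tanProj G φ p (hess Γ φ p z x) := fun x => by
    rw [hess_apply h.contDiffAt]; rfl
  -- `b₀ = -G(dφ(S ·), dφ ·)`, so `T` is `-∇_z S` up to a multiple of `S`, where `∇_z` acts on `S`
  -- by a derivative and a commutator
  let T : U →L[ℝ] U := (S p).comp N - N.comp (S p) - fderiv ℝ S p z + normalForm Γ G φ ν p z • S p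
  refine ⟨T, ?_, fun x y => ?_⟩
  · have hcomm : traceCLM U ((S p).comp N) = traceCLM U (N.comp (S p)) :=
      LinearMap.trace_mul_comm ℝ (S p : U →ₗ[ℝ] U) (N : U →ₗ[ℝ] U)
    change traceCLM U T = 0
    simp only [T, map_add, map_sub, map_smul, htr, htr', hcomm]
    simp
  · have hSx : DifferentiableAt ℝ (fun q => S q x) p := hSd.clm_apply (differentiableAt_const x)
    have h1 : fderiv ℝ (fun r => sffTF Γ G φ ν r x y) p z
        = - fderiv ℝ (fun q => G (φ q) (fderiv ℝ φ q (S q x)) (fderiv ℝ φ q y)) p z := by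
      have : (fun r => sffTF Γ G φ ν r x y)
          =ᶠ[𝓝 p] fun q => -G (φ q) (fderiv ℝ φ q (S q x)) (fderiv ℝ φ q y) :=
        (sffTF_eq h).mono fun q hq => hq x y
      rw [this.fderiv_eq, fderiv_fun_neg]
      rfl
    have h2 : covAt Γ φ (fun q => fderiv ℝ φ q (S q x)) p z
        = hess Γ φ p z (S p x) + fderiv ℝ φ p (fderiv ℝ S p z x) := by
      rw [covAt_apply, fderiv_clm_apply₁ hφ' hSx, hess_apply h.contDiffAt,
        fderiv_clm_apply₁ hSd (differentiableAt_const x)]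
      simp
      abel
    rw [covForm, h1, fderiv_metric_along (h.contDiffAt.differentiableAt (by simp)) hw
      (hφ'.clm_apply hSx) (hφ'.clm_apply (differentiableAt_const y)), h2]
    have h3 := (sffTF_eq h).self_of_nhds
    have h4 : covAt Γ φ (fun q => fderiv ℝ φ q y) p z = hess Γ φ p z y := rfl
    rw [h3, h3, h3, h4, ← hN, ← hN]
    have h5 : G (φ p) (hess Γ φ p z (S p x)) (fderiv ℝ φ p y)
        = G (φ p) (fderiv ℝ φ p (N (S p x))) (fderiv ℝ φ p y) := by
      rw [hN, metric_tanProj hw hinj]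
    have h6 : G (φ p) (fderiv ℝ φ p (S p x)) (hess Γ φ p z y)
        = G (φ p) (fderiv ℝ φ p (S p x)) (fderiv ℝ φ p (N y)) := by
      rw [hN, hw.metric_symm, hw.metric_symm (fderiv ℝ φ p (S p x)), metric_tanProj hw hinj]
    change _ = G (φ p) (fderiv ℝ φ p (T x)) (fderiv ℝ φ p y)
    have hT : T x = S p (N x) - N (S p x) - fderiv ℝ S p z x + normalForm Γ G φ ν p z • S p x := rfl
    have hSq : ∀ v, (shape Γ G φ ν p + localMean Γ G φ ν p • ContinuousLinearMap.id ℝ U) v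
        = S p v := fun v => rfl
    rw [hT, map_add, add_apply, h5, h6]
    simp only [hSq, map_add, map_sub, map_smul, add_apply, sub_apply, smul_apply, smul_eq_mul]
    ring

end LocalHypersurface

/-! ### The traced Codazzi equation -/

section

variable {V : Type*} [AddCommGroup V] [Module ℝ V] [FiniteDimensional ℝ V]

lemma metricTrace_swap (b : V →ₗ[ℝ] V →ₗ[ℝ] ℝ) (hsymm : ∀ v w, b v w = b w v) (A : V → V → ℝ) :
    metricTrace (fun v w => b v w) (fun v w => A w v) = metricTrace (fun v w => b v w) A := by
  have h : (gram fun v w => b v w).transpose = gram fun v w => b v w := by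
    ext i j
    simp [gram, hsymm]
  have h2 : ∀ i j, (gram fun v w => b v w)⁻¹ i j = (gram fun v w => b v w)⁻¹ j i := by
    intro i j
    conv_lhs => rw [← h, ← Matrix.transpose_nonsing_inv]
    rfl
  rw [metricTrace, metricTrace, Finset.sum_comm]
  exact Finset.sum_congr rfl fun i _ => Finset.sum_congr rfl fun j _ => by rw [h2]

/-- An endomorphism that is skew-symmetric up to `c` times the identity has trace `c · dim`. -/
lemma trace_eq_of_skew (b : V →ₗ[ℝ] V →ₗ[ℝ] ℝ) (hsymm : ∀ v w, b v w = b w v)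
    (hpos : ∀ v, v ≠ 0 → 0 < b v v) (A : V →ₗ[ℝ] V) (c : ℝ)
    (h : ∀ v w, b (A v) w + b v (A w) = 2 * c * b v w) :
    LinearMap.trace ℝ V A = Module.finrank ℝ V * c := by
  have h1 := metricTrace_eq_trace b hsymm hpos A (fun v w => b (A v) w) fun _ _ => rfl
  have h2 := metricTrace_eq_trace b hsymm hpos ((2 * c) • LinearMap.id - A)
    (fun v w => b (A w) v) fun v w => by
      have := h v w
      rw [hsymm (A w) v]
      simp
      linarith
  rw [metricTrace_swap b hsymm, h1, map_sub, map_smul, LinearMap.trace_id, smul_eq_mul] at h2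
  linarith

end

section LocalHypersurface

open Filter Topology

variable {U V : Type*} [NormedAddCommGroup U] [NormedSpace ℝ U] [FiniteDimensional ℝ U]
  [NormedAddCommGroup V] [NormedSpace ℝ V] [FiniteDimensional ℝ V]

/-- The endomorphism `u ↦ R_{u,v} w`. -/
def curvLeft (Γ : V → V →L[ℝ] V →L[ℝ] V) (z v w : V) : V →ₗ[ℝ] V where
  toFun u := localCurv Γ z u v w
  map_add' a b := by simp [localCurv]; abel
  map_smul' a b := by simp [localCurv, smul_sub]

/-- The endomorphism `w ↦ R_{u,v} w`. -/
def curvRight (Γ : V → V →L[ℝ] V →L[ℝ] V) (z u v : V) : V →ₗ[ℝ] V where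
  toFun w := localCurv Γ z u v w
  map_add' a b := by simp [localCurv]; abel
  map_smul' a b := by simp [localCurv, smul_sub]

/-- The Ricci tensor in coordinates. -/
def localRicci (Γ : V → V →L[ℝ] V →L[ℝ] V) (z v w : V) : ℝ := LinearMap.trace ℝ V (curvLeft Γ z v w)

/-- The Faraday form in coordinates. -/
def localFaraday (Γ : V → V →L[ℝ] V →L[ℝ] V) (z u v : V) : ℝ :=
  LinearMap.trace ℝ V (curvRight Γ z u v) / Module.finrank ℝ V

variable {Γ : V → V →L[ℝ] V →L[ℝ] V} {G : V → V →L[ℝ] V →L[ℝ] ℝ} {α : V → V →L[ℝ] ℝ}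
  {φ ν : U → V} {p : U}

/-- The skew-symmetric part of the Ricci tensor is a multiple of the Faraday form. -/
lemma localRicci_sub (hV : Module.finrank ℝ V ≠ 0) {z : V}
    (hs : ∀ᶠ y in 𝓝 z, ∀ v w, Γ y v w = Γ y w v) (hΓ : DifferentiableAt ℝ Γ z) (v w : V) :
    localRicci Γ z v w - localRicci Γ z w v = - (Module.finrank ℝ V * localFaraday Γ z v w) := by
  have h1 : curvLeft Γ z v w - curvLeft Γ z w v = - curvRight Γ z v w := by
    ext u
    have := localCurv_bianchi hs hΓ u v w
    have h2 := localCurv_antisymm (Γ := Γ) z w u v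
    change localCurv Γ z u v w - localCurv Γ z u w v = - localCurv Γ z v w u
    rw [h2] at this
    rw [← sub_eq_zero, ← this]
    abel
  have hV' : (Module.finrank ℝ V : ℝ) ≠ 0 := by exact_mod_cast hV
  rw [localRicci, localRicci, ← map_sub, h1, localFaraday, map_neg]
  field_simp

/-- On a finite-dimensional space, a family of linear maps is smooth if it is so pointwise. -/
lemma contDiffAt_clm_of_apply {X Y : Type*} [NormedAddCommGroup X] [NormedSpace ℝ X]
    [NormedAddCommGroup Y] [NormedSpace ℝ Y] {f : X → V →L[ℝ] Y} {x : X} {n : ℕ∞ω}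
    (h : ∀ v, ContDiffAt ℝ n (fun y => f y v) x) : ContDiffAt ℝ n f x := by
  let b := Module.finBasis ℝ V
  have : f = fun y => ∑ i, (b.coord i).toContinuousLinearMap.smulRight (f y (b i)) := by
    funext y
    ext v
    conv_lhs => rw [← b.sum_repr v]
    simp [-Module.Basis.sum_repr]
  rw [this]
  refine ContDiffAt.sum fun i _ => ?_
  exact ((ContinuousLinearMap.smulRightL ℝ V Y
    (b.coord i).toContinuousLinearMap).contDiff.contDiffAt (n := n)).comp x (h (b i))

/-- The form `α` is smooth, as it can be recovered from the metric and the connection. -/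
lemma LocalHypersurface.differentiableAt_form (h : LocalHypersurface Γ G α φ ν p) :
    DifferentiableAt ℝ α (φ p) := by
  have hw := h.weyl_at
  refine (contDiffAt_clm_of_apply (n := ∞) fun u => ?_).differentiableAt (by simp)
  have hc : ∀ v : V, ContDiffAt ℝ ∞ (fun _ : V => v) (φ p) := fun v => contDiffAt_const
  have h1 : (fun y => α y u) =ᶠ[𝓝 (φ p)] fun y =>
      (fderiv ℝ G y u (ν p) (ν p) - 2 * G y (Γ y (ν p) u) (ν p)) / G y (ν p) (ν p) := by
    filter_upwards [h.weyl] with y hy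
    have hp := hy.metric_pos _ h.normal_ne
    rw [hy.compat, hy.metric_symm (ν p) (Γ y (ν p) u)]
    field_simp
    ring
  refine ContDiffAt.congr_of_eventuallyEq ?_ h1
  refine ContDiffAt.div ?_ ((h.contDiffAt_metric.clm_apply (hc _)).clm_apply (hc _))
    (hw.metric_pos _ h.normal_ne).ne'
  refine ContDiffAt.sub ((((contDiffAt_fderiv h.contDiffAt_metric).clm_apply (hc _)).clm_apply
    (hc _)).clm_apply (hc _)) (contDiffAt_const.mul ?_)
  exact (h.contDiffAt_metric.clm_apply ((h.contDiffAt_chris.clm_apply (hc _)).clm_apply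
    (hc _))).clm_apply (hc _)

/-- A continuous bilinear form as a bilinear map. -/
def bilin {X : Type*} [NormedAddCommGroup X] [NormedSpace ℝ X] (b : X →L[ℝ] X →L[ℝ] ℝ) :
    X →ₗ[ℝ] X →ₗ[ℝ] ℝ :=
  LinearMap.mk₂ ℝ (fun v w => b v w) (by simp) (by simp) (by simp) (by simp)

/-- The vanishing of the mixed Schouten-Weyl tensor, in coordinates. -/
theorem LocalHypersurface.mixed_eq_zero (h : LocalHypersurface Γ G α φ ν p)
    (hn : 2 ≤ Module.finrank ℝ U) (x : U) :
    (localRicci Γ (φ p) (fderiv ℝ φ p x) (ν p) + localRicci Γ (φ p) (ν p) (fderiv ℝ φ p x)) / 2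
        / ((Module.finrank ℝ V : ℝ) - 2)
      - localFaraday Γ (φ p) (fderiv ℝ φ p x) (ν p) / 2 - covMean Γ G φ ν p x
      + 1 / ((Module.finrank ℝ U : ℝ) - 1)
        * metricTrace (fun v w : U => G (φ p) (fderiv ℝ φ p v) (fderiv ℝ φ p w))
          (fun z y => covForm Γ G α φ ν (sffTF Γ G φ ν) p z x y) = 0 := by
  have hw := h.weyl_at
  have hinj := h.injective.self_of_nhds
  have hν := h.normal.self_of_nhds
  have hk := hw.metric_pos _ h.normal_ne
  have hΓ : DifferentiableAt ℝ Γ (φ p) := h.contDiffAt_chris.differentiableAt (by simp)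
  have hVn : Module.finrank ℝ V ≠ 0 := by rw [h.finrank_eq]; omega
  set X := fderiv ℝ φ p x with hX
  set D := fderiv ℝ φ p with hD
  set P := tanProj G φ p
  let b : V →ₗ[ℝ] V →ₗ[ℝ] ℝ := bilin (G (φ p))
  let γ : U →ₗ[ℝ] U →ₗ[ℝ] ℝ := bilin ((pairing G φ p).comp D)
  have hγ : ∀ v w, γ v w = G (φ p) (D v) (D w) := fun v w => rfl
  have hγs : ∀ v w, γ v w = γ w v := fun v w => hw.metric_symm _ _
  have hγp : ∀ v, v ≠ 0 → 0 < γ v v := fun v hv =>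
    hw.metric_pos _ fun h0 => hv (hinj (h0.trans (map_zero D).symm))
  have hF : ∀ s t v w, G (φ p) (localCurv Γ (φ p) s t v) w + G (φ p) v (localCurv Γ (φ p) s t w)
      = 2 * localFaraday Γ (φ p) s t * G (φ p) v w := by
    intro s t
    obtain ⟨c, hc⟩ := localCurv_skew h.weyl hΓ h.contDiffAt_metric h.differentiableAt_form s t
    have := trace_eq_of_skew b hw.metric_symm hw.metric_pos (curvRight Γ (φ p) s t) c hc
    have hV' : (Module.finrank ℝ V : ℝ) ≠ 0 := by exact_mod_cast hVn
    have hcF : localFaraday Γ (φ p) s t = c := by rw [localFaraday, this]; field_simp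
    rw [hcF]
    exact hc
  -- the trace of the curvature term
  let K := curvLeft Γ (φ p) X (ν p)
  have hRic : localRicci Γ (φ p) X (ν p)
      = LinearMap.trace ℝ U (P.toLinearMap ∘ₗ K ∘ₗ D.toLinearMap)
        + localFaraday Γ (φ p) (ν p) X := by
    have hid : K = (K ∘ₗ D.toLinearMap) ∘ₗ P.toLinearMap
        + (b.flip (ν p)).smulRight ((1 / G (φ p) (ν p) (ν p)) • K (ν p)) := by
      ext a
      conv_lhs => rw [eq_tangent_add_normal h.finrank_eq hw hinj hν h.normal_ne a]
      rw [map_add, map_smul, LinearMap.add_apply, LinearMap.smulRight_apply, smul_smul,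
        div_eq_mul_one_div]
      rfl
    have hKν : G (φ p) (K (ν p)) (ν p)
        = localFaraday Γ (φ p) (ν p) X * G (φ p) (ν p) (ν p) := by
      have := hF (ν p) X (ν p) (ν p)
      rw [hw.metric_symm (ν p) (localCurv Γ (φ p) (ν p) X (ν p))] at this
      change G (φ p) (localCurv Γ (φ p) (ν p) X (ν p)) (ν p) = _
      linarith
    have hb : (b.flip (ν p)) ((1 / G (φ p) (ν p) (ν p)) • K (ν p))
        = localFaraday Γ (φ p) (ν p) X := by
      rw [map_smul, smul_eq_mul]
      change 1 / G (φ p) (ν p) (ν p) * G (φ p) (K (ν p)) (ν p) = _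
      rw [hKν]
      field_simp
    change LinearMap.trace ℝ V K = _
    conv_lhs => rw [hid]
    rw [map_add, LinearMap.trace_comp_comm', LinearMap.trace_smulRight, hb]
  have hcurv : metricTrace (fun v w => γ v w)
        (fun z y => G (φ p) (localCurv Γ (φ p) (D z) X (D y)) (ν p))
      = - localRicci Γ (φ p) X (ν p) + localFaraday Γ (φ p) (ν p) X := by
    rw [metricTrace_eq_trace γ hγs hγp (-(P.toLinearMap ∘ₗ K ∘ₗ D.toLinearMap)), map_neg, hRic]
    · ring
    · intro z y
      have h1 := hF (D z) X (D y) (ν p)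
      rw [hw.metric_symm (D y) (ν p), hν, hw.metric_symm (D y)] at h1
      rw [LinearMap.neg_apply, map_neg, LinearMap.neg_apply, hγ]
      change _ = - G (φ p) (D (P (localCurv Γ (φ p) (D z) X (ν p)))) (D y)
      rw [metric_tanProj hw hinj]
      linarith
  -- the trace of the left-hand side of Codazzi's equation
  let η : U →ₗ[ℝ] ℝ := IsLinearMap.mk' (covMean Γ G φ ν p)
    ⟨fun a c => by simp [covMean, normalForm]; ring, fun a c => by simp [covMean, normalForm]; ring⟩
  obtain ⟨T, hT0, hT⟩ := h.exists_trace_zero (by omega) x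
  have t1 : metricTrace (fun v w => γ v w) (fun z y => covMean Γ G φ ν p z * γ x y)
      = covMean Γ G φ ν p x := by
    rw [metricTrace_eq_trace γ hγs hγp (η.smulRight x), LinearMap.trace_smulRight]
    · rfl
    · intro z y
      rw [LinearMap.smulRight_apply, map_smul]
      rfl
  have t2 : metricTrace (fun v w => γ v w)
      (fun z y => covForm Γ G α φ ν (sffTF Γ G φ ν) p x z y + covMean Γ G φ ν p x * γ z y)
      = Module.finrank ℝ U * covMean Γ G φ ν p x := by
    rw [metricTrace_eq_trace γ hγs hγp (T + covMean Γ G φ ν p x • LinearMap.id), map_add, hT0,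
      map_smul, LinearMap.trace_id, smul_eq_mul]
    · ring
    · intro z y
      rw [hT, LinearMap.add_apply, LinearMap.smul_apply, map_add, map_smul]
      rfl
  have hcod : metricTrace (fun v w => γ v w)
        (fun z y => covForm Γ G α φ ν (sffTF Γ G φ ν) p z x y) + covMean Γ G φ ν p x
      = - localRicci Γ (φ p) X (ν p) + localFaraday Γ (φ p) (ν p) X
        + Module.finrank ℝ U * covMean Γ G φ ν p x := by
    rw [← t2, ← hcurv, ← metricTrace_add, ← t1, ← metricTrace_add, t1]
    congr 1
    funext z y
    have := h.codazzi z x y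
    rw [← hD, ← hX] at this
    rw [hγ, hγ]
    linarith
  have hanti := localRicci_sub hVn (h.weyl.mono fun y hy => hy.symm) hΓ X (ν p)
  have hFa : localFaraday Γ (φ p) (ν p) X = - localFaraday Γ (φ p) X (ν p) := by
    have : curvRight Γ (φ p) (ν p) X = - curvRight Γ (φ p) X (ν p) := by
      ext w
      exact localCurv_antisymm _ _ _ _
    rw [localFaraday, localFaraday, this, map_neg, neg_div]
  change _ / 2 / _ - _ / 2 - _ + 1 / _ * metricTrace (fun v w => γ v w) _ = 0
  have hn' : (Module.finrank ℝ U : ℝ) - 1 ≠ 0 := by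
    have : (2 : ℝ) ≤ Module.finrank ℝ U := by exact_mod_cast hn
    intro h0
    linarith
  rw [h.finrank_eq] at hanti ⊢
  push_cast at hanti ⊢
  -- `m - 2 = n - 1`, so all terms have the same denominator
  have e : ((Module.finrank ℝ U : ℝ) + 1) - 2 = (Module.finrank ℝ U : ℝ) - 1 := by ring
  have e2 : localRicci Γ (φ p) (ν p) X = localRicci Γ (φ p) X (ν p)
      + (Module.finrank ℝ U + 1) * localFaraday Γ (φ p) X (ν p) := by linarith
  rw [e, e2, eq_sub_of_add_eq hcod, hFa]
  field_simp
  ring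

end LocalHypersurface

/-! ### Coordinates on the tangent bundle -/

section Coordinates

open Filter Topology

variable {k : ℕ} {P : Type*} [TopologicalSpace P] [ChartedSpace (EuclideanSpace ℝ (Fin k)) P]
  [IsManifold (𝓡 k) ∞ P]

/-- The components in the trivialization of `TP` at `x₀` of a tangent vector at `y`. -/
def crd (x₀ y : P) : TangentSpace (𝓡 k) y →L[ℝ] EuclideanSpace ℝ (Fin k) :=
  (trivializationAt (EuclideanSpace ℝ (Fin k)) (fun z : P => TangentSpace (𝓡 k) z)
    x₀).continuousLinearMapAt ℝ y

/-- The tangent vector at `y` with given components in the trivialization of `TP` at `x₀`. -/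
def frm (x₀ y : P) : EuclideanSpace ℝ (Fin k) →L[ℝ] TangentSpace (𝓡 k) y :=
  (trivializationAt (EuclideanSpace ℝ (Fin k)) (fun z : P => TangentSpace (𝓡 k) z) x₀).symmL ℝ y

lemma mem_baseSet_iff (x₀ y : P) :
    y ∈ (trivializationAt (EuclideanSpace ℝ (Fin k)) (fun z : P => TangentSpace (𝓡 k) z)
      x₀).baseSet ↔ y ∈ (extChartAt (𝓡 k) x₀).source := by
  rw [TangentBundle.trivializationAt_baseSet, extChartAt_source]

lemma crd_frm {x₀ y : P} (hy : y ∈ (extChartAt (𝓡 k) x₀).source) (v : EuclideanSpace ℝ (Fin k)) :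
    crd x₀ y (frm x₀ y v) = v :=
  Trivialization.continuousLinearMapAt_symmL _ ((mem_baseSet_iff x₀ y).2 hy) v

lemma frm_crd {x₀ y : P} (hy : y ∈ (extChartAt (𝓡 k) x₀).source) (v : TangentSpace (𝓡 k) y) :
    frm x₀ y (crd x₀ y v) = v :=
  Trivialization.symmL_continuousLinearMapAt _ ((mem_baseSet_iff x₀ y).2 hy) v

/-- The local extension `ext v` is the field with constant components in the chart at the base point
of `v`. -/
lemma ext_eq_frm {x y : P} (v : TangentSpace (𝓡 k) x) (hy : y ∈ (extChartAt (𝓡 k) x).source) :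
    ext v y = frm x y (crd x x v) := by
  have h := (mem_baseSet_iff x x).2 (mem_extChartAt_source (I := 𝓡 k) x)
  rw [crd, frm, Trivialization.continuousLinearMapAt_apply,
    Trivialization.coe_linearMapAt_of_mem _ h,
    Trivialization.symmL_apply _ ((mem_baseSet_iff x y).2 hy)]
  rfl

/-- The trivialization at `x₀` is the differential of the chart at `x₀`. -/
lemma crd_eq_mfderiv {x₀ y : P} (hy : y ∈ (extChartAt (𝓡 k) x₀).source) :
    crd x₀ y = mfderiv (𝓡 k) (𝓡 k) (extChartAt (𝓡 k) x₀) y :=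
  TangentBundle.continuousLinearMapAt_trivializationAt (by rwa [extChartAt_source] at hy)

lemma frm_eq_mfderiv {x₀ : P} {q : EuclideanSpace ℝ (Fin k)}
    (hq : q ∈ (extChartAt (𝓡 k) x₀).target) :
    frm x₀ ((extChartAt (𝓡 k) x₀).symm q)
      = mfderiv (𝓡 k) (𝓡 k) (extChartAt (𝓡 k) x₀).symm q := by
  have hy := (extChartAt (𝓡 k) x₀).map_target hq
  have h := TangentBundle.symmL_trivializationAt (I := 𝓡 k) (x₀ := x₀)
    (x := (extChartAt (𝓡 k) x₀).symm q) (by rwa [extChartAt_source] at hy)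
  rw [(extChartAt (𝓡 k) x₀).right_inv hq] at h
  rw [frm, h]
  simp only [modelWithCornersSelf_coe, Set.range_id, mfderivWithin_univ]
  rfl

variable {W : Type*} [NormedAddCommGroup W] [NormedSpace ℝ W]

/-- Differentiability may be checked in the chart at any point `x₀`. -/
lemma mdifferentiableAt_iff_coord {x₀ : P} {q : EuclideanSpace ℝ (Fin k)}
    (hq : q ∈ (extChartAt (𝓡 k) x₀).target) {f : P → W} :
    MDifferentiableAt (𝓡 k) 𝓘(ℝ, W) f ((extChartAt (𝓡 k) x₀).symm q) ↔
      DifferentiableAt ℝ (fun r => f ((extChartAt (𝓡 k) x₀).symm r)) q := by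
  have hT : (extChartAt (𝓡 k) x₀).target ∈ 𝓝 q := (isOpen_extChartAt_target x₀).mem_nhds hq
  have hS := (extChartAt (𝓡 k) x₀).map_target hq
  have hsymm : MDifferentiableAt (𝓡 k) (𝓡 k) (extChartAt (𝓡 k) x₀).symm q :=
    ((contMDiffOn_extChartAt_symm (n := 1) x₀).contMDiffAt hT).mdifferentiableAt one_ne_zero
  constructor
  · intro h
    exact (h.comp q hsymm).differentiableAt
  · intro h
    have hc : MDifferentiableAt (𝓡 k) (𝓡 k) (extChartAt (𝓡 k) x₀)
        ((extChartAt (𝓡 k) x₀).symm q) :=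
      mdifferentiableAt_extChartAt (by rwa [extChartAt_source] at hS)
    have h' : MDifferentiableAt (𝓡 k) 𝓘(ℝ, W) (fun r => f ((extChartAt (𝓡 k) x₀).symm r))
        (extChartAt (𝓡 k) x₀ ((extChartAt (𝓡 k) x₀).symm q)) := by
      rw [(extChartAt (𝓡 k) x₀).right_inv hq]
      exact h.mdifferentiableAt
    refine (h'.comp _ hc).congr_of_eventuallyEq ?_
    filter_upwards [(isOpen_extChartAt_source x₀).mem_nhds hS] with y hy
    exact congrArg f ((extChartAt (𝓡 k) x₀).left_inv hy).symm

/-- Partial derivatives in the chart at `x₀` are derivatives along the coordinate fields. -/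
lemma fderiv_coord {x₀ : P} {q : EuclideanSpace ℝ (Fin k)}
    (hq : q ∈ (extChartAt (𝓡 k) x₀).target) {f : P → W}
    (hf : DifferentiableAt ℝ (fun r => f ((extChartAt (𝓡 k) x₀).symm r)) q)
    (v : EuclideanSpace ℝ (Fin k)) :
    fderiv ℝ (fun r => f ((extChartAt (𝓡 k) x₀).symm r)) q v
      = mvfderiv (𝓡 k) f ((extChartAt (𝓡 k) x₀).symm q)
        (frm x₀ ((extChartAt (𝓡 k) x₀).symm q) v) := by
  have hT : (extChartAt (𝓡 k) x₀).target ∈ 𝓝 q := (isOpen_extChartAt_target x₀).mem_nhds hq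
  have hsymm : MDifferentiableAt (𝓡 k) (𝓡 k) (extChartAt (𝓡 k) x₀).symm q :=
    ((contMDiffOn_extChartAt_symm (n := 1) x₀).contMDiffAt hT).mdifferentiableAt one_ne_zero
  have hf' := (mdifferentiableAt_iff_coord hq).2 hf
  have h := mfderiv_comp q hf' hsymm
  rw [frm_eq_mfderiv hq, ← mfderiv_eq_fderiv]
  exact congrArg (fun g : EuclideanSpace ℝ (Fin k) →L[ℝ] W => g v) h

/-- The components of a vector field, in the chart at `x₀`. -/
def crdField (x₀ : P) (Y : (y : P) → TangentSpace (𝓡 k) y) (q : EuclideanSpace ℝ (Fin k)) :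
    EuclideanSpace ℝ (Fin k) :=
  crd x₀ ((extChartAt (𝓡 k) x₀).symm q) (Y ((extChartAt (𝓡 k) x₀).symm q))

lemma differentiableFieldAt_iff {x₀ : P} {q : EuclideanSpace ℝ (Fin k)}
    (hq : q ∈ (extChartAt (𝓡 k) x₀).target) {Y : (y : P) → TangentSpace (𝓡 k) y} :
    DifferentiableFieldAt Y ((extChartAt (𝓡 k) x₀).symm q) ↔
      DifferentiableAt ℝ (crdField x₀ Y) q := by
  have hS := (extChartAt (𝓡 k) x₀).map_target hq
  rw [DifferentiableFieldAt, Trivialization.mdifferentiableAt_section_iff (𝓡 k)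
    (trivializationAt (EuclideanSpace ℝ (Fin k)) (fun z : P => TangentSpace (𝓡 k) z) x₀) Y
    ((mem_baseSet_iff _ _).2 hS), mdifferentiableAt_iff_coord hq]
  refine Filter.EventuallyEq.differentiableAt_iff ?_
  filter_upwards [(isOpen_extChartAt_target x₀).mem_nhds hq] with r hr
  rw [crdField, crd, Trivialization.continuousLinearMapAt_apply,
    Trivialization.coe_linearMapAt_of_mem _
      ((mem_baseSet_iff _ _).2 ((extChartAt (𝓡 k) x₀).map_target hr))]

lemma crdField_frm {x₀ : P} {q : EuclideanSpace ℝ (Fin k)}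
    (hq : q ∈ (extChartAt (𝓡 k) x₀).target) (v : EuclideanSpace ℝ (Fin k)) :
    crdField x₀ (fun y => frm x₀ y v) q = v :=
  crd_frm ((extChartAt (𝓡 k) x₀).map_target hq) v

/-- The frame fields of the trivialization are smooth. -/
lemma contMDiffAt_frm {x₀ y : P} (hy : y ∈ (extChartAt (𝓡 k) x₀).source)
    (v : EuclideanSpace ℝ (Fin k)) :
    ContMDiffAt (𝓡 k) (𝓡 k).tangent ∞
      (fun y => (TotalSpace.mk y (frm x₀ y v) : TangentBundle (𝓡 k) P)) y := by
  have hy' := (mem_baseSet_iff x₀ y).2 hy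
  refine (Trivialization.contMDiffAt_section_iff
    (trivializationAt (EuclideanSpace ℝ (Fin k)) (fun z : P => TangentSpace (𝓡 k) z) x₀) hy').2 ?_
  refine (contMDiffAt_const (c := v)).congr_of_eventuallyEq ?_
  filter_upwards [(isOpen_extChartAt_source x₀).mem_nhds hy] with z hz
  have := crd_frm hz v
  rwa [crd, Trivialization.continuousLinearMapAt_apply, Trivialization.coe_linearMapAt_of_mem _
      ((mem_baseSet_iff _ _).2 hz)] at this

lemma differentiableFieldAt_frm {x₀ y : P} (hy : y ∈ (extChartAt (𝓡 k) x₀).source)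
    (v : EuclideanSpace ℝ (Fin k)) : DifferentiableFieldAt (fun y => frm x₀ y v) y :=
  (contMDiffAt_frm hy v).mdifferentiableAt (by simp)

/-- The constant vector field `v` on the model space. -/
def constField (v z : EuclideanSpace ℝ (Fin k)) : TangentSpace (𝓡 k) z := v

/-- The coordinate fields commute. -/
lemma mlieBracket_frm {x₀ y : P} (hy : y ∈ (extChartAt (𝓡 k) x₀).source)
    (v w : EuclideanSpace ℝ (Fin k)) :
    VectorField.mlieBracket (𝓡 k) (fun y => frm x₀ y v) (fun y => frm x₀ y w) y = 0 := by
  have hpull : ∀ v : EuclideanSpace ℝ (Fin k), (fun y => frm x₀ y v) =ᶠ[𝓝 y]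
      VectorField.mpullback (𝓡 k) (𝓡 k) (extChartAt (𝓡 k) x₀) (constField v) := by
    intro v
    filter_upwards [(isOpen_extChartAt_source x₀).mem_nhds hy] with z hz
    rw [VectorField.mpullback_apply, ← crd_eq_mfderiv hz]
    have : (crd (k := k) x₀ z).IsInvertible := by
      refine ContinuousLinearMap.IsInvertible.of_inverse (g := frm (k := k) x₀ z) ?_ ?_
      · ext v; simp [crd_frm hz]
      · ext v; simp [frm_crd hz]
    exact (this.inverse_apply_eq.2 (crd_frm hz v).symm).symm
  rw [Filter.EventuallyEq.mlieBracket_vectorField_eq (hpull v) (hpull w)]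
  have hd : ∀ (v : EuclideanSpace ℝ (Fin k)) (z : EuclideanSpace ℝ (Fin k)),
      MDifferentiableAt (𝓡 k) (𝓡 k).tangent (fun z : EuclideanSpace ℝ (Fin k) =>
        (TotalSpace.mk z (constField v z) :
          TangentBundle (𝓡 k) (EuclideanSpace ℝ (Fin k)))) z := by
    intro v z
    exact ((contMDiffAt_vectorSpace_iff_contDiffAt (n := 1)
      (V := constField v)).2 contDiffAt_const).mdifferentiableAt one_ne_zero
  have hmin : minSmoothness ℝ 2 = 2 := minSmoothness_of_isRCLikeNormedField
  have : IsManifold (𝓡 k) (minSmoothness ℝ 2) P := by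
    rw [hmin]; exact IsManifold.of_le (n := ∞) two_le_infty
  rw [← VectorField.mpullback_mlieBracket (n := ∞) (hd v _) (hd w _)
    (contMDiffAt_extChartAt' (by rwa [extChartAt_source] at hy)) (by rw [hmin]; exact two_le_infty)]
  have h0 : VectorField.mlieBracket (𝓡 k) (constField v) (constField w) (extChartAt (𝓡 k) x₀ y)
      = 0 := by
    rw [← VectorField.mlieBracketWithin_univ, VectorField.mlieBracketWithin_eq_lieBracketWithin]
    simp only [VectorField.lieBracketWithin]
    have h : ∀ u : EuclideanSpace ℝ (Fin k), fderivWithin ℝ (constField u) Set.univ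
        (extChartAt (𝓡 k) x₀ y) = 0 := fun u => by
      change fderivWithin ℝ (fun _ : EuclideanSpace ℝ (Fin k) => u) Set.univ
        (extChartAt (𝓡 k) x₀ y) = 0
      simp
    rw [h, h]
    exact sub_self (0 : EuclideanSpace ℝ (Fin k))
  rw [VectorField.mpullback_apply, h0, map_zero]

end Coordinates

/-! ### Christoffel symbols -/

section Christoffel

open Filter Topology

variable {k : ℕ} {P : Type*} [TopologicalSpace P] [ChartedSpace (EuclideanSpace ℝ (Fin k)) P]
  [IsManifold (𝓡 k) ∞ P]

/-- The Leibniz rule for a finite sum. -/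
lemma conn_sum_smul (D : AffineConnection k P) {ι : Type*} (s : Finset ι) (f : ι → P → ℝ)
    (F : ι → (y : P) → TangentSpace (𝓡 k) y) {x : P}
    (hf : ∀ i, MDifferentiableAt (𝓡 k) 𝓘(ℝ) (f i) x) (hF : ∀ i, DifferentiableFieldAt (F i) x) :
    D (fun y => ∑ i ∈ s, f i y • F i y) x
      = ∑ i ∈ s, (f i x • D (F i) x + (mvfderiv (𝓡 k) (f i) x).smulRight (F i x)) := by
  classical
  induction s using Finset.induction_on with
  | empty =>
    simp only [Finset.sum_empty]
    exact D.isCovariantDerivativeOnUniv.zero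
  | insert a s ha ih =>
    simp only [Finset.sum_insert ha]
    have h := D.isCovariantDerivativeOnUniv.add (σ := f a • F a)
      (σ' := fun y => ∑ i ∈ s, f i y • F i y) ((hf a).smul_section (hF a))
      (MDifferentiableAt.sum_section fun i _ => (hf i).smul_section (hF i)) trivial
    rw [← ih, ← D.isCovariantDerivativeOnUniv.leibniz (hF a) (hf a) trivial]
    exact h

/-- The Christoffel symbols of `D` in the chart at `x₀`: `chris D x₀ z w v` is `∇_v e_w` where
`e_w` is the coordinate field with constant components `w`. -/
def chris (D : AffineConnection k P) (x₀ : P) (z : EuclideanSpace ℝ (Fin k)) :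
    EuclideanSpace ℝ (Fin k) →L[ℝ] EuclideanSpace ℝ (Fin k) →L[ℝ] EuclideanSpace ℝ (Fin k) :=
  ∑ i, (EuclideanSpace.proj i : EuclideanSpace ℝ (Fin k) →L[ℝ] ℝ).smulRight
    ((crd x₀ ((extChartAt (𝓡 k) x₀).symm z)).comp
      ((D (fun y => frm x₀ y (EuclideanSpace.single i 1)) ((extChartAt (𝓡 k) x₀).symm z)).comp
        (frm x₀ ((extChartAt (𝓡 k) x₀).symm z))))

lemma chris_apply (D : AffineConnection k P) (x₀ : P) (z w v : EuclideanSpace ℝ (Fin k)) :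
    chris D x₀ z w v = ∑ i, w i • crd x₀ ((extChartAt (𝓡 k) x₀).symm z)
      (D (fun y => frm x₀ y (EuclideanSpace.single i 1)) ((extChartAt (𝓡 k) x₀).symm z)
        (frm x₀ ((extChartAt (𝓡 k) x₀).symm z) v)) := by
  simp only [chris, _root_.sum_apply, smul_apply,
    ContinuousLinearMap.smulRight_apply, ContinuousLinearMap.coe_comp, Function.comp_apply]
  rfl

/-- Connections are local operators. -/
lemma conn_congr (D : AffineConnection k P) {Y Y' : (y : P) → TangentSpace (𝓡 k) y} {x : P}
    (h : DifferentiableFieldAt Y x) (h' : DifferentiableFieldAt Y' x)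
    (hY : ∀ᶠ y in 𝓝 x, Y y = Y' y) :
    D Y x = D Y' x :=
  D.isCovariantDerivativeOnUniv.congr_of_eventuallyEq h h' univ_mem hY

/-- The coordinate expression of a connection. -/
lemma crd_conn (D : AffineConnection k P) {x₀ : P} {z : EuclideanSpace ℝ (Fin k)}
    (hz : z ∈ (extChartAt (𝓡 k) x₀).target) {Y : (y : P) → TangentSpace (𝓡 k) y}
    (hY : DifferentiableAt ℝ (crdField x₀ Y) z) (v : EuclideanSpace ℝ (Fin k)) :
    crd x₀ ((extChartAt (𝓡 k) x₀).symm z) (D Y ((extChartAt (𝓡 k) x₀).symm z)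
        (frm x₀ ((extChartAt (𝓡 k) x₀).symm z) v))
      = fderiv ℝ (crdField x₀ Y) z v + chris D x₀ z (crdField x₀ Y z) v := by
  set y := (extChartAt (𝓡 k) x₀).symm z with hy
  have hS : y ∈ (extChartAt (𝓡 k) x₀).source := (extChartAt (𝓡 k) x₀).map_target hz
  let f : Fin k → P → ℝ := fun i y => (crd x₀ y (Y y)) i
  have hfd : ∀ i, DifferentiableAt ℝ (fun r => f i ((extChartAt (𝓡 k) x₀).symm r)) z := fun i =>
    (EuclideanSpace.proj (𝕜 := ℝ) i : EuclideanSpace ℝ (Fin k) →L[ℝ] ℝ).differentiableAt.comp z hY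
  have hf : ∀ i, MDifferentiableAt (𝓡 k) 𝓘(ℝ) (f i) y := fun i =>
    (mdifferentiableAt_iff_coord hz).2 (hfd i)
  have hF : ∀ i : Fin k, DifferentiableFieldAt
      (fun y => frm x₀ y (EuclideanSpace.single i (1 : ℝ))) y :=
    fun i => differentiableFieldAt_frm hS _
  have hexp : ∀ᶠ y' in 𝓝 y, Y y' = ∑ i, f i y' • frm x₀ y' (EuclideanSpace.single i (1 : ℝ)) := by
    filter_upwards [(isOpen_extChartAt_source x₀).mem_nhds hS] with y' hy'
    rw [← frm_crd hy' (Y y')]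
    conv_lhs => rw [← (EuclideanSpace.basisFun (Fin k) ℝ).sum_repr (crd x₀ y' (Y y')), map_sum]
    refine Finset.sum_congr rfl fun i _ => ?_
    rw [map_smul]
    simp [f]
  have hD := (conn_congr D ((differentiableFieldAt_iff hz).2 hY)
    (MDifferentiableAt.sum_section fun i _ => (hf i).smul_section (hF i)) hexp).trans
    (conn_sum_smul D Finset.univ f _ hf hF)
  rw [hD, chris_apply, add_comm]
  simp only [_root_.sum_apply, add_apply, smul_apply,
    ContinuousLinearMap.smulRight_apply, map_sum, map_add, map_smul, Finset.sum_add_distrib]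
  have hcomp : ∀ i, mvfderiv (𝓡 k) (f i) y (frm x₀ y v) = fderiv ℝ (crdField x₀ Y) z v i := by
    intro i
    rw [← fderiv_coord hz (hfd i) v]
    exact congrArg (fun L => L v) ((EuclideanSpace.proj (𝕜 := ℝ) i :
      EuclideanSpace ℝ (Fin k) →L[ℝ] ℝ).hasFDerivAt.comp z hY.hasFDerivAt).fderiv
  refine congrArg₂ (· + ·) rfl ((Finset.sum_congr rfl fun i _ =>
    congrArg₂ (· • ·) (hcomp i) (crd_frm hS _)).trans ?_)
  have := (EuclideanSpace.basisFun (Fin k) ℝ).sum_repr (fderiv ℝ (crdField x₀ Y) z v)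
  simpa using this

lemma hasFDerivAt_crdField_frm {x₀ : P} {z : EuclideanSpace ℝ (Fin k)}
    (hz : z ∈ (extChartAt (𝓡 k) x₀).target) (w : EuclideanSpace ℝ (Fin k)) :
    HasFDerivAt (crdField x₀ fun y => frm x₀ y w) (0 : EuclideanSpace ℝ (Fin k) →L[ℝ] _) z := by
  refine (hasFDerivAt_const w z).congr_of_eventuallyEq ?_
  filter_upwards [(isOpen_extChartAt_target x₀).mem_nhds hz] with r hr
  exact crdField_frm hr w

lemma crd_conn_frm (D : AffineConnection k P) {x₀ : P} {z : EuclideanSpace ℝ (Fin k)}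
    (hz : z ∈ (extChartAt (𝓡 k) x₀).target) (w v : EuclideanSpace ℝ (Fin k)) :
    crd x₀ ((extChartAt (𝓡 k) x₀).symm z) (D (fun y => frm x₀ y w) ((extChartAt (𝓡 k) x₀).symm z)
        (frm x₀ ((extChartAt (𝓡 k) x₀).symm z) v)) = chris D x₀ z w v := by
  have h := hasFDerivAt_crdField_frm hz w
  rw [crd_conn D hz h.differentiableAt, h.fderiv, crdField_frm hz]
  simp

/-- The Christoffel symbols of a torsion-free connection are symmetric. -/
lemma chris_symm {D : AffineConnection k P} (hD : D.torsion = 0) {x₀ : P}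
    {z : EuclideanSpace ℝ (Fin k)} (hz : z ∈ (extChartAt (𝓡 k) x₀).target)
    (v w : EuclideanSpace ℝ (Fin k)) : chris D x₀ z w v = chris D x₀ z v w := by
  have hS := (extChartAt (𝓡 k) x₀).map_target hz
  have h := (CovariantDerivative.torsion_eq_zero_iff (cov := D)).1 hD
    (differentiableFieldAt_frm hS v) (differentiableFieldAt_frm hS w)
  rw [mlieBracket_frm hS, sub_eq_zero] at h
  rw [← crd_conn_frm D hz, ← crd_conn_frm D hz, h]

/-- In the chart, a smooth section of `TP` has smooth components. -/
lemma contDiffAt_crdField {x₀ : P} {Y : (y : P) → TangentSpace (𝓡 k) y}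
    (hY : ContMDiffAt (𝓡 k) (𝓡 k).tangent ∞
      (fun y => (TotalSpace.mk y (Y y) : TangentBundle (𝓡 k) P)) x₀) :
    ContDiffAt ℝ ∞ (crdField x₀ Y) (extChartAt (𝓡 k) x₀ x₀) := by
  have hx := mem_extChartAt_source (I := 𝓡 k) x₀
  have hz := mem_extChartAt_target (I := 𝓡 k) x₀
  rw [Trivialization.contMDiffAt_section_iff
    (trivializationAt (EuclideanSpace ℝ (Fin k)) (fun z : P => TangentSpace (𝓡 k) z) x₀)
    ((mem_baseSet_iff _ _).2 hx)] at hY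
  have hsymm : ContMDiffAt (𝓡 k) (𝓡 k) ∞ (extChartAt (𝓡 k) x₀).symm (extChartAt (𝓡 k) x₀ x₀) :=
    (contMDiffOn_extChartAt_symm (n := ∞) x₀).contMDiffAt
      ((isOpen_extChartAt_target x₀).mem_nhds hz)
  refine (hY.comp_of_eq hsymm (extChartAt_to_inv x₀)).contDiffAt.congr_of_eventuallyEq ?_
  filter_upwards [(isOpen_extChartAt_target x₀).mem_nhds hz] with r hr
  rw [crdField, crd, Trivialization.continuousLinearMapAt_apply,
    Trivialization.coe_linearMapAt_of_mem _
      ((mem_baseSet_iff _ _).2 ((extChartAt (𝓡 k) x₀).map_target hr))]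
  rfl

/-- Near `x₀`, the coordinate fields agree with smooth vector fields that are defined on all
of `P`. -/
lemma exists_smooth_field [T2Space P] (x₀ : P) (w : EuclideanSpace ℝ (Fin k)) :
    ∃ Y : (y : P) → TangentSpace (𝓡 k) y, ContMDiff (𝓡 k) (𝓡 k).tangent ∞
      (fun y => (TotalSpace.mk y (Y y) : TangentBundle (𝓡 k) P)) ∧
      ∀ᶠ y in 𝓝 x₀, Y y = frm x₀ y w := by
  obtain ⟨f⟩ : Nonempty (SmoothBumpFunction (𝓡 k) x₀) := inferInstance
  refine ⟨(f : P → ℝ) • fun y => frm x₀ y w, ?_, ?_⟩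
  · exact ContMDiffOn.smul_section_of_tsupport (u := (extChartAt (𝓡 k) x₀).source)
      f.contMDiff.contMDiffOn (isOpen_extChartAt_source x₀) f.tsupport_subset_extChartAt_source
      fun y hy => (contMDiffAt_frm hy w).contMDiffWithinAt
  · filter_upwards [f.eventuallyEq_one] with y hy
    simp [hy]

/-- The Christoffel symbols of a smooth connection are smooth. -/
lemma contDiffAt_chris [T2Space P] {D : AffineConnection k P}
    (hD : CovariantDerivative.ContMDiffCovariantDerivative D ∞) (x₀ : P) :
    ContDiffAt ℝ ∞ (chris D x₀) (extChartAt (𝓡 k) x₀ x₀) := by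
  have hx := mem_extChartAt_source (I := 𝓡 k) x₀
  have hz := mem_extChartAt_target (I := 𝓡 k) x₀
  refine contDiffAt_clm_of_apply fun w => contDiffAt_clm_of_apply fun v => ?_
  obtain ⟨Y, hY, hYe⟩ := exists_smooth_field x₀ w
  have h := (hD.contMDiff.contMDiff (σ := Y) (by simpa using hY.contMDiffOn)).contMDiffAt
    (x := x₀) univ_mem
  have h2 := contDiffAt_crdField (h.clm_bundle_apply (contMDiffAt_frm hx v))
  refine h2.congr_of_eventuallyEq ?_
  have hsymm : Tendsto (extChartAt (𝓡 k) x₀).symm (𝓝 (extChartAt (𝓡 k) x₀ x₀)) (𝓝 x₀) := by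
    have := (continuousAt_extChartAt_symm (I := 𝓡 k) x₀).tendsto
    rwa [extChartAt_to_inv] at this
  filter_upwards [(isOpen_extChartAt_target x₀).mem_nhds hz,
    hsymm.eventually (eventually_eventually_nhds.2 hYe)] with r hr hr'
  rw [← crd_conn_frm D hr, crdField]
  refine congrArg (fun L : TangentSpace (𝓡 k) ((extChartAt (𝓡 k) x₀).symm r) →L[ℝ]
    TangentSpace (𝓡 k) ((extChartAt (𝓡 k) x₀).symm r) =>
    crd x₀ ((extChartAt (𝓡 k) x₀).symm r) (L (frm x₀ ((extChartAt (𝓡 k) x₀).symm r) v))) ?_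
  exact (conn_congr D (hY.mdifferentiableAt (by simp))
    (differentiableFieldAt_frm ((extChartAt (𝓡 k) x₀).map_target hr) w) hr').symm

end Christoffel

/-! ### Metric, conformal factor and curvature in a chart -/

section LocalWeylStructure

open Filter Topology

variable {k : ℕ} {P : Type*} [TopologicalSpace P] [ChartedSpace (EuclideanSpace ℝ (Fin k)) P]
  [IsManifold (𝓡 k) ∞ P]

/-- The linear isomorphism given by the components of tangent vectors at `y`. -/
def crdEquiv (x₀ : P) {y : P} (hy : y ∈ (extChartAt (𝓡 k) x₀).source) :
    TangentSpace (𝓡 k) y ≃ₗ[ℝ] EuclideanSpace ℝ (Fin k) where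
  toLinearMap := (crd (k := k) x₀ y).toLinearMap
  invFun := frm (k := k) x₀ y
  left_inv v := frm_crd hy v
  right_inv v := crd_frm hy v

lemma crdEquiv_apply (x₀ : P) {y : P} (hy : y ∈ (extChartAt (𝓡 k) x₀).source)
    (v : TangentSpace (𝓡 k) y) : crdEquiv x₀ hy v = crd x₀ y v := rfl

/-- The metric in the chart at `x₀`. -/
def locMetric (g : Metric k P) (x₀ : P) (z : EuclideanSpace ℝ (Fin k)) :
    EuclideanSpace ℝ (Fin k) →L[ℝ] EuclideanSpace ℝ (Fin k) →L[ℝ] ℝ :=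
  (ContinuousLinearMap.precomp ℝ (frm (k := k) x₀ ((extChartAt (𝓡 k) x₀).symm z))).comp
    ((g.inner ((extChartAt (𝓡 k) x₀).symm z)).comp (frm x₀ ((extChartAt (𝓡 k) x₀).symm z)))

lemma locMetric_apply (g : Metric k P) (x₀ : P) (z v w : EuclideanSpace ℝ (Fin k)) :
    locMetric g x₀ z v w = g.inner ((extChartAt (𝓡 k) x₀).symm z)
      (frm x₀ ((extChartAt (𝓡 k) x₀).symm z) v) (frm x₀ ((extChartAt (𝓡 k) x₀).symm z) w) := rfl

lemma locMetric_crd (g : Metric k P) {x₀ y : P} (hy : y ∈ (extChartAt (𝓡 k) x₀).source)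
    (v w : TangentSpace (𝓡 k) y) :
    locMetric g x₀ (extChartAt (𝓡 k) x₀ y) (crd x₀ y v) (crd x₀ y w) = g.inner y v w := by
  rw [locMetric_apply, (extChartAt (𝓡 k) x₀).left_inv hy, frm_crd hy, frm_crd hy]

/-- A `1`-form in the chart at `x₀`. -/
def locForm (α : (y : P) → TangentSpace (𝓡 k) y →L[ℝ] ℝ) (x₀ : P) (z : EuclideanSpace ℝ (Fin k)) :
    EuclideanSpace ℝ (Fin k) →L[ℝ] ℝ :=
  (α ((extChartAt (𝓡 k) x₀).symm z)).comp (frm x₀ ((extChartAt (𝓡 k) x₀).symm z))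

lemma contDiffAt_locMetric (g : Metric k P) (x₀ : P) {z : EuclideanSpace ℝ (Fin k)}
    (hz : z ∈ (extChartAt (𝓡 k) x₀).target) : ContDiffAt ℝ ∞ (locMetric g x₀) z := by
  have hS := (extChartAt (𝓡 k) x₀).map_target hz
  refine contDiffAt_clm_of_apply fun v => contDiffAt_clm_of_apply fun w => ?_
  have h : ContMDiffAt (𝓡 k) ((𝓡 k).prod 𝓘(ℝ)) ∞
      (fun y => TotalSpace.mk' ℝ (E := Bundle.Trivial P ℝ) y
        (g.inner y (frm x₀ y v) (frm x₀ y w))) ((extChartAt (𝓡 k) x₀).symm z) := by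
    apply ContMDiffAt.clm_bundle_apply₂ (F₁ := EuclideanSpace ℝ (Fin k))
      (F₂ := EuclideanSpace ℝ (Fin k))
    · exact g.contMDiff.contMDiffAt
    · exact contMDiffAt_frm hS v
    · exact contMDiffAt_frm hS w
  rw [contMDiffAt_totalSpace] at h
  have hsymm : ContMDiffAt (𝓡 k) (𝓡 k) ∞ (extChartAt (𝓡 k) x₀).symm z :=
    (contMDiffOn_extChartAt_symm (n := ∞) x₀).contMDiffAt
      ((isOpen_extChartAt_target x₀).mem_nhds hz)
  exact (h.2.comp z hsymm).contDiffAt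

/-- In a chart, a conformal torsion-free connection satisfies `IsLocalWeyl`. -/
lemma isLocalWeyl_chris {D : AffineConnection k P} (hD : D.torsion = 0) (g : Metric k P)
    {α : (x : P) → TangentSpace (𝓡 k) x →L[ℝ] ℝ}
    (hα : ∀ (x : P) (Y Z : (y : P) → TangentSpace (𝓡 k) y) (v : TangentSpace (𝓡 k) x),
      DifferentiableFieldAt Y x → DifferentiableFieldAt Z x →
        mvfderiv (𝓡 k) (fun y => g.inner y (Y y) (Z y)) x v
            - g.inner x (D Y x v) (Z x) - g.inner x (Y x) (D Z x v)
          = α x v * g.inner x (Y x) (Z x))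
    (x₀ : P) {z : EuclideanSpace ℝ (Fin k)} (hz : z ∈ (extChartAt (𝓡 k) x₀).target) :
    IsLocalWeyl (chris D x₀) (locMetric g x₀) (locForm α x₀) z where
  symm v w := chris_symm hD hz w v
  metric_symm v w := g.symm _ _ _
  metric_pos v hv := by
    refine g.pos _ _ fun h => hv ?_
    have h' : frm (k := k) x₀ ((extChartAt (𝓡 k) x₀).symm z) v = 0 := h
    rw [← crd_frm ((extChartAt (𝓡 k) x₀).map_target hz) v, h', map_zero]
  differentiable := (contDiffAt_locMetric g x₀ hz).differentiableAt (by simp)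
  compat u v w := by
    have hS := (extChartAt (𝓡 k) x₀).map_target hz
    have hd := (contDiffAt_locMetric g x₀ hz).differentiableAt (by simp)
    have h := hα ((extChartAt (𝓡 k) x₀).symm z) (fun y => frm x₀ y v) (fun y => frm x₀ y w)
      (frm x₀ ((extChartAt (𝓡 k) x₀).symm z) u) (differentiableFieldAt_frm hS v)
      (differentiableFieldAt_frm hS w)
    have hd' : DifferentiableAt ℝ (fun r => g.inner ((extChartAt (𝓡 k) x₀).symm r)
        (frm x₀ ((extChartAt (𝓡 k) x₀).symm r) v) (frm x₀ ((extChartAt (𝓡 k) x₀).symm r) w)) z :=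
      (hd.clm_apply (differentiableAt_const v)).clm_apply (differentiableAt_const w)
    rw [← fderiv_coord hz (f := fun y => g.inner y (frm x₀ y v) (frm x₀ y w)) hd' u] at h
    have hG : fderiv ℝ (fun r => g.inner ((extChartAt (𝓡 k) x₀).symm r)
        (frm x₀ ((extChartAt (𝓡 k) x₀).symm r) v) (frm x₀ ((extChartAt (𝓡 k) x₀).symm r) w)) z u
        = fderiv ℝ (locMetric g x₀) z u v w := by
      have := fderiv_clm_apply₂ hd (differentiableAt_const v) (differentiableAt_const w) u
      simp only [fderiv_const_apply, zero_apply, map_zero, add_zero] at this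
      exact this
    rw [hG] at h
    rw [← crd_conn_frm D hz, ← crd_conn_frm D hz, locMetric_apply, locMetric_apply, frm_crd hS,
      frm_crd hS, locMetric_apply]
    have h2 : locForm α x₀ z u = α ((extChartAt (𝓡 k) x₀).symm z)
      (frm x₀ ((extChartAt (𝓡 k) x₀).symm z) u) := rfl
    rw [h2]
    linarith

lemma crd_conn_of_mem (D : AffineConnection k P) {x₀ y : P}
    (hy : y ∈ (extChartAt (𝓡 k) x₀).source) {Y : (y : P) → TangentSpace (𝓡 k) y}
    (hY : DifferentiableAt ℝ (crdField x₀ Y) (extChartAt (𝓡 k) x₀ y)) (v : TangentSpace (𝓡 k) y) :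
    crd x₀ y (D Y y v) = fderiv ℝ (crdField x₀ Y) (extChartAt (𝓡 k) x₀ y) (crd x₀ y v)
      + chris D x₀ (extChartAt (𝓡 k) x₀ y) (crd x₀ y (Y y)) (crd x₀ y v) := by
  obtain ⟨z, hz, rfl⟩ : ∃ z ∈ (extChartAt (𝓡 k) x₀).target, (extChartAt (𝓡 k) x₀).symm z = y :=
    ⟨_, (extChartAt (𝓡 k) x₀).map_source hy, (extChartAt (𝓡 k) x₀).left_inv hy⟩
  rw [(extChartAt (𝓡 k) x₀).right_inv hz] at hY ⊢
  have := crd_conn D hz hY (crd x₀ ((extChartAt (𝓡 k) x₀).symm z) v)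
  rwa [frm_crd hy] at this

lemma ext_self {x : P} (v : TangentSpace (𝓡 k) x) : ext v x = v := by
  rw [ext_eq_frm v (mem_extChartAt_source x), frm_crd (mem_extChartAt_source x)]

lemma differentiableFieldAt_ext {x y : P} (v : TangentSpace (𝓡 k) x)
    (hy : y ∈ (extChartAt (𝓡 k) x).source) : DifferentiableFieldAt (ext v) y := by
  refine (differentiableFieldAt_frm hy (crd x x v)).congr_of_eventuallyEq ?_
  filter_upwards [(isOpen_extChartAt_source x).mem_nhds hy] with y' hy'
  rw [ext_eq_frm v hy']

lemma conn_ext (D : AffineConnection k P) {x y : P} (v : TangentSpace (𝓡 k) x)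
    (hy : y ∈ (extChartAt (𝓡 k) x).source) : D (ext v) y = D (fun y => frm x y (crd x x v)) y := by
  refine conn_congr D (differentiableFieldAt_ext v hy) (differentiableFieldAt_frm hy _) ?_
  filter_upwards [(isOpen_extChartAt_source x).mem_nhds hy] with y' hy'
  rw [ext_eq_frm v hy']

lemma crdField_conn_ext (D : AffineConnection k P) {x : P} (Y Z : TangentSpace (𝓡 k) x)
    {z : EuclideanSpace ℝ (Fin k)} (hz : z ∈ (extChartAt (𝓡 k) x).target) :
    crdField x (fun y => D (ext Z) y (ext Y y)) z = chris D x z (crd x x Z) (crd x x Y) := by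
  have hS := (extChartAt (𝓡 k) x).map_target hz
  rw [crdField, conn_ext D Z hS, ext_eq_frm Y hS, crd_conn_frm D hz]

/-- The curvature in the chart at its base point. -/
lemma crd_curvature [T2Space P] {D : AffineConnection k P}
    (hD : CovariantDerivative.ContMDiffCovariantDerivative D ∞) {x : P}
    (X Y Z : TangentSpace (𝓡 k) x) :
    crd x x (curvature D x X Y Z)
      = localCurv (chris D x) (extChartAt (𝓡 k) x x) (crd x x X) (crd x x Y) (crd x x Z) := by
  have hx := mem_extChartAt_source (I := 𝓡 k) x
  have hz := mem_extChartAt_target (I := 𝓡 k) x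
  have hΓ : DifferentiableAt ℝ (chris D x) (extChartAt (𝓡 k) x x) :=
    (contDiffAt_chris hD x).differentiableAt (by simp)
  have key : ∀ X Y : TangentSpace (𝓡 k) x, crd x x (D (fun y => D (ext Z) y (ext Y y)) x X)
      = fderiv ℝ (chris D x) (extChartAt (𝓡 k) x x) (crd x x X) (crd x x Z) (crd x x Y)
        + chris D x (extChartAt (𝓡 k) x x) (chris D x (extChartAt (𝓡 k) x x) (crd x x Z)
          (crd x x Y)) (crd x x X) := by
    intro X Y
    have he : crdField x (fun y => D (ext Z) y (ext Y y)) =ᶠ[𝓝 (extChartAt (𝓡 k) x x)]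
        fun z => chris D x z (crd x x Z) (crd x x Y) := by
      filter_upwards [(isOpen_extChartAt_target x).mem_nhds hz] with z hz
      exact crdField_conn_ext D Y Z hz
    have hd : DifferentiableAt ℝ (fun z => chris D x z (crd x x Z) (crd x x Y))
        (extChartAt (𝓡 k) x x) :=
      (hΓ.clm_apply (differentiableAt_const _)).clm_apply (differentiableAt_const _)
    rw [crd_conn_of_mem D hx (hd.congr_of_eventuallyEq he), he.fderiv_eq, fderiv_clm_apply₂ hΓ
      (differentiableAt_const _) (differentiableAt_const _)]
    have h2 := he.self_of_nhds
    rw [crdField, extChartAt_to_inv] at h2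
    rw [h2]
    simp only [fderiv_const_apply, zero_apply, map_zero, add_zero]
  have hbr : VectorField.mlieBracket (𝓡 k) (ext X) (ext Y) x = 0 := by
    have he : ∀ V : TangentSpace (𝓡 k) x, ext V =ᶠ[𝓝 x] fun y => frm x y (crd x x V) := by
      intro V
      filter_upwards [(isOpen_extChartAt_source x).mem_nhds hx] with y hy
      exact ext_eq_frm V hy
    rw [Filter.EventuallyEq.mlieBracket_vectorField_eq (he X) (he Y), mlieBracket_frm hx]
  rw [curvature, hbr, map_zero, sub_zero, map_sub, key, key, localCurv]

lemma ricci_eq [T2Space P] {D : AffineConnection k P}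
    (hD : CovariantDerivative.ContMDiffCovariantDerivative D ∞) {x : P}
    (X Y : TangentSpace (𝓡 k) x) :
    ricci D x X Y
      = localRicci (chris D x) (extChartAt (𝓡 k) x x) (crd x x X) (crd x x Y) :=
  endTrace_conj (crdEquiv x (mem_extChartAt_source x)) _ _ fun Z => crd_curvature hD Z X Y

lemma faraday_eq [T2Space P] {D : AffineConnection k P}
    (hD : CovariantDerivative.ContMDiffCovariantDerivative D ∞) {x : P}
    (X Y : TangentSpace (𝓡 k) x) :
    faraday D x X Y
      = localFaraday (chris D x) (extChartAt (𝓡 k) x x) (crd x x X) (crd x x Y) := by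
  rw [faraday, localFaraday, finrank_euclideanSpace_fin]
  exact congrArg (· / (k : ℝ)) (endTrace_conj (crdEquiv x (mem_extChartAt_source x)) _ _
    fun Z => crd_curvature hD X Y Z)

end LocalWeylStructure

/-! ### Differentiation along a map in coordinates -/

section Along

open Filter Topology

lemma differentiableAt_clm_of_apply {X Y V : Type*} [NormedAddCommGroup X] [NormedSpace ℝ X]
    [NormedAddCommGroup Y] [NormedSpace ℝ Y] [NormedAddCommGroup V] [NormedSpace ℝ V]
    [FiniteDimensional ℝ V] {f : X → V →L[ℝ] Y} {x : X}
    (h : ∀ v, DifferentiableAt ℝ (fun y => f y v) x) : DifferentiableAt ℝ f x := by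
  let b := Module.finBasis ℝ V
  have : f = fun y => ∑ i, (b.coord i).toContinuousLinearMap.smulRight (f y (b i)) := by
    funext y
    ext v
    conv_lhs => rw [← b.sum_repr v, map_sum]
    simp
  rw [this]
  refine DifferentiableAt.fun_sum fun i _ => ?_
  exact ((ContinuousLinearMap.smulRightL ℝ V Y (b.coord i).toContinuousLinearMap)
    |>.differentiableAt).comp x (h (b i))

section

variable {k : ℕ} {P : Type*} [TopologicalSpace P] [ChartedSpace (EuclideanSpace ℝ (Fin k)) P]
  [IsManifold (𝓡 k) ∞ P]

/-- The transition functions between the trivializations at two points are differentiable. -/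
lemma differentiableAt_transition {x₀ x₁ x₂ : P} {z : EuclideanSpace ℝ (Fin k)}
    (hz : z ∈ (extChartAt (𝓡 k) x₀).target)
    (h₁ : (extChartAt (𝓡 k) x₀).symm z ∈ (extChartAt (𝓡 k) x₁).source)
    (h₂ : (extChartAt (𝓡 k) x₀).symm z ∈ (extChartAt (𝓡 k) x₂).source) :
    DifferentiableAt ℝ (fun r => (crd (k := k) x₁ ((extChartAt (𝓡 k) x₀).symm r)).comp
      (frm (k := k) x₂ ((extChartAt (𝓡 k) x₀).symm r))) z := by
  refine differentiableAt_clm_of_apply fun c => ?_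
  have h := differentiableFieldAt_frm h₂ c
  rw [DifferentiableFieldAt, Trivialization.mdifferentiableAt_section_iff (𝓡 k)
    (trivializationAt (EuclideanSpace ℝ (Fin k)) (fun z : P => TangentSpace (𝓡 k) z) x₁) _
    ((mem_baseSet_iff _ _).2 h₁)] at h
  have h' : MDifferentiableAt (𝓡 k) 𝓘(ℝ, EuclideanSpace ℝ (Fin k))
      (fun y => crd x₁ y (frm x₂ y c)) ((extChartAt (𝓡 k) x₀).symm z) := by
    refine h.congr_of_eventuallyEq ?_
    filter_upwards [(isOpen_extChartAt_source x₁).mem_nhds h₁] with y hy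
    rw [crd, Trivialization.continuousLinearMapAt_apply,
      Trivialization.coe_linearMapAt_of_mem _ ((mem_baseSet_iff _ _).2 hy)]
  exact (mdifferentiableAt_iff_coord hz).1 h'

end

variable {m : ℕ} {n : ℕ}
  {M : Type*} [TopologicalSpace M] [ChartedSpace (EuclideanSpace ℝ (Fin m)) M]
  [IsManifold (𝓡 m) ∞ M]
  {N : Type*} [TopologicalSpace N] [ChartedSpace (EuclideanSpace ℝ (Fin n)) N]
  [IsManifold (𝓡 n) ∞ N]

/-- The map `ι` in the charts at `x₀` and `ι x₀`. -/
def locMap (ι : N → M) (x₀ : N) (q : EuclideanSpace ℝ (Fin n)) : EuclideanSpace ℝ (Fin m) :=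
  extChartAt (𝓡 m) (ι x₀) (ι ((extChartAt (𝓡 n) x₀).symm q))

/-- The open set where the coordinate expression `locMap` of `ι` is meaningful. -/
def locDom (ι : N → M) (x₀ : N) : Set (EuclideanSpace ℝ (Fin n)) :=
  (extChartAt (𝓡 n) x₀).target ∩
    (fun q => ι ((extChartAt (𝓡 n) x₀).symm q)) ⁻¹' (extChartAt (𝓡 m) (ι x₀)).source

lemma isOpen_locDom {ι : N → M} (hι : Continuous ι) (x₀ : N) :
    IsOpen (locDom (m := m) (n := n) ι x₀) :=
  (hι.comp_continuousOn (continuousOn_extChartAt_symm x₀)).isOpen_inter_preimage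
    (isOpen_extChartAt_target x₀) (isOpen_extChartAt_source _)

lemma mem_locDom (ι : N → M) (x₀ : N) : extChartAt (𝓡 n) x₀ x₀ ∈ locDom (m := m) (n := n) ι x₀ :=
  ⟨mem_extChartAt_target x₀, by simp⟩

lemma contDiffAt_locMap {ι : N → M} (hι : ContMDiff (𝓡 n) (𝓡 m) ∞ ι) {x₀ : N}
    {q : EuclideanSpace ℝ (Fin n)} (hq : q ∈ locDom (m := m) ι x₀) :
    ContDiffAt ℝ ∞ (locMap (m := m) ι x₀) q := by
  have hsymm : ContMDiffAt (𝓡 n) (𝓡 n) ∞ (extChartAt (𝓡 n) x₀).symm q :=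
    (contMDiffOn_extChartAt_symm (n := ∞) x₀).contMDiffAt
      ((isOpen_extChartAt_target x₀).mem_nhds hq.1)
  have h2 : ContMDiffAt (𝓡 m) (𝓡 m) ∞ (extChartAt (𝓡 m) (ι x₀))
      (ι ((extChartAt (𝓡 n) x₀).symm q)) :=
    contMDiffAt_extChartAt' (by have := hq.2; rwa [Set.mem_preimage, extChartAt_source] at this)
  exact (h2.comp q (hι.contMDiffAt.comp q hsymm)).contDiffAt

/-- The differential of `ι` in coordinates. -/
lemma crd_push_frm {ι : N → M} (hι : ContMDiff (𝓡 n) (𝓡 m) ∞ ι) {x₀ : N}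
    {q : EuclideanSpace ℝ (Fin n)} (hq : q ∈ locDom (m := m) ι x₀) (v : EuclideanSpace ℝ (Fin n)) :
    crd (ι x₀) (ι ((extChartAt (𝓡 n) x₀).symm q)) (push (m := m) n ι ((extChartAt (𝓡 n) x₀).symm q)
      (frm x₀ ((extChartAt (𝓡 n) x₀).symm q) v)) = fderiv ℝ (locMap (m := m) ι x₀) q v := by
  have hsymm : MDifferentiableAt (𝓡 n) (𝓡 n) (extChartAt (𝓡 n) x₀).symm q :=
    ((contMDiffOn_extChartAt_symm (n := 1) x₀).contMDiffAt
      ((isOpen_extChartAt_target x₀).mem_nhds hq.1)).mdifferentiableAt one_ne_zero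
  have h1 : MDifferentiableAt (𝓡 n) (𝓡 m) ι ((extChartAt (𝓡 n) x₀).symm q) :=
    hι.contMDiffAt.mdifferentiableAt (by simp)
  have h2 : MDifferentiableAt (𝓡 m) (𝓡 m) (extChartAt (𝓡 m) (ι x₀))
      (ι ((extChartAt (𝓡 n) x₀).symm q)) :=
    mdifferentiableAt_extChartAt
      (by have := hq.2; rwa [Set.mem_preimage, extChartAt_source] at this)
  rw [crd_eq_mfderiv hq.2, frm_eq_mfderiv hq.1, ← mfderiv_eq_fderiv]
  have h := mfderiv_comp q h2 (h1.comp q hsymm)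
  rw [mfderiv_comp q h1 hsymm] at h
  exact (congrArg (fun L : EuclideanSpace ℝ (Fin n) →L[ℝ] EuclideanSpace ℝ (Fin m) => L v) h).symm

/-- The components of a field along `ι`, in the charts at `x₀` and `ι x₀`. -/
def crdAlong (ι : N → M) (x₀ : N) (A : (y : N) → TangentSpace (𝓡 m) (ι y))
    (q : EuclideanSpace ℝ (Fin n)) : EuclideanSpace ℝ (Fin m) :=
  crd (ι x₀) (ι ((extChartAt (𝓡 n) x₀).symm q)) (A ((extChartAt (𝓡 n) x₀).symm q))

/-- The derivative of a field along `ι`, in coordinates. The definition of `covAlong` at `y` uses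
the trivialization at `ι y`; the transition function `J` to the trivialization at `ι x₀` contributes
terms which cancel between the derivative of the components and the connection. -/
lemma crd_covAlong (D : AffineConnection m M) {ι : N → M} (hι : ContMDiff (𝓡 n) (𝓡 m) ∞ ι) {x₀ : N}
    {q : EuclideanSpace ℝ (Fin n)} (hq : q ∈ locDom (m := m) ι x₀)
    {A : (y : N) → TangentSpace (𝓡 m) (ι y)} (hA : DifferentiableAt ℝ (crdAlong ι x₀ A) q)
    (v : EuclideanSpace ℝ (Fin n)) :
    crd (ι x₀) (ι ((extChartAt (𝓡 n) x₀).symm q)) (covAlong n D ι A ((extChartAt (𝓡 n) x₀).symm q)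
      (frm x₀ ((extChartAt (𝓡 n) x₀).symm q) v))
      = covAt (chris D (ι x₀)) (locMap ι x₀) (crdAlong ι x₀ A) q v := by
  have hpush := crd_push_frm hι hq v
  have hz₁s := mem_extChartAt_source (I := 𝓡 m) (ι ((extChartAt (𝓡 n) x₀).symm q))
  set y := (extChartAt (𝓡 n) x₀).symm q with hy
  have hS₀ : ι y ∈ (extChartAt (𝓡 m) (ι x₀)).source := hq.2
  have hφq : locMap (m := m) ι x₀ q = extChartAt (𝓡 m) (ι x₀) (ι y) := rfl
  have hT : locMap (m := m) ι x₀ q ∈ (extChartAt (𝓡 m) (ι x₀)).target :=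
    (extChartAt (𝓡 m) (ι x₀)).map_source hS₀
  have hinv : (extChartAt (𝓡 m) (ι x₀)).symm (locMap ι x₀ q) = ι y :=
    (extChartAt (𝓡 m) (ι x₀)).left_inv hS₀
  have hφ : DifferentiableAt ℝ (locMap (m := m) ι x₀) q :=
    (contDiffAt_locMap hι hq).differentiableAt (by simp)
  -- the transition functions between the trivializations at `ι x₀` and at `ι y`
  let J : EuclideanSpace ℝ (Fin m) → EuclideanSpace ℝ (Fin m) →L[ℝ] EuclideanSpace ℝ (Fin m) :=
    fun r => (crd (k := m) (ι x₀) ((extChartAt (𝓡 m) (ι x₀)).symm r)).comp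
      (frm (k := m) (ι y) ((extChartAt (𝓡 m) (ι x₀)).symm r))
  let K : EuclideanSpace ℝ (Fin m) → EuclideanSpace ℝ (Fin m) →L[ℝ] EuclideanSpace ℝ (Fin m) :=
    fun r => (crd (k := m) (ι y) ((extChartAt (𝓡 m) (ι x₀)).symm r)).comp
      (frm (k := m) (ι x₀) ((extChartAt (𝓡 m) (ι x₀)).symm r))
  have hJ : DifferentiableAt ℝ J (locMap ι x₀ q) :=
    differentiableAt_transition hT (by rwa [hinv]) (by rwa [hinv])
  have hK : DifferentiableAt ℝ K (locMap ι x₀ q) :=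
    differentiableAt_transition hT (by rwa [hinv]) (by rwa [hinv])
  let B : N → EuclideanSpace ℝ (Fin m) := fun y' => crd (ι y) (ι y') (A y')
  have hcont : ContinuousAt (fun r => ι ((extChartAt (𝓡 n) x₀).symm r)) q :=
    hι.continuous.continuousAt.comp (continuousAt_extChartAt_symm'' hq.1)
  have hnear : ∀ᶠ r in 𝓝 q, r ∈ locDom (m := m) ι x₀ ∧
      ι ((extChartAt (𝓡 n) x₀).symm r) ∈ (extChartAt (𝓡 m) (ι y)).source :=
    Filter.Eventually.and ((isOpen_locDom hι.continuous x₀).mem_nhds hq)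
      (hcont.preimage_mem_nhds ((isOpen_extChartAt_source _).mem_nhds hz₁s))
  have hBK : (fun r => B ((extChartAt (𝓡 n) x₀).symm r)) =ᶠ[𝓝 q]
      fun r => K (locMap ι x₀ r) (crdAlong ι x₀ A r) := by
    filter_upwards [hnear] with r hr
    have h1 : (extChartAt (𝓡 m) (ι x₀)).symm (locMap ι x₀ r) = ι ((extChartAt (𝓡 n) x₀).symm r) :=
      (extChartAt (𝓡 m) (ι x₀)).left_inv hr.1.2
    simp only [B, K, crdAlong, ContinuousLinearMap.coe_comp, Function.comp_apply]
    rw [h1, frm_crd hr.1.2]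
  have hAJ : crdAlong ι x₀ A =ᶠ[𝓝 q]
      fun r => J (locMap ι x₀ r) (B ((extChartAt (𝓡 n) x₀).symm r)) := by
    filter_upwards [hnear] with r hr
    have h1 : (extChartAt (𝓡 m) (ι x₀)).symm (locMap ι x₀ r) = ι ((extChartAt (𝓡 n) x₀).symm r) :=
      (extChartAt (𝓡 m) (ι x₀)).left_inv hr.1.2
    simp only [B, J, crdAlong, ContinuousLinearMap.coe_comp, Function.comp_apply]
    rw [h1, frm_crd hr.2]
  have hB : DifferentiableAt ℝ (fun r => B ((extChartAt (𝓡 n) x₀).symm r)) q :=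
    ((hK.comp q hφ).clm_apply hA).congr_of_eventuallyEq hBK
  have hJφ : HasFDerivAt (fun r => J (locMap ι x₀ r))
      ((fderiv ℝ J (locMap ι x₀ q)).comp (fderiv ℝ (locMap ι x₀) q)) q :=
    hJ.hasFDerivAt.comp q hφ.hasFDerivAt
  have hdA : fderiv ℝ (crdAlong ι x₀ A) q v
      = fderiv ℝ J (locMap ι x₀ q) (fderiv ℝ (locMap ι x₀) q v) (B y)
        + J (locMap ι x₀ q) (fderiv ℝ (fun r => B ((extChartAt (𝓡 n) x₀).symm r)) q v) := by
    rw [hAJ.fderiv_eq, (hJφ.clm_apply hB.hasFDerivAt).fderiv]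
    simp only [add_apply, ContinuousLinearMap.coe_comp, Function.comp_apply,
      ContinuousLinearMap.flip_apply]
    rw [add_comm]
  have hlead : crd (ι x₀) (ι y) ((trivializationAt (EuclideanSpace ℝ (Fin m))
      (fun z : M => TangentSpace (𝓡 m) z) (ι y)).symm (ι y)
        (mvfderiv (𝓡 n) B y (frm x₀ y v)))
      = J (locMap ι x₀ q) (fderiv ℝ (fun r => B ((extChartAt (𝓡 n) x₀).symm r)) q v) := by
    rw [fderiv_coord hq.1 hB,
      ← Trivialization.symmL_apply (R := ℝ) _ ((mem_baseSet_iff _ _).2 hz₁s)]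
    simp only [J, ContinuousLinearMap.coe_comp, Function.comp_apply]
    rw [hinv]
    rfl
  have hJd : DifferentiableAt ℝ (fun r => J r (B y)) (locMap ι x₀ q) :=
    hJ.clm_apply (differentiableAt_const _)
  have hconn : crd (ι x₀) (ι y) (D (ext (A y)) (ι y) (push n ι y (frm x₀ y v)))
      = fderiv ℝ J (locMap ι x₀ q) (fderiv ℝ (locMap ι x₀) q v) (B y)
        + chris D (ι x₀) (locMap ι x₀ q) (crdAlong ι x₀ A q) (fderiv ℝ (locMap ι x₀) q v) := by
    rw [conn_ext D (A y) hz₁s, crd_conn_of_mem D hS₀ (by rw [← hφq]; exact hJd), hpush, ← hφq]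
    have h1 : frm (ι y) (ι y) (B y) = A y := frm_crd hz₁s _
    change fderiv ℝ (fun r => J r (B y)) _ _ + chris D (ι x₀) _ (crd (ι x₀) (ι y)
      (frm (ι y) (ι y) (B y))) _ = _
    rw [h1, (hJ.hasFDerivAt.clm_apply (hasFDerivAt_const (B y) _)).fderiv]
    simp
    rfl
  rw [covAlong, map_add, covAt_apply, hdA]
  refine (congrArg₂ (· + ·) hlead hconn).trans ?_
  abel

end Along

/-! ### Hypersurfaces of a manifold with a Weyl structure -/

section Hypersurface

open Filter Topology

variable {m : ℕ} {n : ℕ}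
  {M : Type*} [TopologicalSpace M] [ChartedSpace (EuclideanSpace ℝ (Fin m)) M]
  [IsManifold (𝓡 m) ∞ M]
  {N : Type*} [TopologicalSpace N] [ChartedSpace (EuclideanSpace ℝ (Fin n)) N]
  [IsManifold (𝓡 n) ∞ N]

/-- The trivialization at `x` is the identity on `T_xN`. -/
lemma crd_self (x : N) (v : TangentSpace (𝓡 n) x) : crd x x v = v := by
  rw [crd, TangentBundle.continuousLinearMapAt_trivializationAt_eq_core (mem_chart_source _ x)]
  exact (tangentBundleCore (𝓡 n) N).coordChange_self _ _ (mem_chart_source _ x) v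

/-- The differential of an immersion is injective. -/
lemma injective_push {ι : N → M} (hι : IsImmersion (𝓡 n) (𝓡 m) ∞ ι) (y : N) :
    Function.Injective (push (m := m) n ι y) := by
  have h := hι.isImmersionAt y
  have hcod : ∀ y' ∈ h.domChart.source, h.codChart (ι y') = h.equiv (h.domChart y', 0) := by
    intro y' hy'
    have hmem : h.domChart y' ∈ (h.domChart.extend (𝓡 n)).target := by
      simpa [OpenPartialHomeomorph.extend] using h.domChart.map_source hy'
    have h2 := h.writtenInCharts hmem
    have h4 : h.domChart.symm (h.domChart y') = y' := h.domChart.left_inv hy'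
    refine Eq.trans ?_ h2
    conv_lhs => rw [← h4]
    rfl
  have hdom : ∀ y' ∈ h.domChart.source, h.domChart.symm
      ((h.equiv.symm (h.codChart (ι y'))).1) = y' := by
    intro y' hy'
    rw [hcod y' hy', ContinuousLinearEquiv.symm_apply_apply]
    exact h.domChart.left_inv hy'
  have hy := h.mem_domChart_source
  -- a smooth left inverse of `ι` near `y`
  let L : M → N := fun z => h.domChart.symm ((h.equiv.symm (h.codChart z)).1)
  have hL : MDifferentiableAt (𝓡 m) (𝓡 n) L (ι y) := by
    have h1 : ContMDiffAt (𝓡 m) (𝓡 m) ∞ h.codChart (ι y) :=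
      contMDiffAt_of_mem_maximalAtlas h.codChart_mem_maximalAtlas h.mem_codChart_source
    have h2 : ContMDiff (𝓡 m) (𝓡 n) ∞ (fun z : EuclideanSpace ℝ (Fin m) => (h.equiv.symm z).1) :=
      (contDiff_fst.comp h.equiv.symm.contDiff).contMDiff
    have h4 : (h.equiv.symm (h.codChart (ι y))).1 ∈ h.domChart.target := by
      rw [hcod y hy, ContinuousLinearEquiv.symm_apply_apply]
      exact h.domChart.map_source hy
    have h3 := contMDiffAt_symm_of_mem_maximalAtlas h.domChart_mem_maximalAtlas h4
    exact (h3.comp (ι y) (h2.contMDiffAt.comp (ι y) h1)).mdifferentiableAt (by simp)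
  have hι' : MDifferentiableAt (𝓡 n) (𝓡 m) ι y := h.contMDiffAt.mdifferentiableAt (by simp)
  have hid : (L ∘ ι) =ᶠ[𝓝 y] id := by
    filter_upwards [h.domChart.open_source.mem_nhds hy] with y' hy'
    exact hdom y' hy'
  have hc := mfderiv_comp y hL hι'
  rw [hid.mfderiv_eq, mfderiv_id] at hc
  intro v w hvw
  have e1 := congrArg (fun T : TangentSpace (𝓡 n) y →L[ℝ] TangentSpace (𝓡 n) y => T v) hc
  have e2 := congrArg (fun T : TangentSpace (𝓡 n) y →L[ℝ] TangentSpace (𝓡 n) y => T w) hc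
  have e3 : mfderiv (𝓡 m) (𝓡 n) L (ι y) (push (m := m) n ι y v)
    = mfderiv (𝓡 m) (𝓡 n) L (ι y) (push (m := m) n ι y w) := congrArg _ hvw
  exact e1.trans (e3.trans e2.symm)

/-- A hypersurface `ι` of a manifold with a smooth torsion-free connection `D` satisfying
`∇ g = α ⊗ g`. -/
structure IsWeylHypersurface (D : AffineConnection m M) (g : Metric m M)
    (α : (x : M) → TangentSpace (𝓡 m) x →L[ℝ] ℝ) (ι : N → M) : Prop where
  smooth : CovariantDerivative.ContMDiffCovariantDerivative D ∞
  torsion_free : D.torsion = 0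
  compat : ∀ (x : M) (Y Z : (y : M) → TangentSpace (𝓡 m) y) (v : TangentSpace (𝓡 m) x),
      DifferentiableFieldAt Y x → DifferentiableFieldAt Z x →
        mvfderiv (𝓡 m) (fun y => g.inner y (Y y) (Z y)) x v
            - g.inner x (D Y x v) (Z x) - g.inner x (Y x) (D Z x v)
          = α x v * g.inner x (Y x) (Z x)
  contMDiff : ContMDiff (𝓡 n) (𝓡 m) ∞ ι
  injective : ∀ y, Function.Injective (push (m := m) n ι y)
  dim_eq : m = n + 1

variable {D : AffineConnection m M} {g : Metric m M}
  {α : (x : M) → TangentSpace (𝓡 m) x →L[ℝ] ℝ} {ι : N → M}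

namespace IsWeylHypersurface

variable (H : IsWeylHypersurface (n := n) D g α ι) {x₀ : N} {q : EuclideanSpace ℝ (Fin n)}
  (hq : q ∈ locDom (m := m) ι x₀)
include H hq

lemma isLocalWeyl : IsLocalWeyl (chris D (ι x₀)) (locMetric g (ι x₀)) (locForm α (ι x₀))
    (locMap ι x₀ q) :=
  isLocalWeyl_chris H.torsion_free g H.compat (ι x₀) ((extChartAt (𝓡 m) (ι x₀)).map_source hq.2)

lemma crd_push (v : TangentSpace (𝓡 n) ((extChartAt (𝓡 n) x₀).symm q)) :
    crd (ι x₀) (ι ((extChartAt (𝓡 n) x₀).symm q)) (push (m := m) n ι _ v)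
      = fderiv ℝ (locMap ι x₀) q (crd x₀ ((extChartAt (𝓡 n) x₀).symm q) v) := by
  rw [← crd_push_frm H.contMDiff hq, frm_crd ((extChartAt (𝓡 n) x₀).map_target hq.1)]

lemma injective_fderiv : Function.Injective (fderiv ℝ (locMap (m := m) ι x₀) q) := by
  intro v w h
  rw [← crd_push_frm H.contMDiff hq, ← crd_push_frm H.contMDiff hq] at h
  have hy := (extChartAt (𝓡 n) x₀).map_target hq.1
  exact (crdEquiv x₀ hy).symm.injective (H.injective _ ((crdEquiv (ι x₀) hq.2).injective h))

omit H in
lemma inner_eq (v w : TangentSpace (𝓡 m) (ι ((extChartAt (𝓡 n) x₀).symm q))) :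
    g.inner _ v w = locMetric g (ι x₀) (locMap ι x₀ q)
      (crd (ι x₀) (ι ((extChartAt (𝓡 n) x₀).symm q)) v)
      (crd (ι x₀) (ι ((extChartAt (𝓡 n) x₀).symm q)) w) :=
  (locMetric_crd g hq.2 v w).symm

omit hq in
lemma inducedMetric_pos {y : N} (v : TangentSpace (𝓡 n) y) (hv : v ≠ 0) :
    0 < inducedMetric n g ι y v v :=
  g.pos _ _ fun h => hv (H.injective y (h.trans (map_zero _).symm))

end IsWeylHypersurface

/-- The induced metric as a bilinear map. -/
def inducedBilin (g : Metric m M) (ι : N → M) (y : N) :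
    TangentSpace (𝓡 n) y →ₗ[ℝ] TangentSpace (𝓡 n) y →ₗ[ℝ] ℝ :=
  LinearMap.mk₂ ℝ (inducedMetric n g ι y) (by simp [inducedMetric]) (by simp [inducedMetric])
    (by simp [inducedMetric]) (by simp [inducedMetric])

/-- The linear form `v ↦ g(A, dι(v))`. -/
def tangentialForm (g : Metric m M) (ι : N → M) (y : N) (A : TangentSpace (𝓡 m) (ι y)) :
    TangentSpace (𝓡 n) y →ₗ[ℝ] ℝ :=
  ((g.inner (ι y) A).comp (push n ι y)).toLinearMap

namespace IsWeylHypersurface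

variable (H : IsWeylHypersurface (n := n) D g α ι)
include H

/-- The defining property of the tangential component. -/
lemma inner_push_tangential {y : N} (A : TangentSpace (𝓡 m) (ι y)) (w : TangentSpace (𝓡 n) y) :
    g.inner (ι y) (push n ι y (tangential n g ι y A)) (push n ι y w)
      = g.inner (ι y) A (push n ι y w) :=
  metricTrace_smul_left (inducedBilin g ι y) (fun _ _ => g.symm _ _ _)
    (fun v hv => H.inducedMetric_pos v hv) (tangentialForm g ι y A) w

lemma isNormal_normal {y : N} (A : TangentSpace (𝓡 m) (ι y)) :
    IsNormal n g ι y (normal n g ι y A) := by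
  intro w
  rw [normal, map_sub, sub_apply, H.inner_push_tangential, sub_self]

omit H in
/-- Pairing with a normal vector only sees the normal component. -/
lemma inner_normal {y : N} (A : TangentSpace (𝓡 m) (ι y)) {ζ : TangentSpace (𝓡 m) (ι y)}
    (hζ : IsNormal n g ι y ζ) : g.inner (ι y) (normal n g ι y A) ζ = g.inner (ι y) A ζ := by
  rw [normal, map_sub, sub_apply, g.symm _ (push n ι y _) ζ, hζ, sub_zero]

variable {x₀ : N} {q : EuclideanSpace ℝ (Fin n)} (hq : q ∈ locDom (m := m) ι x₀)
include hq

lemma crd_tangential (A : TangentSpace (𝓡 m) (ι ((extChartAt (𝓡 n) x₀).symm q))) :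
    crd x₀ ((extChartAt (𝓡 n) x₀).symm q) (tangential n g ι _ A)
      = tanProj (locMetric g (ι x₀)) (locMap ι x₀) q
        (crd (ι x₀) (ι ((extChartAt (𝓡 n) x₀).symm q)) A) := by
  refine tanProj_unique (H.isLocalWeyl hq) (H.injective_fderiv hq) _ _ fun w => ?_
  rw [← H.crd_push hq, ← crd_push_frm H.contMDiff hq, ← inner_eq hq, ← inner_eq hq,
    H.inner_push_tangential]

lemma crd_normal (A : TangentSpace (𝓡 m) (ι ((extChartAt (𝓡 n) x₀).symm q))) :
    crd (ι x₀) (ι ((extChartAt (𝓡 n) x₀).symm q)) (normal n g ι _ A)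
      = normalField (locMetric g (ι x₀)) (locMap ι x₀)
        (crd (ι x₀) (ι ((extChartAt (𝓡 n) x₀).symm q)) A) q := by
  rw [normal, map_sub, H.crd_push hq, H.crd_tangential hq, normalField]

end IsWeylHypersurface

end Hypersurface

/-! ### Mean curvature and fundamental form in coordinates -/

section

open Filter Topology

variable {U V : Type*} [NormedAddCommGroup U] [NormedSpace ℝ U] [FiniteDimensional ℝ U]
  [NormedAddCommGroup V] [NormedSpace ℝ V] [FiniteDimensional ℝ V]
  {Γ : V → V →L[ℝ] V →L[ℝ] V} {G : V → V →L[ℝ] V →L[ℝ] ℝ} {α : V → V →L[ℝ] ℝ}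
  {φ : U → V} {q : U}

lemma covAt_congr {A A' : U → V} (h : A =ᶠ[𝓝 q] A') : covAt Γ φ A q = covAt Γ φ A' q := by
  rw [covAt, covAt, h.fderiv_eq, h.self_of_nhds]

lemma covAt_smul {A : U → V} {f : U → ℝ} (hf : DifferentiableAt ℝ f q)
    (hA : DifferentiableAt ℝ A q) (v : U) :
    covAt Γ φ (fun r => f r • A r) q v = fderiv ℝ f q v • A q + f q • covAt Γ φ A q v := by
  have h := (hf.hasFDerivAt.smul hA.hasFDerivAt).fderiv
  rw [covAt_apply, covAt_apply]
  change fderiv ℝ (f • A) q v + _ = _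
  rw [h]
  simp only [add_apply, smul_apply, ContinuousLinearMap.smulRight_apply, map_smul, smul_add]
  abel

/-- The derivative of a tangential field `dφ(Y)`. -/
lemma covAt_tangent (hφ : ContDiffAt ℝ ∞ φ q) {Y : U → U} (hY : DifferentiableAt ℝ Y q) (v : U) :
    covAt Γ φ (fun r => fderiv ℝ φ r (Y r)) q v
      = hess Γ φ q v (Y q) + fderiv ℝ φ q (fderiv ℝ Y q v) := by
  have hd := (contDiffAt_fderiv hφ).differentiableAt (by simp)
  rw [hess_apply hφ, covAt_apply, fderiv_clm_apply₁ hd hY]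
  abel

lemma tanProj_eq_zero (hw : IsLocalWeyl Γ G α (φ q)) (hinj : Function.Injective (fderiv ℝ φ q))
    {a : V} (ha : ∀ w, G (φ q) a (fderiv ℝ φ q w) = 0) : tanProj G φ q a = 0 :=
  (tanProj_unique hw hinj a 0 fun w => by rw [ha, map_zero, map_zero, zero_apply]).symm

/-- The tangential part of the derivative of a normal field only depends on its value. -/
lemma tanProj_covAt_congr (hφ : ContDiffAt ℝ 2 φ q) (hw : IsLocalWeyl Γ G α (φ q))
    (hinj : Function.Injective (fderiv ℝ φ q)) {A A' : U → V}
    (hA : DifferentiableAt ℝ A q) (hA' : DifferentiableAt ℝ A' q)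
    (hn : ∀ᶠ r in 𝓝 q, ∀ w, G (φ r) (A r) (fderiv ℝ φ r w) = 0)
    (hn' : ∀ᶠ r in 𝓝 q, ∀ w, G (φ r) (A' r) (fderiv ℝ φ r w) = 0) (h : A q = A' q) (v : U) :
    tanProj G φ q (covAt Γ φ A q v) = tanProj G φ q (covAt Γ φ A' q v) :=
  tanProj_unique hw hinj _ _ fun w => by
    rw [metric_tanProj hw hinj, weingarten hφ hw hA hn, weingarten hφ hw hA' hn', h]

end

section Hypersurface

open Filter Topology

variable {m : ℕ} {n : ℕ}
  {M : Type*} [TopologicalSpace M] [ChartedSpace (EuclideanSpace ℝ (Fin m)) M]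
  [IsManifold (𝓡 m) ∞ M]
  {N : Type*} [TopologicalSpace N] [ChartedSpace (EuclideanSpace ℝ (Fin n)) N]
  [IsManifold (𝓡 n) ∞ N]

variable {D : AffineConnection m M} {g : Metric m M}
  {α : (x : M) → TangentSpace (𝓡 m) x →L[ℝ] ℝ} {ι : N → M}

lemma inner_metricTrace (g : Metric m M) {z : M} (ζ : TangentSpace (𝓡 m) z) {W : Type*}
    [AddCommGroup W] [Module ℝ W] [FiniteDimensional ℝ W] (β : W → W → ℝ)
    (A : W → W → TangentSpace (𝓡 m) z) :
    g.inner z (metricTrace β A) ζ = metricTrace β fun v w => g.inner z (A v w) ζ := by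
  rw [g.symm, ← ContinuousLinearMap.coe_coe (g.inner z ζ), metricTrace_map]
  simp only [ContinuousLinearMap.coe_coe, g.symm z ζ]

namespace IsWeylHypersurface

variable (H : IsWeylHypersurface (n := n) D g α ι) {x₀ : N} {q : EuclideanSpace ℝ (Fin n)}
  (hq : q ∈ locDom (m := m) ι x₀) {y : N} (hy : (extChartAt (𝓡 n) x₀).symm q = y)
include H hq

lemma eventually_locDom : ∀ᶠ r in 𝓝 q, r ∈ locDom (m := m) ι x₀ :=
  (isOpen_locDom H.contMDiff.continuous x₀).mem_nhds hq

lemma contDiffAt_two : ContDiffAt ℝ 2 (locMap (m := m) ι x₀) q :=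
  (contDiffAt_locMap H.contMDiff hq).of_le two_le_infty

include hy

omit H in
lemma mem_source : y ∈ (extChartAt (𝓡 n) x₀).source := by
  rw [← hy]; exact (extChartAt (𝓡 n) x₀).map_target hq.1

lemma crd_covAlong_apply {A : (y : N) → TangentSpace (𝓡 m) (ι y)}
    (hA : DifferentiableAt ℝ (crdAlong ι x₀ A) q) (v : TangentSpace (𝓡 n) y) :
    crd (ι x₀) (ι y) (covAlong n D ι A y v)
      = covAt (chris D (ι x₀)) (locMap ι x₀) (crdAlong ι x₀ A) q (crd x₀ y v) := by
  subst hy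
  rw [← crd_covAlong D H.contMDiff hq hA, frm_crd ((extChartAt (𝓡 n) x₀).map_target hq.1)]

/-- The derivative along `N` of a tangent field of `N`. -/
lemma crd_covAlong_push {Y : (y : N) → TangentSpace (𝓡 n) y}
    (hY : DifferentiableAt ℝ (crdField x₀ Y) q) (v : TangentSpace (𝓡 n) y) :
    crd (ι x₀) (ι y) (covAlong n D ι (fun y => push n ι y (Y y)) y v)
      = hess (chris D (ι x₀)) (locMap ι x₀) q (crd x₀ y v) (crdField x₀ Y q)
        + fderiv ℝ (locMap ι x₀) q (fderiv ℝ (crdField x₀ Y) q (crd x₀ y v)) := by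
  have hφ := contDiffAt_locMap H.contMDiff hq
  have he : crdAlong ι x₀ (fun y => push (m := m) n ι y (Y y)) =ᶠ[𝓝 q]
      fun r => fderiv ℝ (locMap ι x₀) r (crdField x₀ Y r) := by
    filter_upwards [H.eventually_locDom hq] with r hr
    exact H.crd_push hr _
  have hd : DifferentiableAt ℝ (fun r => fderiv ℝ (locMap (m := m) ι x₀) r (crdField x₀ Y r)) q :=
    ((contDiffAt_fderiv hφ).differentiableAt (by simp)).clm_apply hY
  rw [H.crd_covAlong_apply hq hy (hd.congr_of_eventuallyEq he), covAt_congr he,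
    covAt_tangent hφ hY]

lemma isNormal_iff (ζ : TangentSpace (𝓡 m) (ι y)) : IsNormal n g ι y ζ ↔
    ∀ w, locMetric g (ι x₀) (locMap ι x₀ q) (crd (ι x₀) (ι y) ζ)
      (fderiv ℝ (locMap ι x₀) q w) = 0 := by
  subst hy
  constructor
  · intro h w
    rw [← crd_push_frm H.contMDiff hq, ← inner_eq hq]
    exact h _
  · intro h w
    rw [inner_eq hq, H.crd_push hq]
    exact h _

/-- The coordinate expression of the normal extension of a normal vector is differentiable, normal,
and takes the prescribed value. -/
lemma crdAlong_normalExt {ζ : TangentSpace (𝓡 m) (ι y)} (hζ : IsNormal n g ι y ζ) :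
    DifferentiableAt ℝ (crdAlong ι x₀ (normalExt n g ι ζ)) q ∧
      (∀ᶠ r in 𝓝 q, ∀ w, locMetric g (ι x₀) (locMap ι x₀ r)
        (crdAlong ι x₀ (normalExt n g ι ζ) r) (fderiv ℝ (locMap ι x₀) r w) = 0) ∧
      crdAlong ι x₀ (normalExt n g ι ζ) q = crd (ι x₀) (ι y) ζ := by
  have hζ' := (H.isNormal_iff hq hy ζ).1 hζ
  have hφ := contDiffAt_locMap H.contMDiff hq
  have hS₀ : ι y ∈ (extChartAt (𝓡 m) (ι x₀)).source := by rw [← hy]; exact hq.2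
  have hz₁s := mem_extChartAt_source (I := 𝓡 m) (ι y)
  have hT : locMap (m := m) ι x₀ q ∈ (extChartAt (𝓡 m) (ι x₀)).target :=
    (extChartAt (𝓡 m) (ι x₀)).map_source hq.2
  have hinv : (extChartAt (𝓡 m) (ι x₀)).symm (locMap ι x₀ q) = ι y := by
    rw [← hy]; exact (extChartAt (𝓡 m) (ι x₀)).left_inv hq.2
  have hcont : ContinuousAt (fun r => ι ((extChartAt (𝓡 n) x₀).symm r)) q :=
    H.contMDiff.continuous.continuousAt.comp (continuousAt_extChartAt_symm'' hq.1)
  let J : EuclideanSpace ℝ (Fin n) → EuclideanSpace ℝ (Fin m) := fun r =>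
    crdAlong ι x₀ (fun y' => ext ζ (ι y')) r
  have hJ : DifferentiableAt ℝ J q := by
    have h1 := (differentiableAt_transition (x₀ := ι x₀) (x₁ := ι x₀) (x₂ := ι y) hT (by rwa [hinv])
      (by rwa [hinv])).comp q (hφ.differentiableAt (by simp))
    refine (h1.clm_apply (differentiableAt_const (crd (ι y) (ι y) ζ))).congr_of_eventuallyEq ?_
    filter_upwards [H.eventually_locDom hq,
      hcont.preimage_mem_nhds ((isOpen_extChartAt_source (ι y)).mem_nhds (by rwa [hy]))]
      with r hr hr'
    have h1 : (extChartAt (𝓡 m) (ι x₀)).symm (locMap ι x₀ r) = ι ((extChartAt (𝓡 n) x₀).symm r) :=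
      (extChartAt (𝓡 m) (ι x₀)).left_inv hr.2
    simp only [J, crdAlong, Function.comp_apply, ContinuousLinearMap.coe_comp]
    rw [h1, ext_eq_frm ζ hr']
  have hJq : J q = crd (ι x₀) (ι y) ζ := by
    have h : ∀ y', y' = y → ∀ ζ : TangentSpace (𝓡 m) (ι y),
        crd (ι x₀) (ι y') (ext ζ (ι y')) = crd (ι x₀) (ι y) ζ := by
      rintro _ rfl ζ
      rw [ext_self]
    exact h _ hy ζ
  have he : ∀ r ∈ locDom (m := m) ι x₀, crdAlong ι x₀ (normalExt n g ι ζ) r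
      = normalField (locMetric g (ι x₀)) (locMap ι x₀) (J r) r := fun r hr => H.crd_normal hr _
  have hG := contDiffAt_locMetric g (ι x₀) hT
  have hP := contDiffAt_tanProj hG (H.isLocalWeyl hq) hφ (H.injective_fderiv hq)
  refine ⟨?_, ?_, ?_⟩
  · have hd : DifferentiableAt ℝ (fun r => normalField (locMetric g (ι x₀)) (locMap ι x₀) (J r) r)
        q :=
      hJ.sub (((contDiffAt_fderiv hφ).differentiableAt (by simp)).clm_apply
        ((hP.differentiableAt (by simp)).clm_apply hJ))
    refine hd.congr_of_eventuallyEq ?_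
    filter_upwards [H.eventually_locDom hq] with r hr
    exact he r hr
  · filter_upwards [H.eventually_locDom hq] with r hr w
    rw [he r hr]
    exact normalField_orthogonal (H.isLocalWeyl hr) (H.injective_fderiv hr) _ _
  · rw [he q hq, hJq, normalField,
      tanProj_eq_zero (H.isLocalWeyl hq) (H.injective_fderiv hq) hζ', map_zero, sub_zero]

/-- The mean curvature in coordinates, for any local normal field `ν` extending `ζ`. -/
lemma meanCurv_eq {ζ : TangentSpace (𝓡 m) (ι y)} (hζ : IsNormal n g ι y ζ)
    {ν : EuclideanSpace ℝ (Fin n) → EuclideanSpace ℝ (Fin m)} (hν : DifferentiableAt ℝ ν q)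
    (hn : ∀ᶠ r in 𝓝 q, ∀ w, locMetric g (ι x₀) (locMap ι x₀ r) (ν r)
      (fderiv ℝ (locMap ι x₀) r w) = 0) (hνq : ν q = crd (ι x₀) (ι y) ζ) :
    meanCurv n g D ι y ζ
      = localMean (chris D (ι x₀)) (locMetric g (ι x₀)) (locMap ι x₀) ν q := by
  obtain ⟨h1, h2, h3⟩ := H.crdAlong_normalExt hq hy hζ
  rw [meanCurv, localMean, finrank_euclideanSpace_fin]
  congr 2
  refine endTrace_conj (crdEquiv x₀ (mem_source hq hy)) _ _ fun v => ?_
  rw [crdEquiv_apply, crdEquiv_apply]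
  have h4 := tanProj_covAt_congr (H.contDiffAt_two hq) (H.isLocalWeyl hq) (H.injective_fderiv hq)
    hν h1 hn h2 (hνq.trans h3.symm) (crd x₀ y v)
  rw [← H.crd_covAlong_apply hq hy h1] at h4
  refine Eq.trans ?_ h4.symm
  subst hy
  exact H.crd_tangential hq _

/-- The fundamental form, paired with a normal vector, in coordinates. -/
lemma inner_fundForm {ζ : TangentSpace (𝓡 m) (ι y)} (hζ : IsNormal n g ι y ζ)
    (X Y : TangentSpace (𝓡 n) y) :
    g.inner (ι y) (fundForm n g D ι y X Y) ζ = locMetric g (ι x₀) (locMap ι x₀ q)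
      (hess (chris D (ι x₀)) (locMap ι x₀) q (crd x₀ y X) (crd x₀ y Y)) (crd (ι x₀) (ι y) ζ) := by
  have hζ' := (H.isNormal_iff hq hy ζ).1 hζ
  have hd : DifferentiableAt ℝ (crdField x₀ (ext Y)) q := by
    rw [← differentiableFieldAt_iff hq.1, hy]
    exact differentiableFieldAt_ext Y (mem_extChartAt_source y)
  have hYq : crdField x₀ (ext Y) q = crd x₀ y Y := by
    subst hy
    rw [crdField, ext_self]
  have h := H.crd_covAlong_push hq hy hd X
  rw [fundForm, inner_normal _ hζ]
  have h5 : ∀ v, g.inner (ι y) v ζ = locMetric g (ι x₀) (locMap ι x₀ q)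
      (crd (ι x₀) (ι y) v) (crd (ι x₀) (ι y) ζ) := by
    subst hy
    exact fun v => inner_eq hq v ζ
  rw [h5, h, hYq, map_add, add_apply, (H.isLocalWeyl hq).metric_symm (fderiv ℝ _ _ _), hζ',
    add_zero]

/-- The trace of the fundamental form is `n` times the mean curvature. -/
lemma inner_metricTrace_fundForm (hn0 : n ≠ 0) {ζ : TangentSpace (𝓡 m) (ι y)}
    (hζ : IsNormal n g ι y ζ)
    {ν : EuclideanSpace ℝ (Fin n) → EuclideanSpace ℝ (Fin m)} (hν : DifferentiableAt ℝ ν q)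
    (hn : ∀ᶠ r in 𝓝 q, ∀ w, locMetric g (ι x₀) (locMap ι x₀ r) (ν r)
      (fderiv ℝ (locMap ι x₀) r w) = 0) (hνq : ν q = crd (ι x₀) (ι y) ζ) :
    g.inner (ι y) (metricTrace (inducedMetric n g ι y) (fundForm n g D ι y)) ζ
      = n * localMean (chris D (ι x₀)) (locMetric g (ι x₀)) (locMap ι x₀) ν q := by
  let S := shape (chris D (ι x₀)) (locMetric g (ι x₀)) (locMap ι x₀) ν q
  let T : TangentSpace (𝓡 n) y →ₗ[ℝ] TangentSpace (𝓡 n) y :=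
    (crdEquiv x₀ (mem_source hq hy)).symm.conj (-S.toLinearMap)
  have hT : ∀ v, crd x₀ y (T v) = - S (crd x₀ y v) := fun v => by
    rw [← crdEquiv_apply x₀ (mem_source hq hy), ← crdEquiv_apply x₀ (mem_source hq hy)]
    simp [T, LinearEquiv.conj_apply]
  have h1 := inner_metricTrace g ζ (inducedMetric n g ι y) (fundForm n g D ι y)
  have h2 : metricTrace (inducedMetric n g ι y)
      (fun v w => g.inner (ι y) (fundForm n g D ι y v w) ζ)
      = LinearMap.trace ℝ _ T := by
    refine metricTrace_eq_trace (inducedBilin g ι y) (fun _ _ => g.symm _ _ _)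
      (fun v hv => H.inducedMetric_pos v hv) T _ fun v w => ?_
    have h5 : inducedBilin g ι y (T v) w = locMetric g (ι x₀) (locMap ι x₀ q)
        (fderiv ℝ (locMap ι x₀) q (crd x₀ y (T v))) (fderiv ℝ (locMap ι x₀) q (crd x₀ y w)) := by
      subst hy
      rw [← H.crd_push hq, ← H.crd_push hq, ← inner_eq hq]
      rfl
    rw [H.inner_fundForm hq hy hζ, h5, hT, map_neg, map_neg, neg_apply]
    change _ = - locMetric g (ι x₀) (locMap ι x₀ q) (fderiv ℝ (locMap ι x₀) q
      (tanProj _ _ _ (covAt _ _ ν q _))) _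
    rw [metric_tanProj (H.isLocalWeyl hq) (H.injective_fderiv hq),
      weingarten (H.contDiffAt_two hq) (H.isLocalWeyl hq) hν hn, neg_neg, hνq]
  refine h1.trans (h2.trans ?_)
  rw [LinearMap.trace_conj', map_neg, localMean, finrank_euclideanSpace_fin]
  have : (n : ℝ) ≠ 0 := by exact_mod_cast hn0
  field_simp
  rfl

/-- The trace-free fundamental form, paired with a normal vector, in coordinates. -/
lemma inner_fundFormTF (hn0 : n ≠ 0) {ζ : TangentSpace (𝓡 m) (ι y)} (hζ : IsNormal n g ι y ζ)
    {ν : EuclideanSpace ℝ (Fin n) → EuclideanSpace ℝ (Fin m)} (hν : DifferentiableAt ℝ ν q)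
    (hn : ∀ᶠ r in 𝓝 q, ∀ w, locMetric g (ι x₀) (locMap ι x₀ r) (ν r)
      (fderiv ℝ (locMap ι x₀) r w) = 0) (hνq : ν q = crd (ι x₀) (ι y) ζ)
    (X Y : TangentSpace (𝓡 n) y) :
    g.inner (ι y) (fundFormTF n g D ι y X Y) ζ
      = sffTF (chris D (ι x₀)) (locMetric g (ι x₀)) (locMap ι x₀) ν q (crd x₀ y X)
        (crd x₀ y Y) := by
  have h5 : inducedMetric n g ι y X Y = locMetric g (ι x₀) (locMap ι x₀ q)
      (fderiv ℝ (locMap ι x₀) q (crd x₀ y X)) (fderiv ℝ (locMap ι x₀) q (crd x₀ y Y)) := by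
    subst hy
    rw [← H.crd_push hq, ← H.crd_push hq, ← inner_eq hq]
    rfl
  have : (n : ℝ) ≠ 0 := by exact_mod_cast hn0
  rw [fundFormTF, map_sub, sub_apply, map_smul, smul_apply,
    H.inner_metricTrace_fundForm hq hy hn0 hζ hν hn hνq, H.inner_fundForm hq hy hζ, sffTF, sff,
    hνq, ← h5, smul_eq_mul]
  field_simp

end IsWeylHypersurface

end Hypersurface

/-! ### The hypersurface in a chart, and the derivative of the mean curvature -/

section Hypersurface

open Filter Topology

variable {m : ℕ} {n : ℕ}
  {M : Type*} [TopologicalSpace M] [ChartedSpace (EuclideanSpace ℝ (Fin m)) M]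
  [IsManifold (𝓡 m) ∞ M]
  {N : Type*} [TopologicalSpace N] [ChartedSpace (EuclideanSpace ℝ (Fin n)) N]
  [IsManifold (𝓡 n) ∞ N]

lemma mvfderiv_eq_fderiv_coord {x₀ y : N} {q : EuclideanSpace ℝ (Fin n)}
    (hq : q ∈ (extChartAt (𝓡 n) x₀).target) (hy : (extChartAt (𝓡 n) x₀).symm q = y) {f : N → ℝ}
    (hf : DifferentiableAt ℝ (fun r => f ((extChartAt (𝓡 n) x₀).symm r)) q)
    (v : TangentSpace (𝓡 n) y) :
    mvfderiv (𝓡 n) f y v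
      = fderiv ℝ (fun r => f ((extChartAt (𝓡 n) x₀).symm r)) q (crd x₀ y v) := by
  subst hy
  rw [fderiv_coord hq hf, frm_crd ((extChartAt (𝓡 n) x₀).map_target hq)]

lemma crd_ext {x₀ y : N} (hy : y ∈ (extChartAt (𝓡 n) x₀).source) (X : TangentSpace (𝓡 n) x₀) :
    crd x₀ y (ext X y) = crd x₀ x₀ X := by
  rw [ext_eq_frm X hy, crd_frm hy]

lemma locMap_base (ι : N → M) (x₀ : N) :
    locMap ι x₀ (extChartAt (𝓡 n) x₀ x₀) = extChartAt (𝓡 m) (ι x₀) (ι x₀) := by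
  rw [locMap, extChartAt_to_inv]

variable {D : AffineConnection m M} {g : Metric m M}
  {α : (x : M) → TangentSpace (𝓡 m) x →L[ℝ] ℝ} {ι : N → M}

namespace IsWeylHypersurface

variable (H : IsWeylHypersurface (n := n) D g α ι) {x₀ : N}
include H

section

variable {q : EuclideanSpace ℝ (Fin n)}
  (hq : q ∈ locDom (m := m) ι x₀) {y : N} (hy : (extChartAt (𝓡 n) x₀).symm q = y)
include hq hy

omit H in
lemma inner_eq_of_eq (v w : TangentSpace (𝓡 m) (ι y)) :
    g.inner (ι y) v w = locMetric g (ι x₀) (locMap ι x₀ q) (crd (ι x₀) (ι y) v)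
      (crd (ι x₀) (ι y) w) := by
  subst hy
  exact inner_eq hq v w

lemma crd_push_of_eq (v : TangentSpace (𝓡 n) y) :
    crd (ι x₀) (ι y) (push (m := m) n ι y v) = fderiv ℝ (locMap ι x₀) q (crd x₀ y v) := by
  subst hy
  exact H.crd_push hq v

lemma crd_tangential_of_eq (A : TangentSpace (𝓡 m) (ι y)) :
    crd x₀ y (tangential n g ι y A)
      = tanProj (locMetric g (ι x₀)) (locMap ι x₀) q (crd (ι x₀) (ι y) A) := by
  subst hy
  exact H.crd_tangential hq A

lemma crd_normal_of_eq (A : TangentSpace (𝓡 m) (ι y)) :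
    crd (ι x₀) (ι y) (normal n g ι y A)
      = normalField (locMetric g (ι x₀)) (locMap ι x₀) (crd (ι x₀) (ι y) A) q := by
  subst hy
  exact H.crd_normal hq A

omit H in
lemma crd_injective {v w : TangentSpace (𝓡 m) (ι y)}
    (h : crd (ι x₀) (ι y) v = crd (ι x₀) (ι y) w) : v = w := by
  have hS : ι y ∈ (extChartAt (𝓡 m) (ι x₀)).source := by rw [← hy]; exact hq.2
  exact (crdEquiv (ι x₀) hS).injective h

end

/-- In the chart at `x₀`, the normal extension of `ξ ∈ ν_{x₀}` is the normal part of a constant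
field. -/
lemma crdAlong_normalExt_base (ξ : TangentSpace (𝓡 m) (ι x₀)) {r : EuclideanSpace ℝ (Fin n)}
    (hr : r ∈ locDom (m := m) ι x₀) :
    crdAlong ι x₀ (normalExt n g ι ξ) r
      = normalField (locMetric g (ι x₀)) (locMap ι x₀) (crd (ι x₀) (ι x₀) ξ) r := by
  rw [crdAlong, normalExt, H.crd_normal hr, crd_ext hr.2]

variable {ξ : TangentSpace (𝓡 m) (ι x₀)} (hξ : IsNormal n g ι x₀ ξ)

lemma isNormal_fundFormTF {y : N} (X Y : TangentSpace (𝓡 n) y) :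
    IsNormal n g ι y (fundFormTF n g D ι y X Y) := by
  intro v
  rw [fundFormTF, map_sub, map_smul, sub_apply, smul_apply, inner_metricTrace]
  have h : ∀ X Y : TangentSpace (𝓡 n) y,
      g.inner (ι y) (fundForm n g D ι y X Y) (push n ι y v) = 0 :=
    fun X Y => H.isNormal_normal _ v
  simp [h, metricTrace]

include hξ

/-- At the base point, the normal extension of a normal vector takes the value of that vector. -/
lemma normalField_base : normalField (locMetric g (ι x₀)) (locMap ι x₀) (crd (ι x₀) (ι x₀) ξ)
    (extChartAt (𝓡 n) x₀ x₀) = crd (ι x₀) (ι x₀) ξ := by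
  rw [← H.crdAlong_normalExt_base ξ (mem_locDom ι x₀)]
  exact (H.crdAlong_normalExt (mem_locDom ι x₀) (extChartAt_to_inv x₀) hξ).2.2

/-- In the charts at `x₀` and `ι x₀`, a hypersurface of a Weyl manifold is a `LocalHypersurface`,
with the normal extension of a nonzero normal vector `ξ` as normal field. -/
lemma localHypersurface [T2Space M] (hξ0 : ξ ≠ 0) :
    LocalHypersurface (chris D (ι x₀)) (locMetric g (ι x₀)) (locForm α (ι x₀)) (locMap ι x₀)
      (normalField (locMetric g (ι x₀)) (locMap ι x₀) (crd (ι x₀) (ι x₀) ξ))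
      (extChartAt (𝓡 n) x₀ x₀) where
  finrank_eq := by simpa using H.dim_eq
  contDiffAt_chris := by rw [locMap_base]; exact contDiffAt_chris H.smooth _
  contDiffAt_metric := by
    rw [locMap_base]; exact contDiffAt_locMetric g _ (mem_extChartAt_target _)
  weyl := by
    rw [locMap_base]
    filter_upwards [(isOpen_extChartAt_target (ι x₀)).mem_nhds (mem_extChartAt_target (ι x₀))]
      with z hz
    exact isLocalWeyl_chris H.torsion_free g H.compat (ι x₀) hz
  contDiffAt := contDiffAt_locMap H.contMDiff (mem_locDom ι x₀)
  injective := by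
    filter_upwards [H.eventually_locDom (mem_locDom ι x₀)] with r hr
    exact H.injective_fderiv hr
  contDiffAt_normal := by
    refine contDiffAt_normalField ?_ (H.isLocalWeyl (mem_locDom ι x₀))
      (contDiffAt_locMap H.contMDiff (mem_locDom ι x₀)) (H.injective_fderiv (mem_locDom ι x₀)) _
    rw [locMap_base]; exact contDiffAt_locMetric g _ (mem_extChartAt_target _)
  normal := by
    filter_upwards [H.eventually_locDom (mem_locDom ι x₀)] with r hr
    exact normalField_orthogonal (H.isLocalWeyl hr) (H.injective_fderiv hr) _
  normal_ne := by
    rw [H.normalField_base hξ]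
    intro h
    exact hξ0 (crd_injective (m := m) (n := n) (mem_locDom ι x₀) (extChartAt_to_inv x₀)
      (h.trans (map_zero _).symm))

/-- Near the base point, the mean curvature evaluated on the normal extension of `ξ`. -/
lemma eventually_meanCurv_eq [T2Space M] (hξ0 : ξ ≠ 0) :
    ∀ᶠ r in 𝓝 (extChartAt (𝓡 n) x₀ x₀),
      meanCurv n g D ι ((extChartAt (𝓡 n) x₀).symm r)
          (normalExt n g ι ξ ((extChartAt (𝓡 n) x₀).symm r))
        = localMean (chris D (ι x₀)) (locMetric g (ι x₀)) (locMap ι x₀)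
          (normalField (locMetric g (ι x₀)) (locMap ι x₀) (crd (ι x₀) (ι x₀) ξ)) r := by
  have hL := H.localHypersurface hξ hξ0
  filter_upwards [H.eventually_locDom (mem_locDom ι x₀), hL.normal.eventually_nhds,
    ((hL.contDiffAt_normal.of_le two_le_infty).eventually (by simp))] with r hr hn hd
  exact H.meanCurv_eq hr rfl (H.isNormal_normal _) (hd.differentiableAt (by simp)) hn
    (H.crdAlong_normalExt_base ξ hr).symm

omit H hξ in
lemma localMean_const_smul (Γ : EuclideanSpace ℝ (Fin m) → EuclideanSpace ℝ (Fin m) →L[ℝ]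
      EuclideanSpace ℝ (Fin m) →L[ℝ] EuclideanSpace ℝ (Fin m))
    (G : EuclideanSpace ℝ (Fin m) → EuclideanSpace ℝ (Fin m) →L[ℝ] EuclideanSpace ℝ (Fin m) →L[ℝ] ℝ)
    (φ : EuclideanSpace ℝ (Fin n) → EuclideanSpace ℝ (Fin m)) {ν : EuclideanSpace ℝ (Fin n) →
      EuclideanSpace ℝ (Fin m)} {q : EuclideanSpace ℝ (Fin n)} (hν : DifferentiableAt ℝ ν q)
    (c : ℝ) :
    localMean Γ G φ (fun r => c • ν r) q = c * localMean Γ G φ ν q := by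
  have h : shape Γ G φ (fun r => c • ν r) q = c • shape Γ G φ ν q := by
    ext1 v
    have := covAt_smul (Γ := Γ) (φ := φ) (differentiableAt_const c) hν v
    simp only [fderiv_const_apply, zero_apply, zero_smul, zero_add] at this
    rw [shape, ContinuousLinearMap.comp_apply, this, map_smul]
    rfl
  rw [localMean, localMean, h, ContinuousLinearMap.toLinearMap_smul, map_smul, smul_eq_mul]
  ring

/-- As the normal bundle has rank one, `∇^⊥ν = τ ⊗ ν` for the normal extension `ν` of `ξ`. -/
lemma crd_normalConn [T2Space M] (hξ0 : ξ ≠ 0) (X : TangentSpace (𝓡 n) x₀) :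
    crd (ι x₀) (ι x₀) (normalConn n g D ι (normalExt n g ι ξ) x₀ X)
      = normalForm (chris D (ι x₀)) (locMetric g (ι x₀)) (locMap ι x₀)
          (normalField (locMetric g (ι x₀)) (locMap ι x₀) (crd (ι x₀) (ι x₀) ξ))
          (extChartAt (𝓡 n) x₀ x₀) (crd x₀ x₀ X) • crd (ι x₀) (ι x₀) ξ := by
  have hp := mem_locDom (m := m) (n := n) ι x₀
  have hy := extChartAt_to_inv (I := 𝓡 n) x₀
  have hL := H.localHypersurface hξ hξ0
  have he : crdAlong ι x₀ (normalExt n g ι ξ) =ᶠ[𝓝 (extChartAt (𝓡 n) x₀ x₀)]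
      normalField (locMetric g (ι x₀)) (locMap ι x₀) (crd (ι x₀) (ι x₀) ξ) := by
    filter_upwards [H.eventually_locDom hp] with r hr
    exact H.crdAlong_normalExt_base ξ hr
  rw [normalConn, H.crd_normal_of_eq hp hy, H.crd_covAlong_apply hp hy
    (H.crdAlong_normalExt hp hy hξ).1, covAt_congr he]
  have h := eq_tangent_add_normal hL.finrank_eq hL.weyl_at hL.injective.self_of_nhds
    hL.normal.self_of_nhds hL.normal_ne (covAt (chris D (ι x₀)) (locMap ι x₀)
      (normalField (locMetric g (ι x₀)) (locMap ι x₀) (crd (ι x₀) (ι x₀) ξ))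
      (extChartAt (𝓡 n) x₀ x₀) (crd (k := n) x₀ x₀ X))
  rw [normalField, sub_eq_iff_eq_add']
  conv_rhs => rw [← H.normalField_base hξ]
  rw [H.normalField_base hξ] at h ⊢
  rw [normalForm, H.normalField_base hξ]
  exact h

/-- The derivative of the mean curvature, in coordinates. -/
lemma covMeanCurv_eq [T2Space M] (hξ0 : ξ ≠ 0) (X : TangentSpace (𝓡 n) x₀) :
    covMeanCurv n g D ι x₀ X ξ = covMean (chris D (ι x₀)) (locMetric g (ι x₀)) (locMap ι x₀)
      (normalField (locMetric g (ι x₀)) (locMap ι x₀) (crd (ι x₀) (ι x₀) ξ))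
      (extChartAt (𝓡 n) x₀ x₀) (crd (k := n) x₀ x₀ X) := by
  have hp := mem_locDom (m := m) (n := n) ι x₀
  have hy := extChartAt_to_inv (I := 𝓡 n) x₀
  have hL := H.localHypersurface hξ hξ0
  let f : N → ℝ := fun y => meanCurv n g D ι y (normalExt n g ι ξ y)
  have he : (fun r => f ((extChartAt (𝓡 n) x₀).symm r)) =ᶠ[𝓝 (extChartAt (𝓡 n) x₀ x₀)]
      localMean (chris D (ι x₀)) (locMetric g (ι x₀)) (locMap ι x₀)
        (normalField (locMetric g (ι x₀)) (locMap ι x₀) (crd (ι x₀) (ι x₀) ξ)) :=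
    H.eventually_meanCurv_eq hξ hξ0
  have hd := hL.contDiffAt_localMean.differentiableAt (by simp)
  have hνd := hL.contDiffAt_normal.differentiableAt (by simp)
  have h1 := mvfderiv_eq_fderiv_coord hp.1 hy (hd.congr_of_eventuallyEq he) X
  rw [he.fderiv_eq] at h1
  have h2 := H.meanCurv_eq hp hy (H.isNormal_normal (covAlong n D ι (normalExt n g ι ξ) x₀ X))
    (hνd.const_smul (normalForm (chris D (ι x₀)) (locMetric g (ι x₀)) (locMap ι x₀)
      (normalField (locMetric g (ι x₀)) (locMap ι x₀) (crd (ι x₀) (ι x₀) ξ))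
      (extChartAt (𝓡 n) x₀ x₀) (crd (k := n) x₀ x₀ X))) ?_ ?_
  · rw [covMean, ← localMean_const_smul _ _ _ hνd]
    exact congrArg₂ (· - ·) h1 h2
  · filter_upwards [hL.normal] with r hr w
    rw [Pi.smul_apply, map_smul, smul_apply, hr, smul_zero]
  · rw [Pi.smul_apply, H.normalField_base hξ]
    exact (H.crd_normalConn hξ hξ0 X).symm

end IsWeylHypersurface

end Hypersurface

/-! ### The divergence of the trace-free fundamental form, and conclusion -/

section

open Filter Topology

variable {U V : Type*} [NormedAddCommGroup U] [NormedSpace ℝ U] [FiniteDimensional ℝ U]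
  [NormedAddCommGroup V] [NormedSpace ℝ V] [FiniteDimensional ℝ V]
  {Γ : V → V →L[ℝ] V →L[ℝ] V} {G : V → V →L[ℝ] V →L[ℝ] ℝ} {α : V → V →L[ℝ] ℝ}
  {φ ν : U → V} {p : U}

/-- If `B = (b / |ν|²) ν` is the normal field with `G(B, ν) = b`, then
`G(∇_v B, ν) = db(v) - (α(v) + τ(v)) b`, where `∇^⊥ν = τ ⊗ ν`. -/
lemma LocalHypersurface.metric_covAt_normal (h : LocalHypersurface Γ G α φ ν p) {b : U → ℝ}
    (hb : DifferentiableAt ℝ b p) (v : U) :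
    G (φ p) (covAt Γ φ (fun r => (b r / G (φ r) (ν r) (ν r)) • ν r) p v) (ν p)
      = fderiv ℝ b p v - (α (φ p) (fderiv ℝ φ p v) + normalForm Γ G φ ν p v) * b p := by
  have hν := h.contDiffAt_normal.differentiableAt (by simp)
  have hφ := h.contDiffAt.differentiableAt (by simp)
  have hk := (h.weyl_at.metric_pos _ h.normal_ne).ne'
  have hkd : DifferentiableAt ℝ (fun r => G (φ r) (ν r) (ν r)) p :=
    ((h.weyl_at.differentiable.comp p hφ).clm_apply hν).clm_apply hν
  have hf : DifferentiableAt ℝ (fun r => b r / G (φ r) (ν r) (ν r)) p := by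
    simp only [div_eq_mul_inv]
    exact hb.mul (hkd.fun_inv hk)
  have hdk := fderiv_metric_along hφ h.weyl_at hν hν v
  rw [h.weyl_at.metric_symm (ν p) (covAt Γ φ ν p v)] at hdk
  have hprod : b =ᶠ[𝓝 p] fun r => (b r / G (φ r) (ν r) (ν r)) * G (φ r) (ν r) (ν r) := by
    filter_upwards [hkd.continuousAt.eventually_ne hk] with r hr
    field_simp
  have hdb : fderiv ℝ b p v = b p / G (φ p) (ν p) (ν p)
        * fderiv ℝ (fun r => G (φ r) (ν r) (ν r)) p v
      + G (φ p) (ν p) (ν p) * fderiv ℝ (fun r => b r / G (φ r) (ν r) (ν r)) p v := by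
    rw [hprod.fderiv_eq, fderiv_fun_mul hf hkd]
    simp only [add_apply, smul_apply, smul_eq_mul]
  rw [covAt_smul hf hν, map_add, add_apply, map_smul, map_smul, smul_apply, smul_apply, hdb, hdk,
    normalForm, smul_eq_mul, smul_eq_mul]
  field_simp
  ring

end

section Hypersurface

open Filter Topology

variable {m : ℕ} {n : ℕ}
  {M : Type*} [TopologicalSpace M] [ChartedSpace (EuclideanSpace ℝ (Fin m)) M]
  [IsManifold (𝓡 m) ∞ M]
  {N : Type*} [TopologicalSpace N] [ChartedSpace (EuclideanSpace ℝ (Fin n)) N]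
  [IsManifold (𝓡 n) ∞ N]

variable {D : AffineConnection m M} {g : Metric m M}
  {α : (x : M) → TangentSpace (𝓡 m) x →L[ℝ] ℝ} {ι : N → M}

namespace IsWeylHypersurface

variable (H : IsWeylHypersurface (n := n) D g α ι) {x₀ : N}
include H

/-- The induced connection of `N`, in coordinates. -/
lemma crd_inducedConn_ext (X Z : TangentSpace (𝓡 n) x₀) :
    crd x₀ x₀ (inducedConn n g D ι (ext X) x₀ Z)
      = tanProj (locMetric g (ι x₀)) (locMap ι x₀) (extChartAt (𝓡 n) x₀ x₀)
        (hess (chris D (ι x₀)) (locMap ι x₀) (extChartAt (𝓡 n) x₀ x₀) (crd x₀ x₀ Z)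
          (crd x₀ x₀ X)) := by
  have hp := mem_locDom (m := m) (n := n) ι x₀
  have hy := extChartAt_to_inv (I := 𝓡 n) x₀
  have he : crdField x₀ (ext X) =ᶠ[𝓝 (extChartAt (𝓡 n) x₀ x₀)] fun _ => crd x₀ x₀ X := by
    filter_upwards [(isOpen_extChartAt_target x₀).mem_nhds hp.1] with r hr
    exact crd_ext ((extChartAt (𝓡 n) x₀).map_target hr) X
  have hd : DifferentiableAt ℝ (crdField x₀ (ext X)) (extChartAt (𝓡 n) x₀ x₀) :=
    (differentiableAt_const _).congr_of_eventuallyEq he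
  rw [inducedConn, H.crd_tangential_of_eq hp hy, H.crd_covAlong_push hp hy hd, he.fderiv_eq,
    he.self_of_nhds, fderiv_const_apply, zero_apply, map_zero, add_zero]

variable {ξ : TangentSpace (𝓡 m) (ι x₀)} (hξ : IsNormal n g ι x₀ ξ)
include hξ

/-- In codimension one, the trace-free fundamental form is determined by its scalar version. -/
lemma eventually_crdAlong_fundFormTF [T2Space M] (hn0 : n ≠ 0) (hξ0 : ξ ≠ 0)
    (X Y : TangentSpace (𝓡 n) x₀) :
    crdAlong ι x₀ (fun y => fundFormTF n g D ι y (ext X y) (ext Y y))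
      =ᶠ[𝓝 (extChartAt (𝓡 n) x₀ x₀)] fun r =>
        (sffTF (chris D (ι x₀)) (locMetric g (ι x₀)) (locMap ι x₀)
            (normalField (locMetric g (ι x₀)) (locMap ι x₀) (crd (ι x₀) (ι x₀) ξ)) r
            (crd x₀ x₀ X) (crd x₀ x₀ Y)
          / locMetric g (ι x₀) (locMap ι x₀ r)
            (normalField (locMetric g (ι x₀)) (locMap ι x₀) (crd (ι x₀) (ι x₀) ξ) r)
            (normalField (locMetric g (ι x₀)) (locMap ι x₀) (crd (ι x₀) (ι x₀) ξ) r))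
          • normalField (locMetric g (ι x₀)) (locMap ι x₀) (crd (ι x₀) (ι x₀) ξ) r := by
  have hL := H.localHypersurface hξ hξ0
  filter_upwards [H.eventually_locDom (mem_locDom ι x₀), hL.normal.eventually_nhds,
    ((hL.contDiffAt_normal.of_le two_le_infty).eventually (by simp)),
    hL.contDiffAt_normal.continuousAt.eventually_ne hL.normal_ne] with r hr hn hd hne
  have hS := (extChartAt (𝓡 n) x₀).map_target hr.1
  have h1 := H.inner_fundFormTF hr rfl hn0 (H.isNormal_normal (ext ξ _))
    (hd.differentiableAt (by simp)) hn (H.crdAlong_normalExt_base ξ hr).symm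
    (ext X ((extChartAt (𝓡 n) x₀).symm r)) (ext Y ((extChartAt (𝓡 n) x₀).symm r))
  rw [inner_eq hr, crd_ext hS, crd_ext hS] at h1
  have h2 := H.crdAlong_normalExt_base ξ hr
  rw [crdAlong, normalExt] at h2
  rw [h2] at h1
  have h3 : ∀ w, locMetric g (ι x₀) (locMap ι x₀ r)
      (crdAlong ι x₀ (fun y => fundFormTF n g D ι y (ext X y) (ext Y y)) r)
      (fderiv ℝ (locMap ι x₀) r w) = 0 := (H.isNormal_iff hr rfl _).1 (H.isNormal_fundFormTF
    (ext X ((extChartAt (𝓡 n) x₀).symm r)) (ext Y ((extChartAt (𝓡 n) x₀).symm r)))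
  have h4 := eq_tangent_add_normal hL.finrank_eq (H.isLocalWeyl hr) (H.injective_fderiv hr)
    hn.self_of_nhds hne (crdAlong ι x₀ (fun y => fundFormTF n g D ι y (ext X y) (ext Y y)) r)
  rw [tanProj_eq_zero (H.isLocalWeyl hr) (H.injective_fderiv hr) h3, map_zero, zero_add] at h4
  refine h4.trans ?_
  rw [← h1]
  rfl

/-- The covariant derivative of the trace-free fundamental form, in coordinates. -/
lemma inner_covFundFormTF [T2Space M] (hn0 : n ≠ 0) (hξ0 : ξ ≠ 0)
    (Z X Y : TangentSpace (𝓡 n) x₀) :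
    g.inner (ι x₀) (covFundFormTF n g D ι x₀ Z X Y) ξ
      = covForm (chris D (ι x₀)) (locMetric g (ι x₀)) (locForm α (ι x₀)) (locMap ι x₀)
        (normalField (locMetric g (ι x₀)) (locMap ι x₀) (crd (ι x₀) (ι x₀) ξ))
        (sffTF (chris D (ι x₀)) (locMetric g (ι x₀)) (locMap ι x₀)
          (normalField (locMetric g (ι x₀)) (locMap ι x₀) (crd (ι x₀) (ι x₀) ξ)))
        (extChartAt (𝓡 n) x₀ x₀) (crd x₀ x₀ Z) (crd x₀ x₀ X) (crd x₀ x₀ Y) := by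
  have hp := mem_locDom (m := m) (n := n) ι x₀
  have hy := extChartAt_to_inv (I := 𝓡 n) x₀
  have hL := H.localHypersurface hξ hξ0
  have hν := hL.contDiffAt_normal.differentiableAt (by simp)
  have hνp := H.normalField_base hξ
  have he := H.eventually_crdAlong_fundFormTF hξ hn0 hξ0 X Y
  have hb := (hL.contDiffAt_sffTF (crd x₀ x₀ X) (crd x₀ x₀ Y)).differentiableAt (by simp)
  have hk := (hL.weyl_at.metric_pos _ hL.normal_ne).ne'
  have hkd : DifferentiableAt ℝ (fun r => locMetric g (ι x₀) (locMap ι x₀ r)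
      (normalField (locMetric g (ι x₀)) (locMap ι x₀) (crd (ι x₀) (ι x₀) ξ) r)
      (normalField (locMetric g (ι x₀)) (locMap ι x₀) (crd (ι x₀) (ι x₀) ξ) r))
      (extChartAt (𝓡 n) x₀ x₀) :=
    ((hL.weyl_at.differentiable.comp _ (hL.contDiffAt.differentiableAt (by simp))).clm_apply
      hν).clm_apply hν
  have hA : DifferentiableAt ℝ (crdAlong ι x₀
      (fun y => fundFormTF n g D ι y (ext X y) (ext Y y))) (extChartAt (𝓡 n) x₀ x₀) :=
    DifferentiableAt.congr_of_eventuallyEq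
      (by simp only [div_eq_mul_inv]; exact (hb.mul (hkd.fun_inv hk)).smul hν) he
  have h1 := hL.metric_covAt_normal hb (crd x₀ x₀ Z)
  rw [← covAt_congr he, ← H.crd_covAlong_apply hp hy hA, hνp, ← inner_eq_of_eq hp hy] at h1
  have hTF := H.inner_fundFormTF hp hy hn0 hξ hν hL.normal hνp
  rw [covFundFormTF, map_sub, map_sub, sub_apply, sub_apply, normalConn, inner_normal _ hξ, h1,
    hTF, hTF, H.crd_inducedConn_ext, H.crd_inducedConn_ext, covForm]

/-- The divergence of the trace-free fundamental form, in coordinates. -/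
lemma codiff_eq [T2Space M] (hn0 : n ≠ 0) (hξ0 : ξ ≠ 0) (X : TangentSpace (𝓡 n) x₀) :
    codiff n g D ι x₀ X ξ
      = metricTrace (fun v w : EuclideanSpace ℝ (Fin n) => locMetric g (ι x₀)
          (locMap ι x₀ (extChartAt (𝓡 n) x₀ x₀))
          (fderiv ℝ (locMap ι x₀) (extChartAt (𝓡 n) x₀ x₀) v)
          (fderiv ℝ (locMap ι x₀) (extChartAt (𝓡 n) x₀ x₀) w))
        (fun z y => covForm (chris D (ι x₀)) (locMetric g (ι x₀)) (locForm α (ι x₀)) (locMap ι x₀)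
          (normalField (locMetric g (ι x₀)) (locMap ι x₀) (crd (ι x₀) (ι x₀) ξ))
          (sffTF (chris D (ι x₀)) (locMetric g (ι x₀)) (locMap ι x₀)
            (normalField (locMetric g (ι x₀)) (locMap ι x₀) (crd (ι x₀) (ι x₀) ξ)))
          (extChartAt (𝓡 n) x₀ x₀) z (crd x₀ x₀ X) y) := by
  have hp := mem_locDom (m := m) (n := n) ι x₀
  have hy := extChartAt_to_inv (I := 𝓡 n) x₀
  rw [codiff, inner_metricTrace]
  have h1 : inducedMetric n g ι x₀ = fun v w : TangentSpace (𝓡 n) x₀ => locMetric g (ι x₀)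
      (locMap ι x₀ (extChartAt (𝓡 n) x₀ x₀))
      (fderiv ℝ (locMap ι x₀) (extChartAt (𝓡 n) x₀ x₀) (crd x₀ x₀ v))
      (fderiv ℝ (locMap ι x₀) (extChartAt (𝓡 n) x₀ x₀) (crd x₀ x₀ w)) := by
    funext v w
    rw [← H.crd_push_of_eq hp hy, ← H.crd_push_of_eq hp hy, ← inner_eq_of_eq hp hy]
    rfl
  have h2 : (fun v w => g.inner (ι x₀) (covFundFormTF n g D ι x₀ v X w) ξ) = _ :=
    funext fun v => funext fun w => H.inner_covFundFormTF hξ hn0 hξ0 v X w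
  rw [h1, h2]
  -- the trivialization at `x₀` is the identity on `T_{x₀}N`
  simp only [crd_self]
  rfl

/-- The vanishing of the mixed Schouten-Weyl tensor on a nonzero normal vector. -/
lemma mixedSchoutenWeyl_eq_zero_of_ne [T2Space M] (hn : 2 ≤ n) (hξ0 : ξ ≠ 0)
    (X : TangentSpace (𝓡 n) x₀) : mixedSchoutenWeyl n g D ι x₀ X ξ = 0 := by
  have hp := mem_locDom (m := m) (n := n) ι x₀
  have hy := extChartAt_to_inv (I := 𝓡 n) x₀
  have h := (H.localHypersurface hξ hξ0).mixed_eq_zero (by simpa using hn) (crd x₀ x₀ X)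
  have h0 : g.inner (ι x₀) (push (m := m) n ι x₀ X) ξ = 0 := by rw [g.symm, hξ]
  rw [H.normalField_base hξ, ← H.crd_push_of_eq hp hy, locMap_base, ← ricci_eq H.smooth,
    ← ricci_eq H.smooth, ← faraday_eq H.smooth, ← H.covMeanCurv_eq hξ hξ0, ← locMap_base (n := n),
    ← H.codiff_eq hξ (by omega) hξ0, finrank_euclideanSpace_fin, finrank_euclideanSpace_fin] at h
  rw [mixedSchoutenWeyl, schoutenWeyl, h0, ricciSymm, mul_zero, mul_zero, sub_zero, add_zero]
  exact h

omit hξ in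
lemma meanCurv_zero (y : N) : meanCurv n g D ι y (0 : TangentSpace (𝓡 m) (ι y)) = 0 := by
  have hp := mem_locDom (m := m) (n := n) ι y
  rw [H.meanCurv_eq hp (extChartAt_to_inv y) (ν := fun _ => 0) (fun v => by simp)
    (differentiableAt_const _) (by simp) (by simp)]
  have := localMean_const_smul (chris D (ι y)) (locMetric g (ι y)) (locMap (n := n) (m := m) ι y)
    (ν := fun _ => 0) (q := extChartAt (𝓡 n) y y) (differentiableAt_const _) 0
  simpa using this

omit hξ in
/-- Here `0` has the zero section as normal extension, at least near `x₀`. -/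
lemma covMeanCurv_zero (X : TangentSpace (𝓡 n) x₀) : covMeanCurv n g D ι x₀ X 0 = 0 := by
  have hp := mem_locDom (m := m) (n := n) ι x₀
  have hy := extChartAt_to_inv (I := 𝓡 n) x₀
  have h0 : ∀ r ∈ locDom (m := m) (n := n) ι x₀,
      crdAlong ι x₀ (normalExt n g ι (x := x₀) 0) r = 0 := by
    intro r hr
    rw [H.crdAlong_normalExt_base _ hr, map_zero, normalField, map_zero, map_zero, sub_zero]
  have he : crdAlong ι x₀ (normalExt n g ι (x := x₀) 0) =ᶠ[𝓝 (extChartAt (𝓡 n) x₀ x₀)]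
      fun _ => 0 := by
    filter_upwards [H.eventually_locDom hp] with r hr
    exact h0 r hr
  let f : N → ℝ := fun y => meanCurv n g D ι y (normalExt n g ι (x := x₀) 0 y)
  have hf : (fun r => f ((extChartAt (𝓡 n) x₀).symm r)) =ᶠ[𝓝 (extChartAt (𝓡 n) x₀ x₀)]
      fun _ => 0 := by
    filter_upwards [H.eventually_locDom hp] with r hr
    have : normalExt n g ι (x := x₀) 0 ((extChartAt (𝓡 n) x₀).symm r) = 0 :=
      crd_injective (m := m) (n := n) hr rfl ((h0 r hr).trans (map_zero _).symm)
    change meanCurv n g D ι _ (normalExt n g ι (x := x₀) 0 _) = 0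
    rw [this, H.meanCurv_zero]
  have h1 := mvfderiv_eq_fderiv_coord hp.1 hy
    ((differentiableAt_const (0 : ℝ)).congr_of_eventuallyEq hf) X
  rw [hf.fderiv_eq, fderiv_const_apply, zero_apply] at h1
  have h2 : normalConn n g D ι (normalExt n g ι (x := x₀) 0) x₀ X = 0 := by
    refine crd_injective hp hy ?_
    rw [normalConn, H.crd_normal_of_eq hp hy, H.crd_covAlong_apply hp hy
      ((differentiableAt_const _).congr_of_eventuallyEq he), covAt_congr he, covAt_apply]
    simp [normalField]
  rw [covMeanCurv, h2, H.meanCurv_zero, sub_zero]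
  exact h1

omit hξ in
/-- Every term of `μ_X(ξ)` is linear in `ξ`. -/
lemma mixedSchoutenWeyl_zero [T2Space M] (X : TangentSpace (𝓡 n) x₀) :
    mixedSchoutenWeyl n g D ι x₀ X 0 = 0 := by
  have hr : ∀ (z v : EuclideanSpace ℝ (Fin m)), localRicci (chris D (ι x₀)) z v 0 = 0 := by
    intro z v
    have : curvLeft (chris D (ι x₀)) z v 0 = 0 := by
      ext1 u
      simp [curvLeft, localCurv]
    rw [localRicci, this, map_zero]
  have hr' : ∀ (z v : EuclideanSpace ℝ (Fin m)), localRicci (chris D (ι x₀)) z 0 v = 0 := by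
    intro z v
    have : curvLeft (chris D (ι x₀)) z 0 v = 0 := by
      ext1 u
      simp [curvLeft, localCurv]
    rw [localRicci, this, map_zero]
  have hF : ∀ (z v : EuclideanSpace ℝ (Fin m)), localFaraday (chris D (ι x₀)) z v 0 = 0 := by
    intro z v
    have : curvRight (chris D (ι x₀)) z v 0 = 0 := by
      ext1 u
      simp [curvRight, localCurv]
    rw [localFaraday, this, map_zero, zero_div]
  rw [mixedSchoutenWeyl, schoutenWeyl, ricciSymm, ricci_eq H.smooth, ricci_eq H.smooth,
    faraday_eq H.smooth, map_zero, hr, hr', hF, H.covMeanCurv_zero, codiff, map_zero, map_zero]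
  simp

end IsWeylHypersurface

end Hypersurface

end ConfGeom

end

theorem proposition4p9 {m n : ℕ} (hm : 3 ≤ m) (hmn : m = n + 1)
    {M : Type*} [TopologicalSpace M] [T2Space M]
    [ChartedSpace (EuclideanSpace ℝ (Fin m)) M] [IsManifold (𝓡 m) ∞ M]
    {N : Type*} [TopologicalSpace N]
    [ChartedSpace (EuclideanSpace ℝ (Fin n)) N] [IsManifold (𝓡 n) ∞ N]
    (c : ConfGeom.ConformalStructure m M)
    (ι : N → M) (hι : IsSmoothEmbedding (𝓡 n) (𝓡 m) ∞ ι)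
    (D : ConfGeom.WeylStructure c) (g : ConfGeom.Metric m M) (hg : c.Contains g)
    (x : N) (X : TangentSpace (𝓡 n) x) (ξ : TangentSpace (𝓡 m) (ι x))
    (hξ : ConfGeom.IsNormal n g ι x ξ) :
    ConfGeom.mixedSchoutenWeyl n g D.conn ι x X ξ = 0 := by
  obtain ⟨α, hα⟩ := D.conformal g hg
  have H : ConfGeom.IsWeylHypersurface (n := n) D.conn g α ι :=
    { smooth := D.smooth
      torsion_free := D.torsion_free
      compat := hα
      contMDiff := hι.contMDiff
      injective := ConfGeom.injective_push hι.isImmersion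
      dim_eq := hmn }
  by_cases hξ0 : ξ = 0
  · rw [hξ0]
    exact H.mixedSchoutenWeyl_zero X
  · exact H.mixedSchoutenWeyl_eq_zero_of_ne hξ (by omega) hξ0 X
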